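/- Let $1<p<\infty$, let $X$ and $D$ be Banach spaces with $D$ continuously, densely and compactly embedded in $X$, and let $\mathcal L(D;X)$ be the space of bounded linear operators from $D$ to $X$. For an open interval $I$ that is bounded from below put $a=\inf I$ and $MR^p(I)=L^p(I;D)\cap W^{1,p}(I;X)$ with the norm $$\|u\|_{MR^p(I)}=\Big(\|u\|_{L^p(I;X)}^p+\|u\|_{L^p(I;D)}^p+w_I^p\,\|u'\|_{L^p(I;X)}^p\Big)^{1/p},$$ where $w_I=|I|$ if $I$ is bounded and $w_I=1$ otherwise. A map $A:I\to\mathcal L(D;X)$ is strongly measurable if $A(\cdot)x$ is Bochner measurable for every $x\in D$; it belongs to $L^\infty(I;\mathcal L(D;X))$ if moreover $\|A(\cdot)x\|_X$ is essentially bounded for every $x\in D$. We say that $A\in\mathcal{MR}_p(I)$ if $A\in L^\infty(I;\mathcal L(D;X))$, if for every $t\in I$ the graph norm $\|x\|_X+\|A(t)x\|_X$ is equivalent to $\|x\|_D$, and if for every $f\in L^p(I;X)$ there is a unique $v\in MR^p(I)$ with $v'(t)+A(t)v(t)=f(t)$ for a.e. $t\in I$ and $v(a)=0$, and $\|v\|_{MR^p(I)}\le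 K\|f\|_{L^p(I;X)}$ with some $K\ge 0$ independent of $f$. The infimum of these $K$ is denoted $[A]_{\mathcal{MR}_p(I)}$. For a single operator $A\in\mathcal L(D;X)$, viewed as a constant map, we write $A\in mr_p(I)$ and $[A]_{mr_p(I)}$ instead. For $\nu\in\mathbb R$ let $\nu_+=\max(\nu,0)$, $\nu_-=\max(-\nu,0)$ and $$c_p(\nu)=\big(|\nu|+\kappa_p(\nu)\big)\big(1+e^{p\nu_-}-e^{-p\nu_+}\big)^{1/p},\qquad |\nu|+\kappa_p(\nu)=\inf_{0<\mu<1}\max\big(1+\mu^{1-p}|\nu|^p,\,(1-\mu)^{1-p}\big)^{1/p}.$$ Then $\kappa_p(0)=1$ and $\kappa_p(\nu)/|\nu|\to0$ as $\nu\to\pm\infty$. **Theorem.** Let $A_0\in mr_p(\mathbb R_+)$, $\mathbb R_+=(0,\infty)$. Then $-A_0$, with domain $D$, generates a bounded strongly continuous semigroup $(e^{-\tau A_0})_{\tau\ge0}$ on $X$; put $M_0=\sup_{\tau\ge0}\|e^{-\tau A_0}\|_{\mathcal L(X)}$. Let $I$ be a nonempty bounded open interval. Then $A_0\in mr_p(I)$;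 put $$\varepsilon_0=\frac{1}{2\,([A_0]_{mr_p(I)}+1)(M_0+1)}.$$ Let $B:I\to\mathcal L(D;X)$ be strongly measurable, let $\eta\ge0$, and assume that $$\|B(t)x\|_X\le\varepsilon_0\|x\|_D+\eta\|x\|_X\qquad\text{for all }t\in I,\ x\in D.$$ Then $A_0+B\in\mathcal{MR}_p(I)$ and $$[A_0+B]_{\mathcal{MR}_p(I)}\le 4\,(1+M_0)\,c_p\big(-4M_0\,\eta\,|I|\big)\,[A_0]_{mr_p(I)}.$$ -/

import Mathlib

open MeasureTheory Set Filter Topology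
open scoped NNReal ContDiff

noncomputable section

namespace MaxReg

variable {X D : Type*} [NormedAddCommGroup X] [NormedSpace ℝ X]
  [NormedAddCommGroup D] [NormedSpace ℝ D]

/-- `u` represents an element of the Bochner space `L^p(I; Y)`. -/
def MemLpOn {Y : Type*} [NormedAddCommGroup Y] (p : ℝ) (I : Set ℝ) (u : ℝ → Y) : Prop :=
  MemLp u (ENNReal.ofReal p) (volume.restrict I)

/-- The norm of `L^p(I; Y)`. -/
def lpNormOn {Y : Type*} [NormedAddCommGroup Y] (p : ℝ) (I : Set ℝ) (u : ℝ → Y) : ℝ :=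
  (eLpNorm u (ENNReal.ofReal p) (volume.restrict I)).toReal

/-- `g` is a weak derivative of `v` on the open set `I`, tested against `C_c^∞(I; ℝ)`. -/
def IsWeakDeriv (I : Set ℝ) (v g : ℝ → X) : Prop :=
  ∀ φ : ℝ → ℝ, ContDiff ℝ ∞ φ → HasCompactSupport φ → tsupport φ ⊆ I →
    -∫ t in I, deriv φ t • v t = ∫ t in I, φ t • g t

/-- `v` represents an element of the Sobolev space `W^{1,p}(I; X)`. -/
def MemW1p (p : ℝ) (I : Set ℝ) (v : ℝ → X) : Prop :=
  MemLpOn p I v ∧ ∃ g : ℝ → X, MemLpOn p I g ∧ IsWeakDeriv I v g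

open Classical in
/-- The weak derivative of `v ∈ W^{1,p}(I; X)`; it is unique up to a null subset of `I`
(junk value `0` if `v` is not in `W^{1,p}(I; X)`). -/
def weakDeriv (p : ℝ) (I : Set ℝ) (v : ℝ → X) : ℝ → X :=
  if h : MemW1p p I v then h.2.choose else 0

/-- `u` represents an element of `MR^p(I) = L^p(I; D) ∩ W^{1,p}(I; X)`; the inclusion of `D`
in `X` is the injective map `ι`. -/
def MemMR (p : ℝ) (I : Set ℝ) (ι : D →L[ℝ] X) (u : ℝ → D) : Prop :=
  MemLpOn p I u ∧ MemW1p p I (fun t => ι (u t))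

open Classical in
/-- The weight of the derivative in the norm of `MR^p(I)`: the length `|I|` if the interval `I`
(always bounded from below) is bounded, and `1` if it is unbounded. -/
def derivWeight (I : Set ℝ) : ℝ :=
  if BddAbove I then volume.real I else 1

/-- The norm of `MR^p(I)`. -/
def mrNorm (p : ℝ) (I : Set ℝ) (ι : D →L[ℝ] X) (u : ℝ → D) : ℝ :=
  (lpNormOn p I (fun t => ι (u t)) ^ p + lpNormOn p I u ^ p
    + derivWeight I ^ p * lpNormOn p I (weakDeriv p I (fun t => ι (u t))) ^ p) ^ (1 / p)

/-- The value at the left endpoint `inf I` of the representative of `v` that is continuous on the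
closure of `I` exists and equals `x`. -/
def HasInitialValue (I : Set ℝ) (v : ℝ → X) (x : X) : Prop :=
  ∃ c : ℝ → X, ContinuousOn c (closure I) ∧ (∀ᵐ t ∂(volume.restrict I), c t = v t) ∧
    c (sInf I) = x

/-- `u ∈ MR^p(I)` solves `u' + A(t) u = f` a.e. on `I`, `u(inf I) = 0`. -/
def IsSolution (p : ℝ) (I : Set ℝ) (ι : D →L[ℝ] X) (A : ℝ → D →L[ℝ] X) (f : ℝ → X)
    (u : ℝ → D) : Prop :=
  MemMR p I ι u ∧ HasInitialValue I (fun t => ι (u t)) 0 ∧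
    ∀ᵐ t ∂(volume.restrict I), weakDeriv p I (fun t => ι (u t)) t + A t (u t) = f t

/-- `K ≥ 0` is an admissible constant in the maximal regularity inequality. -/
def IsMRBound (p : ℝ) (I : Set ℝ) (ι : D →L[ℝ] X) (A : ℝ → D →L[ℝ] X) (K : ℝ) : Prop :=
  0 ≤ K ∧ ∀ (f : ℝ → X) (u : ℝ → D), MemLpOn p I f → IsSolution p I ι A f u →
    mrNorm p I ι u ≤ K * lpNormOn p I f

/-- Unique solvability of the Cauchy problem (up to equality a.e. on `I`) for every right-hand
side in `L^p(I; X)`, together with the maximal regularity inequality. -/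
def CauchyWellPosed (p : ℝ) (I : Set ℝ) (ι : D →L[ℝ] X) (A : ℝ → D →L[ℝ] X) : Prop :=
  (∀ f : ℝ → X, MemLpOn p I f → ∃ u : ℝ → D, IsSolution p I ι A f u ∧
    ∀ v : ℝ → D, IsSolution p I ι A f v → ∀ᵐ t ∂(volume.restrict I), v t = u t) ∧
  ∃ K : ℝ, IsMRBound p I ι A K

/-- The maximal regularity constant: the infimum of the admissible constants. -/
def mrConst (p : ℝ) (I : Set ℝ) (ι : D →L[ℝ] X) (A : ℝ → D →L[ℝ] X) : ℝ :=
  sInf {K : ℝ | IsMRBound p I ι A K}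

/-- The graph norm `‖x‖_X + ‖A x‖_X` of `A` is equivalent to the norm of `D`. -/
def GraphNormEquiv (ι A : D →L[ℝ] X) : Prop :=
  ∃ c C : ℝ, 0 < c ∧ 0 < C ∧ ∀ x : D,
    c * ‖x‖ ≤ ‖ι x‖ + ‖A x‖ ∧ ‖ι x‖ + ‖A x‖ ≤ C * ‖x‖

/-- The class `mr_p(I)` of maximally regular autonomous operators. -/
def AutMaxReg (p : ℝ) (I : Set ℝ) (ι A : D →L[ℝ] X) : Prop :=
  GraphNormEquiv ι A ∧ CauchyWellPosed p I ι (fun _ => A)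

/-- The maximal regularity constant of an autonomous operator. -/
def autConst (p : ℝ) (I : Set ℝ) (ι A : D →L[ℝ] X) : ℝ :=
  mrConst p I ι (fun _ => A)

/-- Strong measurability on `I` of a nonautonomous operator. -/
def StronglyMeasurableOp (I : Set ℝ) (A : ℝ → D →L[ℝ] X) : Prop :=
  ∀ x : D, AEStronglyMeasurable (fun t => A t x) (volume.restrict I)

/-- The space `L^∞(I; L(D; X))`. -/
def MemLinftyOp (I : Set ℝ) (A : ℝ → D →L[ℝ] X) : Prop :=
  StronglyMeasurableOp I A ∧ ∀ x : D, ∃ C : ℝ, ∀ᵐ t ∂(volume.restrict I), ‖A t x‖ ≤ C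

/-- The class `MR_p(I)` of maximally regular nonautonomous operators. -/
def NonautMaxReg (p : ℝ) (I : Set ℝ) (ι : D →L[ℝ] X) (A : ℝ → D →L[ℝ] X) : Prop :=
  MemLinftyOp I A ∧ (∀ t ∈ I, GraphNormEquiv ι (A t)) ∧ CauchyWellPosed p I ι A

/-- `T` is the strongly continuous semigroup `(e^{-τA})_{τ ≥ 0}` on `X`: its infinitesimal
generator is `-A`, with domain exactly (the image in `X` of) `D`. -/
structure IsSemigroupOf (ι A : D →L[ℝ] X) (T : ℝ≥0 → X →L[ℝ] X) : Prop where
  zero : T 0 = ContinuousLinearMap.id ℝ X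
  add : ∀ s t : ℝ≥0, T (s + t) = (T s).comp (T t)
  continuous : ∀ x : X, Continuous fun t => T t x
  generator : ∀ x y : X,
    Tendsto (fun h : ℝ≥0 => (h : ℝ)⁻¹ • (T h x - x)) (𝓝[>] 0) (𝓝 y) ↔
      ∃ d : D, ι d = x ∧ y = -(A d)

/-- `sup_{τ ≥ 0} ‖T(τ)‖`. -/
def semigroupSup (T : ℝ≥0 → X →L[ℝ] X) : ℝ := ⨆ τ : ℝ≥0, ‖T τ‖

/-- `α_p(ν) = inf_{0 < μ < 1} max(1 + μ^{1-p} |ν|^p, (1-μ)^{1-p})^{1/p}`. -/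
def alphaP (p ν : ℝ) : ℝ :=
  ⨅ μ : Ioo (0 : ℝ) 1,
    (max (1 + (μ : ℝ) ^ (1 - p) * |ν| ^ p) ((1 - (μ : ℝ)) ^ (1 - p))) ^ (1 / p)

/-- `κ_p(ν) = α_p(ν) - |ν|`. -/
def kappaP (p ν : ℝ) : ℝ := alphaP p ν - |ν|

/-- `c_p(ν) = (|ν| + κ_p(ν)) (1 + e^{p ν₋} - e^{-p ν₊})^{1/p}`, where `ν₊ = max(ν, 0)` and
`ν₋ = max(-ν, 0)`. -/
def cP (p ν : ℝ) : ℝ :=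
  (|ν| + kappaP p ν) *
    (1 + Real.exp (p * max (-ν) 0) - Real.exp (-(p * max ν 0))) ^ (1 / p)

end MaxReg

end

noncomputable section

namespace MaxReg

/-! ### The constants `alphaP`, `kappaP` and their asymptotics -/

section

/-! The perturbation result is a fixed point argument in a damped norm. Write $a=\inf I$, $M=M_0$,
$K_0=[A_0]_{mr_p(I)}$, $\varphi(t)=e^{-l(t-a)}$. If $u'+A_0u=F$ and $u(a)=0$, then $v=\varphi u$
solves $v'+A_0v=\varphi F-lv$. Variation of constants gives $\|u(t)\|_X\le M\int_a^t\|F\|$, hence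
$\|v(t)\|_X\le M\int_a^te^{-l(t-r)}\|\varphi F(r)\|\,dr$, and Young's inequality yields
$l\|v\|_{L^p(X)}\le M\|\varphi F\|_{L^p}$. Maximal regularity then gives $\|v\|_{MR}\le
K_0(1+M)\|\varphi F\|_{L^p}$. With $l=4M\eta$ these two bounds show $\|\varphi
Bu\|\le(\tfrac12+\tfrac14)\|\varphi F\|$, the first part because $\varepsilon_0K_0(1+M)\le\tfrac12$.
So $F\mapsto f-Bu_F$ is a contraction with constant $3/4$, its fixed point solves the perturbed
problem, and $\|\varphi F\|\le4\|f\|$. Returning from $v$ to $u$ costs $e^{l|I|}$, and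
$\alpha_p(l|I|)$ for the term $lv$ in $e^{-l(t-a)}u'=v'+lv$; the product is $c_p(-l|I|)$. The lemmas
are `PerturbSetting.mul_lpNormOn_le`, `PerturbSetting.mrNorm_le`,
`PerturbSetting.lpNormOn_perturbation_le`, `PerturbSetting.exists_perturbed` and
`PerturbSetting.mrNorm_le_undamped`.

The semigroup is obtained from maximal regularity on the half-line, with some constant $K$.
Uniqueness passes to bounded intervals by continuing an integrated solution past the right endpoint
(`HalfLineMR.eq_zero_of_bounded`), so the bounds there hold with the same $K$. If $u'+Au=0$,
$u(0)=x\in D$, then $\int_0^tu$ and $tu(t)$ vanish at $0$ and solve the inhomogeneous equation with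
data $x$ and $u$; applying the bound for the derivative to both gives $\|u(b)\|_X\le K^2\|x\|_X$
(`IsOrbit.norm_le`). Hence the solution operators extend boundedly from $D$ to $X$, and closedness
of $A$ identifies the generator. The same estimate applies to the orbits of any semigroup generated
by $-A$, so all of them are bounded.

Every Cauchy problem is handled in integrated form (`ZeroSol`), which is equivalent to the Sobolev
formulation by `hasInitialValue_zero_and_isWeakDeriv_iff`. -/

lemma alphaP_term_nonneg (p ν : ℝ) (μ : Ioo (0 : ℝ) 1) :
    0 ≤ (max (1 + (μ : ℝ) ^ (1 - p) * |ν| ^ p) ((1 - (μ : ℝ)) ^ (1 - p))) ^ (1 / p) := by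
  have := μ.2.1
  apply Real.rpow_nonneg
  apply le_max_of_le_left
  positivity

lemma alphaP_bddBelow (p ν : ℝ) : BddBelow (range fun μ : Ioo (0 : ℝ) 1 =>
    (max (1 + (μ : ℝ) ^ (1 - p) * |ν| ^ p) ((1 - (μ : ℝ)) ^ (1 - p))) ^ (1 / p)) :=
  ⟨0, by rintro _ ⟨μ, rfl⟩; exact alphaP_term_nonneg p ν μ⟩

instance : Nonempty (Ioo (0 : ℝ) 1) := ⟨⟨1 / 2, by norm_num, by norm_num⟩⟩

lemma alphaP_le (p ν : ℝ) {μ : ℝ} (h0 : 0 < μ) (h1 : μ < 1) : alphaP p ν ≤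
    (max (1 + μ ^ (1 - p) * |ν| ^ p) ((1 - μ) ^ (1 - p))) ^ (1 / p) :=
  ciInf_le (alphaP_bddBelow p ν) ⟨μ, h0, h1⟩

/-- Since $1-p<0$, the factor $\mu^{1-p}$ is at least $1$, so every competitor already dominates
$(|\nu|^p)^{1/p}$. -/
lemma abs_le_alphaP {p : ℝ} (hp : 1 < p) (ν : ℝ) : |ν| ≤ alphaP p ν := by
  refine le_ciInf fun μ => ?_
  have hμ := μ.2.1
  have h1 : 1 ≤ (μ : ℝ) ^ (1 - p) :=
    Real.one_le_rpow_of_pos_of_le_one_of_nonpos hμ μ.2.2.le (by linarith)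
  have h2 : 0 ≤ |ν| ^ p := by positivity
  calc |ν| = (|ν| ^ p) ^ (1 / p) := by
        rw [one_div, Real.rpow_rpow_inv (abs_nonneg _) (by linarith)]
    _ ≤ _ := by
        refine Real.rpow_le_rpow h2 (le_max_of_le_left ?_) (by positivity)
        nlinarith

lemma alphaP_zero {p : ℝ} (hp : 1 < p) : alphaP p 0 = 1 := by
  apply le_antisymm
  -- At $\nu=0$ the maximum is $(1-\mu)^{1-p}$, which tends to $1$ as $\mu\to0$.
  · have hlim : Tendsto (fun μ : ℝ => ((1 - μ) ^ (1 - p)) ^ (1 / p)) (𝓝[>] 0) (𝓝 1) := by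
      have : ContinuousAt (fun μ : ℝ => ((1 - μ) ^ (1 - p)) ^ (1 / p)) 0 := by
        refine ContinuousAt.rpow_const (ContinuousAt.rpow_const (by fun_prop) ?_) ?_ <;> simp
      simpa using this.tendsto.mono_left nhdsWithin_le_nhds
    refine ge_of_tendsto hlim ?_
    filter_upwards [Ioo_mem_nhdsGT (show (0 : ℝ) < 1 by norm_num)] with μ hμ
    refine (alphaP_le p 0 hμ.1 hμ.2).trans (le_of_eq ?_)
    congr 1
    rw [abs_zero, Real.zero_rpow (by linarith), mul_zero, add_zero]
    exact max_eq_right (Real.one_le_rpow_of_pos_of_le_one_of_nonpos (by linarith [hμ.2])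
      (by linarith [hμ.1]) (by linarith))
  · refine le_ciInf fun μ => ?_
    apply Real.one_le_rpow _ (by positivity)
    rw [abs_zero, Real.zero_rpow (by linarith), mul_zero, add_zero]
    exact le_max_left _ _

lemma kappaP_zero {p : ℝ} (hp : 1 < p) : kappaP p 0 = 1 := by
  simp [kappaP, alphaP_zero hp]

/-- Fix $\mu$ so close to $1$ that $\mu^{(1-p)/p}<1+\varepsilon$. For large $|\nu|$ the first entry
of the maximum wins, and $\alpha_p(\nu)/|\nu|\le(|\nu|^{-p}+\mu^{1-p})^{1/p}$, whose limit is
$\mu^{(1-p)/p}$. -/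
lemma eventually_kappaP_div_le {p : ℝ} (hp : 1 < p) {ε : ℝ} (hε : 0 < ε) :
    ∀ᶠ r : ℝ in atTop, ∀ ν : ℝ, |ν| = r → kappaP p ν / |ν| < ε := by
  obtain ⟨μ, hμ, hμε⟩ : ∃ μ ∈ Ioo (0 : ℝ) 1, (μ ^ (1 - p)) ^ (1 / p) < 1 + ε := by
    have hlim : Tendsto (fun μ : ℝ => (μ ^ (1 - p)) ^ (1 / p)) (𝓝[<] 1) (𝓝 1) := by
      have : ContinuousAt (fun μ : ℝ => (μ ^ (1 - p)) ^ (1 / p)) 1 := by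
        refine ContinuousAt.rpow_const (ContinuousAt.rpow_const (by fun_prop) ?_) ?_ <;> simp
      simpa using this.tendsto.mono_left nhdsWithin_le_nhds
    have := (hlim.eventually (gt_mem_nhds (show (1 : ℝ) < 1 + ε by linarith))).and
      (Ioo_mem_nhdsLT (show (0 : ℝ) < 1 by norm_num))
    obtain ⟨μ, h1, h2⟩ := this.exists
    exact ⟨μ, h2, h1⟩
  have hrp : Tendsto (fun r : ℝ => r ^ p) atTop atTop := tendsto_rpow_atTop (by linarith)
  have hlim : Tendsto (fun r : ℝ => ((r ^ p)⁻¹ + μ ^ (1 - p)) ^ (1 / p)) atTop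
      (𝓝 ((0 + μ ^ (1 - p)) ^ (1 / p))) := by
    refine Tendsto.rpow_const ((tendsto_inv_atTop_zero.comp hrp).add_const _) ?_
    right; positivity
  rw [zero_add] at hlim
  have hc : ∀ᶠ r : ℝ in atTop, (1 - μ) ^ (1 - p) ≤ r ^ p := hrp.eventually_ge_atTop _
  filter_upwards [hlim.eventually (gt_mem_nhds hμε), hc, eventually_gt_atTop 0] with r h1 h2 h3 ν hν
  rw [kappaP, hν, sub_div, div_self h3.ne', sub_lt_iff_lt_add']
  refine lt_of_le_of_lt ?_ h1
  rw [div_le_iff₀ h3]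
  refine (alphaP_le p ν hμ.1 hμ.2).trans ?_
  have hm : max (1 + μ ^ (1 - p) * |ν| ^ p) ((1 - μ) ^ (1 - p)) = 1 + μ ^ (1 - p) * |ν| ^ p := by
    apply max_eq_left
    rw [hν]
    have : 1 ≤ μ ^ (1 - p) :=
      Real.one_le_rpow_of_pos_of_le_one_of_nonpos hμ.1 hμ.2.le (by linarith)
    have h4 : 0 < r ^ p := by positivity
    nlinarith
  rw [hm, hν]
  have h4 : 0 < r ^ p := by positivity
  have : r = (r ^ p) ^ (1 / p) := by
    rw [one_div, Real.rpow_rpow_inv h3.le (by linarith)]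
  have h5 : 0 < μ ^ (1 - p) := Real.rpow_pos_of_pos hμ.1 _

  nth_rewrite 3 [this]
  rw [← Real.mul_rpow (by positivity) (by positivity)]
  apply le_of_eq
  congr 1
  field_simp

lemma tendsto_kappaP_div {p : ℝ} (hp : 1 < p) {l : Filter ℝ} (hl : Tendsto (fun ν => |ν|) l atTop) :
    Tendsto (fun ν : ℝ => kappaP p ν / |ν|) l (𝓝 0) := by
  rw [Metric.tendsto_nhds]
  intro ε hε
  filter_upwards [hl.eventually (eventually_kappaP_div_le hp hε)] with ν hν
  have h0 : 0 ≤ kappaP p ν / |ν| :=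
    div_nonneg (sub_nonneg.2 (abs_le_alphaP hp ν)) (abs_nonneg _)
  rw [Real.dist_eq, sub_zero, abs_of_nonneg h0]
  exact hν ν rfl

end

/-! ### Primitives, weak derivatives and initial values -/

section

section FTC
variable {E : Type*} [NormedAddCommGroup E] [NormedSpace ℝ E]

/-- Increments of the primitive of `g` are dominated by increments of the real primitive of `‖g‖`,
so its modulus of absolute continuity can be used. -/
lemma absolutelyContinuousOnInterval_integral {g : ℝ → E} {a b c : ℝ}
    (hg : IntervalIntegrable g volume a b) (hc : c ∈ uIcc a b) :
    AbsolutelyContinuousOnInterval (fun x => ∫ v in c..x, g v) a b := by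
  have h1 := hg.norm.absolutelyContinuousOnInterval_intervalIntegral hc
  rw [absolutelyContinuousOnInterval_iff] at h1 ⊢
  intro ε hε
  obtain ⟨δ, hδ, h⟩ := h1 ε hε
  refine ⟨δ, hδ, fun J hJ hJδ => lt_of_le_of_lt ?_ (h J hJ hJδ)⟩
  refine Finset.sum_le_sum fun i hi => ?_
  have hm := hJ.1 i (by simpa using hi)
  have key : ∀ x ∈ uIcc a b, ∀ y ∈ uIcc a b, IntervalIntegrable g volume x y := fun x hx y hy =>
    hg.mono_set (uIcc_subset_uIcc hx hy)
  rw [dist_eq_norm, dist_eq_norm, intervalIntegral.integral_interval_sub_left (key _ hc _ hm.1)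
    (key _ hc _ hm.2), intervalIntegral.integral_interval_sub_left (key _ hc _ hm.1).norm
    (key _ hc _ hm.2).norm]
  exact intervalIntegral.norm_integral_le_abs_integral_norm

variable [CompleteSpace E]

/-- `F` minus the primitive of `f` is absolutely continuous with zero derivative almost everywhere,
hence constant; no differentiability at every point is needed. -/
lemma integral_eq_sub_of_absolutelyContinuous {F f : ℝ → E} {a b : ℝ}
    (hF : AbsolutelyContinuousOnInterval F a b) (hf : IntervalIntegrable f volume a b)
    (h : ∀ᵐ x, x ∈ uIcc a b → HasDerivAt F (f x) x) :
    ∫ x in a..b, f x = F b - F a := by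
  have h1 := hF.sub (absolutelyContinuousOnInterval_integral hf (c := a) left_mem_uIcc)
  obtain ⟨C, hC⟩ := h1.const_of_ae_hasDerivAt_zero (by
    filter_upwards [h, hf.ae_hasDerivAt_integral] with x hx hx' hxm
    simpa using (hx hxm).sub (hx' hxm a left_mem_uIcc))
  have h2 := hC a left_mem_uIcc
  have h3 := hC b right_mem_uIcc
  simp only [Pi.sub_apply, intervalIntegral.integral_same, sub_zero] at h2 h3
  rw [h2, ← h3]; abel

/-- Integration by parts for a `C¹` function and a primitive of an integrable function. -/
lemma smul_primitive_sub {φ : ℝ → ℝ} (hφ : ContDiff ℝ 1 φ) {g : ℝ → E} {a b : ℝ} (c₀ : E)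
    (hg : IntervalIntegrable g volume a b) :
    ∫ r in a..b, (deriv φ r • (c₀ + ∫ s in a..r, g s) + φ r • g r)
      = φ b • (c₀ + ∫ s in a..b, g s) - φ a • c₀ := by
  have hac := absolutelyContinuousOnInterval_integral hg (c := a) left_mem_uIcc
  have hcst : AbsolutelyContinuousOnInterval (fun _ : ℝ => c₀) a b :=
    ContDiffOn.absolutelyContinuousOnInterval contDiffOn_const
  have hcg := hcst.add hac
  have hcont : ContinuousOn (fun r => c₀ + ∫ s in a..r, g s) (uIcc a b) := hcg.continuousOn
  rw [integral_eq_sub_of_absolutelyContinuous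
    (F := φ • ((fun _ => c₀) + fun x => ∫ v in a..x, g v))]
  · simp
  · exact (hφ.contDiffOn.absolutelyContinuousOnInterval).smul hcg
  · refine IntervalIntegrable.add ?_ (hg.continuousOn_smul hφ.continuous.continuousOn)
    exact ((hφ.continuous_deriv le_rfl).continuousOn.smul hcont).intervalIntegrable
  · filter_upwards [hg.ae_hasDerivAt_integral] with x hx hxm
    have h1 := (hx hxm a left_mem_uIcc).const_add c₀
    have h2 := ((hφ.differentiable one_ne_zero) x).hasDerivAt
    rw [add_comm (deriv φ x • _)]
    exact h2.smul h1

end FTC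

/-- A nonempty open interval with left endpoint `a`. -/
structure IsLeftInterval (a : ℝ) (I : Set ℝ) : Prop where
  isOpen : IsOpen I
  nonempty : I.Nonempty
  subset : I ⊆ Ioi a
  Ioc_subset : ∀ t ∈ I, Ioc a t ⊆ I

lemma isLeftInterval_Ioi (a : ℝ) : IsLeftInterval a (Ioi a) :=
  ⟨isOpen_Ioi, nonempty_Ioi, Subset.rfl, fun _ _ => Ioc_subset_Ioi_self⟩

lemma isLeftInterval_Ioo {a b : ℝ} (h : a < b) : IsLeftInterval a (Ioo a b) :=
  ⟨isOpen_Ioo, nonempty_Ioo.2 h, Ioo_subset_Ioi_self, fun _ ht _ hs => ⟨hs.1, hs.2.trans_lt ht.2⟩⟩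

namespace IsLeftInterval
variable {a : ℝ} {I : Set ℝ} (hI : IsLeftInterval a I)
include hI

lemma exists_gt {t : ℝ} (ht : t ∈ I) : ∃ b ∈ I, t < b := by
  obtain ⟨b, hb, h⟩ := (mem_nhdsGE_iff_exists_Icc_subset (a := t)).1
    (mem_nhdsWithin_of_mem_nhds (hI.isOpen.mem_nhds ht))
  exact ⟨b, h ⟨hb.le, le_rfl⟩, hb⟩

lemma sInf_eq : sInf I = a := by
  obtain ⟨t, ht⟩ := hI.nonempty
  have hat := hI.subset ht
  refine (IsGLB.csInf_eq ⟨fun s hs => (hI.subset hs).le, fun m hm => ?_⟩ hI.nonempty)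
  refine le_of_forall_gt_imp_ge_of_dense fun s hs => ?_
  have : min s t ∈ I := hI.Ioc_subset t ht ⟨lt_min hs hat, min_le_right _ _⟩
  exact (hm this).trans (min_le_left _ _)

lemma mem_closure : a ∈ closure I := by
  have := csInf_mem_closure hI.nonempty ⟨a, fun s hs => (hI.subset hs).le⟩
  rwa [hI.sInf_eq] at this

lemma ordConnected {s t : ℝ} (hs : s ∈ I) (ht : t ∈ I) : Icc s t ⊆ I := fun _ hr =>
  hI.Ioc_subset t ht ⟨(hI.subset hs).trans_le hr.1, hr.2⟩

lemma measurableSet : MeasurableSet I := hI.isOpen.measurableSet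

end IsLeftInterval

section Weak
variable {X : Type*} [NormedAddCommGroup X] [NormedSpace ℝ X] [CompleteSpace X]
variable {a p : ℝ} {I : Set ℝ}

lemma MemLpOn.mono {Y : Type*} [NormedAddCommGroup Y] {u : ℝ → Y} {J : Set ℝ} (h : MemLpOn p I u)
    (hJ : J ⊆ I) : MemLpOn p J u :=
  MemLp.mono_measure (Measure.restrict_mono hJ le_rfl) h

lemma MemLpOn.integrableOn {Y : Type*} [NormedAddCommGroup Y] (hp : 1 ≤ p) {u : ℝ → Y} {J : Set ℝ}
    (h : MemLpOn p I u) (hJ : J ⊆ I) (hfin : volume J ≠ ⊤) : IntegrableOn u J := by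
  have : IsFiniteMeasure (volume.restrict J) := ⟨by simpa using hfin.lt_top⟩
  exact MemLp.integrable (by simpa using hp) (h.mono hJ)

lemma MemLpOn.intervalIntegrable {Y : Type*} [NormedAddCommGroup Y] (hp : 1 ≤ p)
    (hI : IsLeftInterval a I) {u : ℝ → Y} (h : MemLpOn p I u) {t : ℝ} (ht : t ∈ I) :
    IntervalIntegrable u volume a t := by
  rw [intervalIntegrable_iff_integrableOn_Ioc_of_le (hI.subset ht).le]
  exact h.integrableOn hp (hI.Ioc_subset t ht) (by simp)

lemma IsLeftInterval.locallyIntegrableOn {Y : Type*} [NormedAddCommGroup Y]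
    (hI : IsLeftInterval a I) {u : ℝ → Y} (h : ∀ t ∈ I, IntervalIntegrable u volume a t) :
    LocallyIntegrableOn u I := by
  intro x hx
  obtain ⟨b, hb, hxb⟩ := hI.exists_gt hx
  exact ⟨Ioc a b, mem_nhdsWithin_of_mem_nhds (Ioc_mem_nhds (hI.subset hx) hxb),
    (intervalIntegrable_iff_integrableOn_Ioc_of_le (hI.subset hb).le).1 (h b hb)⟩

/-- A test function on `I` lives on some $(a,b)$ with $b\in I$. This reduces integrals over `I`,
bounded or not, to interval integrals with vanishing boundary terms. -/
lemma exists_Ioo_of_tsupport (hI : IsLeftInterval a I) {φ : ℝ → ℝ} (hc : HasCompactSupport φ)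
    (hs : tsupport φ ⊆ I) : ∃ b ∈ I, tsupport φ ⊆ Ioo a b := by
  rcases (tsupport φ).eq_empty_or_nonempty with h | h
  · obtain ⟨b, hb⟩ := hI.nonempty
    exact ⟨b, hb, by simp [h]⟩
  · obtain ⟨m, hm, hmax⟩ := hc.isCompact.exists_isGreatest h
    obtain ⟨b, hb, hmb⟩ := hI.exists_gt (hs hm)
    exact ⟨b, hb, fun x hx => ⟨hI.subset (hs hx), (hmax hx).trans_lt hmb⟩⟩

omit [CompleteSpace X] in
lemma setIntegral_eq_intervalIntegral_of_support (hI : IsLeftInterval a I) {b : ℝ} (hb : b ∈ I)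
    {F : ℝ → X} (hF : ∀ x, x ∉ Ioo a b → F x = 0) : ∫ t in I, F t = ∫ t in a..b, F t := by
  rw [intervalIntegral.integral_of_le (hI.subset hb).le]
  refine (setIntegral_eq_of_subset_of_forall_sdiff_eq_zero hI.measurableSet (hI.Ioc_subset b hb)
    fun x hx => hF x fun h => hx.2 (Ioo_subset_Ioc_self h))

lemma isWeakDeriv_of_primitive (hI : IsLeftInterval a I) {v g : ℝ → X} (c₀ : X)
    (hg : ∀ t ∈ I, IntervalIntegrable g volume a t)
    (hv : ∀ᵐ t ∂(volume.restrict I), v t = c₀ + ∫ r in a..t, g r) : IsWeakDeriv I v g := by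
  intro φ hφ hc hs
  obtain ⟨b, hb, hsub⟩ := exists_Ioo_of_tsupport hI hc hs
  have hφ0 : ∀ x, x ∉ Ioo a b → φ x = 0 := fun x hx => image_eq_zero_of_notMem_tsupport
    fun h => hx (hsub h)
  have hdφ0 : ∀ x, x ∉ Ioo a b → deriv φ x = 0 := fun x hx => image_eq_zero_of_notMem_tsupport
    fun h => hx (hsub (tsupport_deriv_subset h))
  have hφ1 : ContDiff ℝ 1 φ := hφ.of_le (by exact_mod_cast le_top)
  have h1 : ∫ t in I, deriv φ t • v t = ∫ t in a..b, deriv φ t • (c₀ + ∫ r in a..t, g r) := by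
    rw [← setIntegral_eq_intervalIntegral_of_support hI hb
      (F := fun t => deriv φ t • (c₀ + ∫ r in a..t, g r))
      fun x hx => by simp [hdφ0 x hx]]
    refine integral_congr_ae ?_
    filter_upwards [hv] with t ht
    rw [ht]
  rw [h1, setIntegral_eq_intervalIntegral_of_support hI hb (F := fun t => φ t • g t)
    fun x hx => by simp [hφ0 x hx]]
  have h2 := smul_primitive_sub hφ1 c₀ (hg b hb)
  have hcont : ContinuousOn (fun r => c₀ + ∫ s in a..r, g s) (uIcc a b) :=
    continuousOn_const.add
      (absolutelyContinuousOnInterval_integral (hg b hb) (c := a) left_mem_uIcc).continuousOn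
  rw [intervalIntegral.integral_add (f := fun r => deriv φ r • (c₀ + ∫ s in a..r, g s))
    ((hφ1.continuous_deriv le_rfl).continuousOn.smul hcont).intervalIntegrable
    ((hg b hb).continuousOn_smul hφ1.continuous.continuousOn)] at h2
  rw [hφ0 a (by simp), hφ0 b (by simp), zero_smul, zero_smul, sub_zero] at h2
  exact neg_eq_of_add_eq_zero_right h2

omit [CompleteSpace X] in
lemma IsLeftInterval.integrableOn_smul (hI : IsLeftInterval a I) {g : ℝ → X}
    (hg : ∀ t ∈ I, IntervalIntegrable g volume a t) {φ : ℝ → ℝ} (hφ : Continuous φ) (hc : HasCompactSupport φ)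
    (hs : tsupport φ ⊆ I) : IntegrableOn (fun x => φ x • g x) I := by
  obtain ⟨b, hb, hsub⟩ := exists_Ioo_of_tsupport hI hc hs
  refine IntegrableOn.of_forall_sdiff_eq_zero (s := Ioc a b) ?_ hI.measurableSet fun x hx => ?_
  · have := (hg b hb).continuousOn_smul hφ.continuousOn
    rwa [intervalIntegrable_iff_integrableOn_Ioc_of_le (hI.subset hb).le] at this
  · rw [image_eq_zero_of_notMem_tsupport fun h => hx.2 (Ioo_subset_Ioc_self (hsub h)), zero_smul]

lemma ae_eq_of_forall_integral_smul_eq (hI : IsLeftInterval a I) {g₁ g₂ : ℝ → X}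
    (hg₁ : ∀ t ∈ I, IntervalIntegrable g₁ volume a t) (hg₂ : ∀ t ∈ I, IntervalIntegrable g₂ volume a t)
    (h : ∀ φ : ℝ → ℝ, ContDiff ℝ ∞ φ → HasCompactSupport φ → tsupport φ ⊆ I →
      ∫ t in I, φ t • g₁ t = ∫ t in I, φ t • g₂ t) :
    ∀ᵐ t ∂(volume.restrict I), g₁ t = g₂ t := by
  rw [ae_restrict_iff' hI.measurableSet]
  have := hI.isOpen.ae_eq_zero_of_integral_contDiff_smul_eq_zero (μ := volume)
    ((hI.locallyIntegrableOn hg₁).sub (hI.locallyIntegrableOn hg₂)) ?_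
  · filter_upwards [this] with x hx hxI
    exact sub_eq_zero.1 (hx hxI)
  · intro φ hφ hc hs
    have e : ∫ x, φ x • (g₁ - g₂) x = ∫ x in I, φ x • (g₁ - g₂) x := by
      rw [setIntegral_eq_integral_of_forall_compl_eq_zero]
      intro x hx
      rw [image_eq_zero_of_notMem_tsupport (fun h => hx (hs h)), zero_smul]
    rw [e]
    simp only [Pi.sub_apply, smul_sub]
    rw [integral_sub (hI.integrableOn_smul hg₁ hφ.continuous hc hs)
      (hI.integrableOn_smul hg₂ hφ.continuous hc hs), h φ hφ hc hs, sub_self]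

lemma ae_eq_of_isWeakDeriv (hI : IsLeftInterval a I) {v g₁ g₂ : ℝ → X}
    (h₁ : IsWeakDeriv I v g₁) (h₂ : IsWeakDeriv I v g₂) (hg₁ : ∀ t ∈ I, IntervalIntegrable g₁ volume a t)
    (hg₂ : ∀ t ∈ I, IntervalIntegrable g₂ volume a t) : ∀ᵐ t ∂(volume.restrict I), g₁ t = g₂ t :=
  ae_eq_of_forall_integral_smul_eq hI hg₁ hg₂ fun φ hφ hc hs => by
    rw [← h₁ φ hφ hc hs, ← h₂ φ hφ hc hs]

/-- A test function of zero mean is the derivative of a test function. -/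
lemma exists_primitive_of_integral_eq_zero (hI : IsLeftInterval a I) {φ : ℝ → ℝ}
    (hφ : ContDiff ℝ ∞ φ) (hc : HasCompactSupport φ) (hs : tsupport φ ⊆ I)
    (h0 : ∫ t, φ t = 0) : ∃ Φ : ℝ → ℝ, ContDiff ℝ ∞ Φ ∧ HasCompactSupport Φ ∧ tsupport Φ ⊆ I ∧
      deriv Φ = φ := by
  rcases (tsupport φ).eq_empty_or_nonempty with h | h
  · have : φ = 0 := by
      ext x; exact image_eq_zero_of_notMem_tsupport (by simp [h])
    exact ⟨0, contDiff_const, HasCompactSupport.zero, by simp [tsupport], by simp [this]⟩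
  obtain ⟨M, hM, hmax⟩ := hc.isCompact.exists_isGreatest h
  obtain ⟨m, hm, hmin⟩ := hc.isCompact.exists_isLeast h
  have hz : ∀ x, x ∉ Icc m M → φ x = 0 := fun x hx => image_eq_zero_of_notMem_tsupport
    fun h => hx ⟨hmin h, hmax h⟩
  have hd : ∀ x, HasDerivAt (fun t => ∫ r in m..t, φ r) (φ x) x := fun x =>
    hφ.continuous.integral_hasStrictDerivAt m x |>.hasDerivAt
  have hderiv : deriv (fun t => ∫ r in m..t, φ r) = φ := funext fun x => (hd x).deriv
  have hmM : m ≤ M := hmax hm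
  -- Left of the support the integrand vanishes; right of it the integral is the full mean of `φ`,
  -- which is zero.
  have hsupp : Function.support (fun t => ∫ r in m..t, φ r) ⊆ Icc m M := by
    intro x hx
    by_contra hxm
    apply hx
    rcases lt_or_ge x m with h1 | h1
    · refine (intervalIntegral.integral_congr_ae (g := fun _ => 0) ?_).trans
        intervalIntegral.integral_zero
      rw [uIoc_of_ge h1.le]
      have : ∀ᵐ y : ℝ, y ≠ m := by simp [ae_iff, measure_singleton]
      filter_upwards [this] with y hy hym
      exact hz y fun h => hy (le_antisymm hym.2 h.1)
    · have h2 : M < x := lt_of_not_ge fun h => hxm ⟨h1, h⟩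
      simp only
      rw [intervalIntegral.integral_of_le h1, ← h0, ← integral_Icc_eq_integral_Ioc,
        setIntegral_eq_integral_of_forall_compl_eq_zero]
      exact fun y hy => hz y fun h => hy ⟨h.1, h.2.trans h2.le⟩
  have hts : tsupport (fun t => ∫ r in m..t, φ r) ⊆ Icc m M :=
    closure_minimal hsupp isClosed_Icc
  refine ⟨_, ?_, HasCompactSupport.of_support_subset_isCompact isCompact_Icc hsupp,
    hts.trans (hI.ordConnected (hs hm) (hs hM)), hderiv⟩
  rw [contDiff_infty_iff_deriv, hderiv]
  exact ⟨fun x => (hd x).differentiableAt, hφ⟩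

lemma exists_test_integral_eq_one (hI : IsLeftInterval a I) : ∃ ψ : ℝ → ℝ, ContDiff ℝ ∞ ψ ∧
    HasCompactSupport ψ ∧ tsupport ψ ⊆ I ∧ ∫ t, ψ t = 1 := by
  obtain ⟨x, hx⟩ := hI.nonempty
  obtain ⟨ε, hε, hball⟩ := Metric.isOpen_iff.1 hI.isOpen x hx
  let f : ContDiffBump x := ⟨ε / 4, ε / 2, by positivity, by linarith⟩
  refine ⟨f.normed volume, f.contDiff_normed, f.hasCompactSupport_normed, ?_, f.integral_normed⟩
  rw [f.tsupport_normed_eq]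
  exact (Metric.closedBall_subset_ball (by show ε / 2 < ε; linarith)).trans hball

lemma ae_eq_const_of_isWeakDeriv_zero (hI : IsLeftInterval a I) {v : ℝ → X}
    (hv : ∀ t ∈ I, IntervalIntegrable v volume a t) (h : IsWeakDeriv I v 0) :
    ∃ c : X, ∀ᵐ t ∂(volume.restrict I), v t = c := by
  obtain ⟨ψ, hψ, hψc, hψs, hψ1⟩ := exists_test_integral_eq_one hI
  refine ⟨∫ t in I, ψ t • v t, ae_eq_of_forall_integral_smul_eq hI hv
    (fun t _ => intervalIntegrable_const) fun φ hφ hφc hφs => ?_⟩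
  have hint : ∀ f : ℝ → ℝ, tsupport f ⊆ I → ∫ t in I, f t = ∫ t, f t := fun f hf =>
    setIntegral_eq_integral_of_forall_compl_eq_zero fun x hx =>
      image_eq_zero_of_notMem_tsupport fun h => hx (hf h)
  -- Subtracting `m • ψ` removes the mean, so `φ - m ψ` is the derivative of a test function and is
  -- annihilated by `v`.
  set m := ∫ t, φ t with hm
  have hs : tsupport (fun t => φ t - m * ψ t) ⊆ I := by
    refine (tsupport_sub φ fun t => m * ψ t).trans (union_subset hφs ?_)
    exact (tsupport_mul_subset_right (f := fun _ => m) (g := ψ)).trans hψs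
  have hcs : HasCompactSupport (fun t => φ t - m * ψ t) :=
    hφc.sub (hψc.mul_left (f := fun _ => m))
  have hsm : ContDiff ℝ ∞ (fun t => φ t - m * ψ t) := hφ.sub (contDiff_const.mul hψ)
  obtain ⟨Φ, h1, h2, h3, h4⟩ := exists_primitive_of_integral_eq_zero hI hsm hcs hs (by
    rw [integral_sub (hφ.continuous.integrable_of_hasCompactSupport hφc)
      ((hψ.continuous.integrable_of_hasCompactSupport hψc).const_mul _),
      integral_const_mul, hψ1, mul_one, hm, sub_self])
  have h5 := h Φ h1 h2 h3
  simp only [h4, Pi.zero_apply, smul_zero, integral_zero, neg_eq_zero, sub_smul, mul_smul] at h5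
  rw [integral_sub (g := fun t => m • ψ t • v t)
    (hI.integrableOn_smul hv hφ.continuous hφc hφs) ((hI.integrableOn_smul hv hψ.continuous hψc hψs).smul m), integral_smul, sub_eq_zero] at h5
  rw [h5, integral_smul_const, hint φ hφs]

omit [NormedSpace ℝ X] [CompleteSpace X] in
lemma MemLpOn.intervalIntegrable_indicator (hp : 1 ≤ p) (hI : IsLeftInterval a I) {g : ℝ → X}
    (hg : MemLpOn p I g) (s t : ℝ) : IntervalIntegrable (I.indicator g) volume s t := by
  rw [intervalIntegrable_iff, IntegrableOn, integrable_indicator_iff hI.measurableSet,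
    IntegrableOn, Measure.restrict_restrict hI.measurableSet]
  refine hg.integrableOn hp inter_subset_left ?_
  exact ((measure_mono inter_subset_right).trans_lt (by simp [uIoc])).ne

omit [CompleteSpace X] in
lemma IsLeftInterval.integral_indicator (hI : IsLeftInterval a I) (g : ℝ → X) {t : ℝ}
    (ht : t ∈ I) : ∫ r in a..t, I.indicator g r = ∫ r in a..t, g r := by
  refine intervalIntegral.integral_congr_ae (ae_of_all _ fun r hr => ?_)
  rw [uIoc_of_le (hI.subset ht).le] at hr
  exact indicator_of_mem (hI.Ioc_subset t ht hr) g

/-- The Sobolev functions vanishing at the left endpoint are the primitives of `L^p` functions. -/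
lemma hasInitialValue_zero_and_isWeakDeriv_iff (hp : 1 ≤ p) (hI : IsLeftInterval a I) {v g : ℝ → X}
    (hv : MemLpOn p I v) (hg : MemLpOn p I g) :
    (HasInitialValue I v 0 ∧ IsWeakDeriv I v g) ↔
      ∀ᵐ t ∂(volume.restrict I), v t = ∫ r in a..t, g r := by
  have hgi : ∀ t ∈ I, IntervalIntegrable g volume a t := fun t ht => hg.intervalIntegrable hp hI ht
  have hcont : Continuous fun t => ∫ r in a..t, I.indicator g r :=
    intervalIntegral.continuous_primitive (hg.intervalIntegrable_indicator hp hI) a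
  have hGw : IsWeakDeriv I (fun t => ∫ r in a..t, g r) g :=
    isWeakDeriv_of_primitive hI 0 hgi (by simp)
  constructor
  · rintro ⟨⟨d, hd, hdv, hda⟩, hw⟩
    have hGi : ∀ t ∈ I, IntervalIntegrable (fun t => ∫ r in a..t, g r) volume a t := fun t ht =>
      (absolutelyContinuousOnInterval_integral (hgi t ht)
        (c := a) left_mem_uIcc).continuousOn.intervalIntegrable
    have hvi : ∀ t ∈ I, IntervalIntegrable v volume a t :=
      fun t ht => hv.intervalIntegrable hp hI ht
    obtain ⟨c, hc⟩ := ae_eq_const_of_isWeakDeriv_zero hI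
      (v := fun t => v t - ∫ r in a..t, g r) (fun t ht => (hvi t ht).sub (hGi t ht)) (by
        intro φ hφ hφc hφs
        have hdc : HasCompactSupport (deriv φ) := hφc.deriv
        have hds : tsupport (deriv φ) ⊆ I := tsupport_deriv_subset.trans hφs
        have hd' : Continuous (deriv φ) := hφ.continuous_deriv (by simp)
        simp only [smul_sub, Pi.zero_apply, smul_zero, integral_zero, neg_eq_zero]
        rw [integral_sub (hI.integrableOn_smul hvi hd' hdc hds)
          (hI.integrableOn_smul hGi hd' hdc hds), sub_eq_zero]
        exact neg_injective ((hw φ hφ hφc hφs).trans (hGw φ hφ hφc hφs).symm))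
    -- Both sides are continuous, so equality holds at every point of `I` and can be passed to the
    -- limit at the endpoint `a`.
    have heq : EqOn (fun t => d t - ∫ r in a..t, I.indicator g r) (fun _ => c) I := by
      refine Measure.eqOn_open_of_ae_eq (μ := volume) ?_ hI.isOpen
        ((hd.mono subset_closure).sub hcont.continuousOn) continuousOn_const
      filter_upwards [hc, hdv, ae_restrict_mem hI.measurableSet] with t h1 h2 h3
      rw [h2, hI.integral_indicator g h3, h1]
    -- Let $t\to a$ within `I`: the continuous representative tends to the initial value `0`, and so
    -- does the primitive.
    have hc0 : c = 0 := by
      have := mem_closure_iff_nhdsWithin_neBot.1 hI.mem_closure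
      have h1 : Tendsto (fun t => d t - ∫ r in a..t, I.indicator g r) (𝓝[I] a) (𝓝 0) := by
        have := ((hd a hI.mem_closure).mono subset_closure).sub
          (hcont.continuousWithinAt (s := I) (x := a))
        rw [hI.sInf_eq] at hda
        simp only [ContinuousWithinAt, hda, Pi.sub_apply, intervalIntegral.integral_same,
          sub_zero] at this
        exact this
      refine tendsto_nhds_unique ?_ h1
      exact tendsto_const_nhds.congr' (by
        filter_upwards [self_mem_nhdsWithin] with t ht using (heq ht).symm)
    filter_upwards [hc] with t ht
    rwa [hc0, sub_eq_zero] at ht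
  · intro h
    refine ⟨⟨fun t => ∫ r in a..t, I.indicator g r, hcont.continuousOn, ?_, ?_⟩,
      isWeakDeriv_of_primitive hI 0 hgi (by simpa using h)⟩
    · filter_upwards [h, ae_restrict_mem hI.measurableSet] with t h1 h2
      rw [h1, hI.integral_indicator g h2]
    · rw [hI.sInf_eq]
      exact intervalIntegral.integral_same

end Weak
end

/-! ### $L^p$ norms and the integrated Cauchy problem -/

section

section LpNorm
variable {Y Z : Type*} [NormedAddCommGroup Y] [NormedAddCommGroup Z] {p : ℝ} {I J : Set ℝ}

lemma lpNormOn_nonneg (u : ℝ → Y) : 0 ≤ lpNormOn p I u := ENNReal.toReal_nonneg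

lemma lpNormOn_congr_norm_ae {u : ℝ → Y} {v : ℝ → Z}
    (h : ∀ᵐ t ∂(volume.restrict I), ‖u t‖ = ‖v t‖) : lpNormOn p I u = lpNormOn p I v := by
  rw [lpNormOn, lpNormOn, eLpNorm_congr_norm_ae h]

lemma lpNormOn_congr_ae {u v : ℝ → Y} (h : ∀ᵐ t ∂(volume.restrict I), u t = v t) :
    lpNormOn p I u = lpNormOn p I v :=
  lpNormOn_congr_norm_ae (h.mono fun _ ht => by rw [ht])

lemma lpNormOn_add_le (hp : 1 ≤ p) {u v : ℝ → Y} (hu : MemLpOn p I u) (hv : MemLpOn p I v) :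
    lpNormOn p I (fun t => u t + v t) ≤ lpNormOn p I u + lpNormOn p I v := by
  rw [lpNormOn, lpNormOn, lpNormOn, ← ENNReal.toReal_add hu.2.ne hv.2.ne]
  exact ENNReal.toReal_mono (ENNReal.add_ne_top.2 ⟨hu.2.ne, hv.2.ne⟩)
    (eLpNorm_add_le hu.1 hv.1 (by simpa using hp))

lemma lpNormOn_sub_le (hp : 1 ≤ p) {u v : ℝ → Y} (hu : MemLpOn p I u) (hv : MemLpOn p I v) :
    lpNormOn p I (fun t => u t - v t) ≤ lpNormOn p I u + lpNormOn p I v := by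
  rw [lpNormOn, lpNormOn, lpNormOn, ← ENNReal.toReal_add hu.2.ne hv.2.ne]
  exact ENNReal.toReal_mono (ENNReal.add_ne_top.2 ⟨hu.2.ne, hv.2.ne⟩)
    (eLpNorm_sub_le hu.1 hv.1 (by simpa using hp))

lemma lpNormOn_le_mul {u : ℝ → Y} {v : ℝ → Z} {c : ℝ} (hc : 0 ≤ c) (hv : MemLpOn p I v)
    (h : ∀ᵐ t ∂(volume.restrict I), ‖u t‖ ≤ c * ‖v t‖) :
    lpNormOn p I u ≤ c * lpNormOn p I v := by
  have := eLpNorm_le_mul_eLpNorm_of_ae_le_mul h (ENNReal.ofReal p)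
  have h2 := ENNReal.toReal_mono (ENNReal.mul_ne_top ENNReal.ofReal_ne_top hv.2.ne) this
  rwa [ENNReal.toReal_mul, ENNReal.toReal_ofReal hc] at h2

lemma lpNormOn_mono_set {u : ℝ → Y} (h : MemLpOn p I u) (hJ : J ⊆ I) :
    lpNormOn p J u ≤ lpNormOn p I u :=
  ENNReal.toReal_mono h.2.ne (eLpNorm_mono_measure _ (Measure.restrict_mono hJ le_rfl))

lemma ae_eq_zero_of_lpNormOn_eq_zero (hp : 0 < p) {u : ℝ → Y} (hu : MemLpOn p I u)
    (h : lpNormOn p I u = 0) : ∀ᵐ t ∂(volume.restrict I), u t = 0 := by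
  rw [lpNormOn, ENNReal.toReal_eq_zero_iff, or_iff_left hu.2.ne,
    eLpNorm_eq_zero_iff hu.1 (by simpa using hp)] at h
  exact h

lemma lpNormOn_indicator (hI : MeasurableSet I) (hIJ : I ⊆ J) (u : ℝ → Y) :
    lpNormOn p J (I.indicator u) = lpNormOn p I u := by
  rw [lpNormOn, lpNormOn, eLpNorm_indicator_eq_eLpNorm_restrict hI,
    Measure.restrict_restrict hI, inter_eq_left.2 hIJ]

lemma MemLpOn.indicator (hI : MeasurableSet I) {u : ℝ → Y} (hu : MemLpOn p I u) :
    MemLpOn p J (I.indicator u) := by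
  rw [MemLpOn, memLp_indicator_iff_restrict hI, Measure.restrict_restrict hI]
  exact hu.mono inter_subset_left

lemma MemLpOn.congr {u v : ℝ → Y} (hu : MemLpOn p I u)
    (h : ∀ᵐ t ∂(volume.restrict I), u t = v t) : MemLpOn p I v :=
  MemLp.ae_eq h hu

lemma MemLpOn.comp_sub {u : ℝ → Y} (hI : MeasurableSet I) (hu : MemLpOn p I u) (s : ℝ) :
    MemLpOn p ((fun t => t - s) ⁻¹' I) (fun t => u (t - s)) :=
  MemLp.comp_measurePreserving hu
    ((measurePreserving_sub_right volume s).restrict_preimage hI)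

lemma lpNormOn_comp_sub {u : ℝ → Y} (hI : MeasurableSet I) (hu : MemLpOn p I u) (s : ℝ) :
    lpNormOn p ((fun t => t - s) ⁻¹' I) (fun t => u (t - s)) = lpNormOn p I u := by
  rw [lpNormOn, lpNormOn, ← eLpNorm_comp_measurePreserving hu.1
    ((measurePreserving_sub_right volume s).restrict_preimage hI)]
  rfl

lemma memLpOn_of_continuousOn_bounded {u : ℝ → Y} (hI : MeasurableSet I) (hfin : volume I ≠ ⊤)
    (hu : ContinuousOn u I) {C : ℝ} (hC : ∀ t ∈ I, ‖u t‖ ≤ C) : MemLpOn p I u := by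
  have : IsFiniteMeasure (volume.restrict I) := ⟨by simpa using hfin.lt_top⟩
  exact MemLp.of_bound (hu.aestronglyMeasurable hI) C
    ((ae_restrict_iff' hI).2 (ae_of_all _ hC))

lemma memLpOn_Ioo_of_continuous {u : ℝ → Y} (hu : Continuous u) (a b : ℝ) :
    MemLpOn p (Ioo a b) u := by
  obtain ⟨C, hC⟩ := isCompact_Icc.exists_bound_of_continuousOn (hu.continuousOn (s := Icc a b))
  exact memLpOn_of_continuousOn_bounded measurableSet_Ioo (by simp) hu.continuousOn
    fun t ht => hC t (Ioo_subset_Icc_self ht)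

lemma memLpOn_exp_smul [NormedSpace ℝ Y] (hp : 0 < p) (a : ℝ) (x : Y) :
    MemLpOn p (Ioi a) (fun t => Real.exp (-(t - a)) • x) := by
  have h1 : MemLp (fun t => Real.exp (-(t - a))) (ENNReal.ofReal p) (volume.restrict (Ioi a)) := by
    rw [← integrable_norm_rpow_iff (by fun_prop) (by simpa using hp) (by simp)]
    rw [ENNReal.toReal_ofReal hp.le]
    have h2 := (integrableOn_exp_mul_Ioi (a := -p) (by linarith) a).const_mul (Real.exp (p * a))
    refine h2.congr (ae_of_all _ fun t => ?_)
    simp only [Real.norm_eq_abs, Real.abs_exp]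
    rw [← Real.exp_mul, ← Real.exp_add]
    ring_nf
  exact MemLp.of_le_mul (c := ‖x‖) h1 (by fun_prop)
    (ae_of_all _ fun t => by rw [norm_smul, mul_comm])

end LpNorm

variable {X D : Type*} [NormedAddCommGroup X] [NormedSpace ℝ X]
  [NormedAddCommGroup D] [NormedSpace ℝ D]
variable {p a b : ℝ} {I J : Set ℝ} {ι A : D →L[ℝ] X}

lemma MemLpOn.clm_comp {u : ℝ → D} (hu : MemLpOn p I u) (L : D →L[ℝ] X) :
    MemLpOn p I (fun t => L (u t)) :=
  L.comp_memLp' hu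

/-- The integrated form of `u' + A u = F`, `u(a) = 0`. -/
structure ZeroSol (p : ℝ) (I : Set ℝ) (a : ℝ) (ι A : D →L[ℝ] X) (F : ℝ → X) (u : ℝ → D) :
    Prop where
  sol : MemLpOn p I u
  data : MemLpOn p I F
  eq : ∀ᵐ t ∂(volume.restrict I), ι (u t) = ∫ r in a..t, (F r - A (u r))

namespace ZeroSol
variable {F G : ℝ → X} {u v : ℝ → D}

lemma deriv_mem (h : ZeroSol p I a ι A F u) : MemLpOn p I (fun t => F t - A (u t)) :=
  MemLp.sub h.data (h.sol.clm_comp A)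

lemma mono (h : ZeroSol p I a ι A F u) (hJ : J ⊆ I) : ZeroSol p J a ι A F u :=
  ⟨h.sol.mono hJ, h.data.mono hJ, ae_mono (Measure.restrict_mono hJ le_rfl) h.eq⟩

lemma sub (hp : 1 ≤ p) (hI : IsLeftInterval a I) (hu : ZeroSol p I a ι A F u)
    (hv : ZeroSol p I a ι A G v) :
    ZeroSol p I a ι A (fun t => F t - G t) (fun t => u t - v t) := by
  refine ⟨MemLp.sub hu.sol hv.sol, MemLp.sub hu.data hv.data, ?_⟩
  filter_upwards [hu.eq, hv.eq, ae_restrict_mem hI.measurableSet] with t h1 h2 ht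
  rw [map_sub, h1, h2, ← intervalIntegral.integral_sub
    (hu.deriv_mem.intervalIntegrable hp hI ht) (hv.deriv_mem.intervalIntegrable hp hI ht)]
  congr 1 with r
  rw [map_sub]; abel

lemma congr_ae (hI : IsLeftInterval a I) (hu : ZeroSol p I a ι A F u)
    (hF : ∀ᵐ t ∂(volume.restrict I), F t = G t) (huv : ∀ᵐ t ∂(volume.restrict I), u t = v t) :
    ZeroSol p I a ι A G v := by
  refine ⟨hu.sol.congr huv, hu.data.congr hF, ?_⟩
  filter_upwards [hu.eq, huv, ae_restrict_mem hI.measurableSet] with t h1 h2 ht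
  rw [← h2, h1]
  refine intervalIntegral.integral_congr_ae ?_
  rw [uIoc_of_le (hI.subset ht).le]
  filter_upwards [(ae_restrict_iff' hI.measurableSet).1 hF,
    (ae_restrict_iff' hI.measurableSet).1 huv] with r h3 h4 hr
  have := hI.Ioc_subset t ht hr
  rw [h3 this, h4 this]

lemma comp_sub (hI : MeasurableSet I) (hu : ZeroSol p I a ι A F u) (s : ℝ) :
    ZeroSol p ((fun t => t - s) ⁻¹' I) (a + s) ι A (fun t => F (t - s)) (fun t => u (t - s)) := by
  refine ⟨hu.sol.comp_sub hI s, hu.data.comp_sub hI s, ?_⟩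
  have := ((measurePreserving_sub_right volume s).restrict_preimage hI).quasiMeasurePreserving.ae
    hu.eq
  filter_upwards [this] with t ht
  rw [ht, intervalIntegral.integral_comp_sub_right (fun r => F r - A (u r))]
  simp

end ZeroSol

lemma weakDeriv_spec {v : ℝ → X} (h : MemW1p p I v) :
    MemLpOn p I (weakDeriv p I v) ∧ IsWeakDeriv I v (weakDeriv p I v) := by
  rw [weakDeriv, dif_pos h]
  exact h.2.choose_spec

variable [CompleteSpace X]

lemma ZeroSol.hasInitialValue_and_isWeakDeriv (hp : 1 ≤ p) (hI : IsLeftInterval a I) {F : ℝ → X}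
    {u : ℝ → D} (h : ZeroSol p I a ι A F u) : HasInitialValue I (fun t => ι (u t)) 0 ∧
      IsWeakDeriv I (fun t => ι (u t)) (fun t => F t - A (u t)) :=
  (hasInitialValue_zero_and_isWeakDeriv_iff hp hI (h.sol.clm_comp ι) h.deriv_mem).2 h.eq

lemma ZeroSol.memMR (hp : 1 ≤ p) (hI : IsLeftInterval a I) {F : ℝ → X}
    {u : ℝ → D} (h : ZeroSol p I a ι A F u) : MemMR p I ι u :=
  ⟨h.sol, h.sol.clm_comp ι, _, h.deriv_mem, (h.hasInitialValue_and_isWeakDeriv hp hI).2⟩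

lemma ZeroSol.weakDeriv_ae_eq (hp : 1 ≤ p) (hI : IsLeftInterval a I) {F : ℝ → X}
    {u : ℝ → D} (h : ZeroSol p I a ι A F u) : ∀ᵐ t ∂(volume.restrict I),
      weakDeriv p I (fun t => ι (u t)) t = F t - A (u t) := by
  have h1 := weakDeriv_spec (h.memMR hp hI).2
  exact ae_eq_of_isWeakDeriv hI h1.2 (h.hasInitialValue_and_isWeakDeriv hp hI).2
    (fun t ht => h1.1.intervalIntegrable hp hI ht)
    (fun t ht => h.deriv_mem.intervalIntegrable hp hI ht)

/-- The nonautonomous equation with data `f` is read as the autonomous one for `A` with data `F`.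
Both uses occur: `F = f` for constant operators, and `F = f - B u` for the operator `A + B`. -/
lemma isSolution_iff (hp : 1 ≤ p) (hI : IsLeftInterval a I) {B : ℝ → D →L[ℝ] X} {f F : ℝ → X}
    {u : ℝ → D} (hF : MemLpOn p I F)
    (h : ∀ᵐ t ∂(volume.restrict I), f t - B t (u t) = F t - A (u t)) :
    IsSolution p I ι B f u ↔ ZeroSol p I a ι A F u := by
  constructor
  · rintro ⟨h1, h2, h3⟩
    have h4 := weakDeriv_spec h1.2
    have h5 : ∀ᵐ t ∂(volume.restrict I),
        weakDeriv p I (fun t => ι (u t)) t = F t - A (u t) := by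
      filter_upwards [h, h3] with t ht ht'
      rw [← ht, ← ht', add_sub_cancel_right]
    refine ⟨h1.1, hF, ?_⟩
    refine (hasInitialValue_zero_and_isWeakDeriv_iff hp hI (h1.1.clm_comp ι)
      (h4.1.congr h5)).1 ⟨h2, fun φ hφ hc hs => ?_⟩
    rw [h4.2 φ hφ hc hs]
    refine integral_congr_ae ?_
    filter_upwards [h5] with t ht
    rw [ht]
  · intro hu
    refine ⟨hu.memMR hp hI, (hu.hasInitialValue_and_isWeakDeriv hp hI).1, ?_⟩
    filter_upwards [h, hu.weakDeriv_ae_eq hp hI] with t h1 h2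
    rw [h2, ← h1, sub_add_cancel]

lemma isSolution_const_iff (hp : 1 ≤ p) (hI : IsLeftInterval a I) {f : ℝ → X} {u : ℝ → D}
    (hf : MemLpOn p I f) : IsSolution p I ι (fun _ => A) f u ↔ ZeroSol p I a ι A f u :=
  isSolution_iff hp hI hf (ae_of_all _ fun _ => rfl)

lemma ZeroSol.mrNorm_eq (hp : 1 ≤ p) (hI : IsLeftInterval a I) {F : ℝ → X}
    {u : ℝ → D} (h : ZeroSol p I a ι A F u) : mrNorm p I ι u =
      (lpNormOn p I (fun t => ι (u t)) ^ p + lpNormOn p I u ^ p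
        + derivWeight I ^ p * lpNormOn p I (fun t => F t - A (u t)) ^ p) ^ (1 / p) := by
  rw [mrNorm, lpNormOn_congr_ae (h.weakDeriv_ae_eq hp hI)]

end

/-! ### From the half-line to bounded intervals -/

section

variable {X D : Type*} [NormedAddCommGroup X] [NormedSpace ℝ X]
  [NormedAddCommGroup D] [NormedSpace ℝ D]
variable {p a b K : ℝ} {I J : Set ℝ} {ι A : D →L[ℝ] X}

lemma intervalIntegral_congr_uIoc {E : Type*} [NormedAddCommGroup E] [NormedSpace ℝ E] {s t : ℝ}
    {f g : ℝ → E} (h : EqOn f g (uIoc s t)) : ∫ r in s..t, f r = ∫ r in s..t, g r :=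
  intervalIntegral.integral_congr_ae (ae_of_all _ fun _ hr => h hr)

/-- Maximal regularity on the half-line `(a, ∞)`, in integrated form. -/
structure HalfLineMR (p : ℝ) (ι A : D →L[ℝ] X) (K a : ℝ) : Prop where
  nonneg : 0 ≤ K
  exists_sol : ∀ F : ℝ → X, MemLpOn p (Ioi a) F → ∃ u : ℝ → D, ZeroSol p (Ioi a) a ι A F u
  bound_sol : ∀ (F : ℝ → X) (u : ℝ → D), ZeroSol p (Ioi a) a ι A F u →
    lpNormOn p (Ioi a) u ≤ K * lpNormOn p (Ioi a) F
  bound_deriv : ∀ (F : ℝ → X) (u : ℝ → D), ZeroSol p (Ioi a) a ι A F u →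
    lpNormOn p (Ioi a) (fun t => F t - A (u t)) ≤ K * lpNormOn p (Ioi a) F

lemma le_rpow_sum {p x y z : ℝ} (hp : 1 ≤ p) (hx : 0 ≤ x) (hy : 0 ≤ y) (hz : 0 ≤ z) :
    x ≤ (x ^ p + y ^ p + z ^ p) ^ (1 / p) ∧ y ≤ (x ^ p + y ^ p + z ^ p) ^ (1 / p) ∧
      z ≤ (x ^ p + y ^ p + z ^ p) ^ (1 / p) := by
  have hxp := Real.rpow_nonneg hx p
  have hyp := Real.rpow_nonneg hy p
  have hzp := Real.rpow_nonneg hz p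
  have key : ∀ w : ℝ, 0 ≤ w → w ^ p ≤ x ^ p + y ^ p + z ^ p →
      w ≤ (x ^ p + y ^ p + z ^ p) ^ (1 / p) := by
    intro w hw h
    calc w = (w ^ p) ^ (1 / p) := by rw [one_div, Real.rpow_rpow_inv hw (by linarith)]
      _ ≤ _ := Real.rpow_le_rpow (Real.rpow_nonneg hw p) h (by positivity)
  exact ⟨key x hx (by linarith), key y hy (by linarith), key z hz (by linarith)⟩

lemma halfLineMR_zero [CompleteSpace X] (hp : 1 ≤ p) (h : AutMaxReg p (Ioi 0) ι A) :
    ∃ K, HalfLineMR p ι A K 0 := by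
  obtain ⟨-, h1, K, hK0, hK⟩ := h
  have hI := isLeftInterval_Ioi 0
  have hw : derivWeight (Ioi (0 : ℝ)) = 1 := by
    rw [derivWeight, if_neg (not_bddAbove_Ioi (0 : ℝ))]
  have hb : ∀ (F : ℝ → X) (u : ℝ → D), ZeroSol p (Ioi 0) 0 ι A F u →
      lpNormOn p (Ioi 0) u ≤ K * lpNormOn p (Ioi 0) F ∧
      lpNormOn p (Ioi 0) (fun t => F t - A (u t)) ≤ K * lpNormOn p (Ioi 0) F := by
    intro F u hu
    have h2 := hK F u hu.data ((isSolution_const_iff hp hI hu.data).2 hu)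
    rw [hu.mrNorm_eq hp hI, hw, Real.one_rpow, one_mul] at h2
    have h3 := le_rpow_sum hp (lpNormOn_nonneg (p := p) (I := Ioi 0) fun t => ι (u t))
      (lpNormOn_nonneg (p := p) (I := Ioi 0) u)
      (lpNormOn_nonneg (p := p) (I := Ioi 0) fun t => F t - A (u t))
    exact ⟨h3.2.1.trans h2, h3.2.2.trans h2⟩
  refine ⟨K, hK0, fun F hF => ?_, fun F u hu => (hb F u hu).1, fun F u hu => (hb F u hu).2⟩
  obtain ⟨u, hu, -⟩ := h1 F hF
  exact ⟨u, (isSolution_const_iff hp hI hF).1 hu⟩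

lemma HalfLineMR.shift (h : HalfLineMR p ι A K 0) (a : ℝ) : HalfLineMR p ι A K a := by
  have e1 : ((fun t : ℝ => t - a) ⁻¹' Ioi 0) = Ioi a := by simp
  have e2 : ((fun t : ℝ => t - (-a)) ⁻¹' Ioi a) = Ioi 0 := by simp
  have back : ∀ (F : ℝ → X) (u : ℝ → D), ZeroSol p (Ioi a) a ι A F u →
      ZeroSol p (Ioi 0) 0 ι A (fun t => F (t - (-a))) (fun t => u (t - (-a))) := by
    intro F u hu
    have := hu.comp_sub measurableSet_Ioi (-a)
    rwa [e2, add_neg_cancel] at this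
  have enorm : ∀ {Y : Type _} [NormedAddCommGroup Y] (v : ℝ → Y), MemLpOn p (Ioi a) v →
      lpNormOn p (Ioi 0) (fun t => v (t - (-a))) = lpNormOn p (Ioi a) v := by
    intro Y _ v hv
    have := lpNormOn_comp_sub measurableSet_Ioi hv (-a)
    rwa [e2] at this
  have enorm' : ∀ (v : ℝ → D), MemLpOn p (Ioi a) v →
      lpNormOn p (Ioi 0) (fun t => v (t - (-a))) = lpNormOn p (Ioi a) v := by
    intro v hv
    have := lpNormOn_comp_sub measurableSet_Ioi hv (-a)
    rwa [e2] at this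
  refine ⟨h.nonneg, fun F hF => ?_, fun F u hu => ?_, fun F u hu => ?_⟩
  · have hF' := hF.comp_sub measurableSet_Ioi (-a)
    rw [e2] at hF'
    obtain ⟨u, hu⟩ := h.exists_sol _ hF'
    have := hu.comp_sub measurableSet_Ioi a
    rw [e1, zero_add] at this
    simp only [sub_neg_eq_add, sub_add_cancel] at this
    exact ⟨_, this⟩
  · have := h.bound_sol _ _ (back F u hu)
    rwa [enorm' u hu.sol, enorm F hu.data] at this
  · have := h.bound_deriv _ _ (back F u hu)
    rwa [enorm (fun t => F t - A (u t)) hu.deriv_mem, enorm F hu.data] at this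

/-- The difference of two solutions has zero data, so the a priori bound makes its norm vanish. -/
lemma HalfLineMR.unique (hp : 1 ≤ p) (h : HalfLineMR p ι A K a) {F : ℝ → X} {u v : ℝ → D}
    (hu : ZeroSol p (Ioi a) a ι A F u) (hv : ZeroSol p (Ioi a) a ι A F v) :
    ∀ᵐ t ∂(volume.restrict (Ioi a)), u t = v t := by
  have h1 := hu.sub hp (isLeftInterval_Ioi a) hv
  have h2 := h.bound_sol _ _ h1
  have h3 : lpNormOn p (Ioi a) (fun t => F t - F t) = 0 := by simp [lpNormOn]
  rw [h3, mul_zero] at h2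
  filter_upwards [ae_eq_zero_of_lpNormOn_eq_zero (by linarith) h1.sol
    (le_antisymm h2 (lpNormOn_nonneg _))] with t ht
  exact sub_eq_zero.1 ht

/-- A solution starting at `b` with zero initial value extends by zero to the left of `b`. -/
lemma ZeroSol.extend_left (hp : 1 ≤ p) (hab : a ≤ b) {F : ℝ → X} {z : ℝ → D}
    (h : ZeroSol p (Ioi b) b ι A F z) :
    ZeroSol p (Ioi a) a ι A ((Ioi b).indicator F) ((Ioi b).indicator z) := by
  refine ⟨h.sol.indicator measurableSet_Ioi, h.data.indicator measurableSet_Ioi, ?_⟩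
  have h1 := (ae_restrict_iff' measurableSet_Ioi).1 h.eq
  filter_upwards [ae_restrict_of_ae h1] with t ht
  have h0 : ∀ s ≤ b, ∫ r in a..s, ((Ioi b).indicator F r - A ((Ioi b).indicator z r)) = 0 := by
    intro s hs
    refine (intervalIntegral_congr_uIoc (g := fun _ => 0) fun r hr => ?_).trans
      intervalIntegral.integral_zero
    have : r ∉ Ioi b := by
      have := hr.2
      simp only [mem_Ioi, not_lt]
      exact this.trans (max_le hab hs)
    simp [indicator_of_notMem this]
  rcases le_or_gt t b with htb | htb
  · rw [h0 t htb, indicator_of_notMem (by simpa using htb), map_zero]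
  · rw [indicator_of_mem (show t ∈ Ioi b from htb), ht htb]
    have e : ∫ r in b..t, ((Ioi b).indicator F r - A ((Ioi b).indicator z r))
        = ∫ r in b..t, (F r - A (z r)) := by
      refine intervalIntegral_congr_uIoc fun r hr => ?_
      rw [uIoc_of_le htb.le] at hr
      simp [indicator_of_mem (show r ∈ Ioi b from hr.1)]
    have hint : IntervalIntegrable
        (fun r => (Ioi b).indicator F r - A ((Ioi b).indicator z r)) volume b t := by
      refine (h.deriv_mem.intervalIntegrable hp (isLeftInterval_Ioi b) htb).congr ?_
      intro r hr
      rw [uIoc_of_le htb.le] at hr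
      simp [indicator_of_mem (show r ∈ Ioi b from hr.1)]
    have hint0 : IntervalIntegrable
        (fun r => (Ioi b).indicator F r - A ((Ioi b).indicator z r)) volume a b := by
      refine (intervalIntegrable_const (c := (0 : X))).congr ?_
      intro r hr
      rw [uIoc_of_le hab] at hr
      have : r ∉ Ioi b := by simpa using hr.2
      simp [indicator_of_notMem this]
    rw [← intervalIntegral.integral_add_adjacent_intervals hint0 hint, h0 b le_rfl, zero_add, e]

variable [CompleteSpace X] [CompleteSpace D]

/-- Uniqueness on bounded intervals. -/
lemma HalfLineMR.eq_zero_of_bounded (hp : 1 ≤ p) (hι : Function.Injective ι)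
    (ha : HalfLineMR p ι A K a) (hb : HalfLineMR p ι A K b) (hab : a < b) {u : ℝ → D}
    (hu : ZeroSol p (Ioo a b) a ι A (fun _ => 0) u) :
    ∀ᵐ t ∂(volume.restrict (Ioo a b)), u t = 0 := by
  have hI := isLeftInterval_Ioo hab
  set w := (Ioo a b).indicator u with hw
  have hwi : ∀ s t, IntervalIntegrable w volume s t := hu.sol.intervalIntegrable_indicator hp hI
  -- The solution `u` is only $L^p$ in `D`, so it has no value at `b` from which to continue. Its
  -- primitive `U` is continuous into `D`, and the equation for `u` reads `ι u = -A U`, that is, `U'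
  -- + A U = 0`.
  set U : ℝ → D := fun t => ∫ r in a..t, w r with hU
  have hUc : Continuous U := intervalIntegral.continuous_primitive hwi a
  have hιU : ∀ t, ι (U t) = ∫ r in a..t, ι (w r) := fun t =>
    (ι.intervalIntegral_comp_comm (hwi a t)).symm
  have hAU : ∀ t, A (U t) = ∫ r in a..t, A (w r) := fun t =>
    (A.intervalIntegral_comp_comm (hwi a t)).symm
  have hwU : ∀ᵐ t, t ∈ Ioo a b → ι (w t) = - A (U t) := by
    filter_upwards [(ae_restrict_iff' measurableSet_Ioo).1 hu.eq] with t ht htI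
    rw [hw, indicator_of_mem htI, ht htI, ← hI.integral_indicator _ htI, hAU,
      ← intervalIntegral.integral_neg]
    congr 1 with r
    by_cases hr : r ∈ Ioo a b <;> simp [hw, hr]
  -- Past `b`, `U` is continued by $e^{-(t-b)}U(b)$, which lies in $L^p(b,\infty;D)$; the resulting
  -- function solves the half-line problem with data `G` supported in `Ioi b`.
  set E : ℝ → D := fun t => Real.exp (-(t - b)) • U b with hE
  set V : ℝ → D := fun t => if t ≤ b then U t else E t with hV
  set G : ℝ → X := fun t => Real.exp (-(t - b)) • (A (U b) - ι (U b)) with hG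
  have hGmem : MemLpOn p (Ioi b) G := memLpOn_exp_smul (by linarith) b _
  have hVsplit : V = fun t => (Iic b).indicator U t + (Ioi b).indicator E t := by
    ext t
    rcases le_or_gt t b with h | h
    · simp [hV, h]
    · simp [hV, h]
  have hVmem : MemLpOn p (Ioi a) V := by
    rw [hVsplit]
    refine MemLp.add ?_ ((memLpOn_exp_smul (by linarith) b _).indicator measurableSet_Ioi)
    rw [memLp_indicator_iff_restrict measurableSet_Iic,
      Measure.restrict_restrict measurableSet_Iic, inter_comm, Ioi_inter_Iic,
      Measure.restrict_congr_set Ioo_ae_eq_Ioc.symm]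
    exact memLpOn_Ioo_of_continuous hUc a b
  have hVsol : ZeroSol p (Ioi a) a ι A ((Ioi b).indicator G) V := by
    refine ⟨hVmem, hGmem.indicator measurableSet_Ioi, ?_⟩
    have hI1 : ∀ s ≤ b, a ≤ s → ∫ r in a..s, ((Ioi b).indicator G r - A (V r)) = ι (U s) ∧
        IntervalIntegrable (fun r => (Ioi b).indicator G r - A (V r)) volume a s := by
      intro s hs has
      have e : ∀ᵐ r, r ∈ uIoc a s → ι (w r) = (Ioi b).indicator G r - A (V r) := by
        have hne : ∀ᵐ r : ℝ, r ≠ b := by simp [ae_iff, measure_singleton]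
        filter_upwards [hwU, hne] with r hr hrb hrs
        rw [uIoc_of_le has] at hrs
        have hrb' : r < b := lt_of_le_of_ne (hrs.2.trans hs) hrb
        rw [hr ⟨hrs.1, hrb'⟩, indicator_of_notMem (by simpa using hrb'.le)]
        simp [hV, hrb'.le]
      refine ⟨?_, ?_⟩
      · rw [hιU, intervalIntegral.integral_congr_ae e]
      · have hi : IntervalIntegrable (fun r => ι (w r)) volume a s :=
          ⟨ι.integrable_comp (hwi a s).1, ι.integrable_comp (hwi a s).2⟩
        exact hi.congr_ae ((ae_restrict_iff' measurableSet_uIoc).2 e)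
    filter_upwards [ae_restrict_mem measurableSet_Ioi] with t ht
    rcases le_or_gt t b with htb | htb
    · rw [(hI1 t htb (le_of_lt ht)).1]
      simp [hV, htb]
    · have e2 : EqOn (fun r => (Ioi b).indicator G r - A (V r))
          (fun r => -(Real.exp (-(r - b)) • ι (U b))) (uIoc b t) := by
        intro r hr
        rw [uIoc_of_le htb.le] at hr
        have : ¬ r ≤ b := not_le.2 hr.1
        simp only [hV, this, if_false, indicator_of_mem (show r ∈ Ioi b from hr.1), hG, hE,
          map_smul, smul_sub]
        abel
      have hder : ∀ r ∈ uIcc b t, HasDerivAt (fun r => Real.exp (-(r - b)) • ι (U b))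
          (-(Real.exp (-(r - b)) • ι (U b))) r := by
        intro r _
        have h1 : HasDerivAt (fun r => Real.exp (-(r - b))) (Real.exp (-(r - b)) * (-1)) r :=
          (((hasDerivAt_id r).sub_const b).neg).exp
        simpa using h1.smul_const (ι (U b))
      have hi2 : IntervalIntegrable (fun r => -(Real.exp (-(r - b)) • ι (U b))) volume b t :=
        (Continuous.intervalIntegrable (by fun_prop) _ _)
      rw [← intervalIntegral.integral_add_adjacent_intervals (hI1 b le_rfl hab.le).2
        (hi2.congr e2.symm), (hI1 b le_rfl hab.le).1, intervalIntegral_congr_uIoc e2,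
        intervalIntegral.integral_eq_sub_of_hasDerivAt hder hi2]
      simp [hV, hE, not_le.2 htb]
  -- The same data are also solved by starting at `b` and extending by zero to the left. Uniqueness
  -- on the half-line forces `U = 0` before `b`, hence `ι u = -A U = 0`.
  obtain ⟨z, hz⟩ := hb.exists_sol G hGmem
  have heq := ha.unique hp hVsol (hz.extend_left hp hab.le)
  rw [ae_restrict_iff' measurableSet_Ioo]
  filter_upwards [(ae_restrict_iff' measurableSet_Ioi).1 heq, hwU] with t h1 h2 ht
  have h3 := h1 ht.1
  rw [indicator_of_notMem (by simpa using ht.2.le)] at h3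
  have h4 : U t = 0 := by simpa [hV, ht.2.le] using h3
  have h5 := h2 ht
  rw [h4, map_zero, neg_zero, hw, indicator_of_mem ht] at h5
  exact hι (by rw [h5, map_zero])

/-- Solutions on bounded intervals are restrictions of solutions on half-lines. -/
lemma HalfLineMR.exists_extension (hp : 1 ≤ p) (hι : Function.Injective ι)
    (h : ∀ a, HalfLineMR p ι A K a) (hab : a < b) {F : ℝ → X} {u : ℝ → D}
    (hu : ZeroSol p (Ioo a b) a ι A F u) : ∃ w : ℝ → D,
      ZeroSol p (Ioi a) a ι A ((Ioo a b).indicator F) w ∧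
      ∀ᵐ t ∂(volume.restrict (Ioo a b)), w t = u t := by
  obtain ⟨w, hw⟩ := (h a).exists_sol _ (hu.data.indicator measurableSet_Ioo)
  refine ⟨w, hw, ?_⟩
  have hI := isLeftInterval_Ioo hab
  have h1 := (hw.mono Ioo_subset_Ioi_self).sub hp hI hu
  have h2 := h1.congr_ae hI (G := fun _ => 0) (v := fun t => w t - u t) (by
    filter_upwards [ae_restrict_mem measurableSet_Ioo] with t ht
    rw [indicator_of_mem ht, sub_self]) (ae_of_all _ fun _ => rfl)
  filter_upwards [(h a).eq_zero_of_bounded hp hι (h b) hab h2] with t ht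
  exact sub_eq_zero.1 ht

lemma HalfLineMR.unique_bounded (hp : 1 ≤ p) (hι : Function.Injective ι)
    (h : ∀ a, HalfLineMR p ι A K a) (hab : a < b) {F : ℝ → X} {u v : ℝ → D}
    (hu : ZeroSol p (Ioo a b) a ι A F u) (hv : ZeroSol p (Ioo a b) a ι A F v) :
    ∀ᵐ t ∂(volume.restrict (Ioo a b)), u t = v t := by
  have h2 := (hu.sub hp (isLeftInterval_Ioo hab) hv)
  simp only [sub_self] at h2
  filter_upwards [(h a).eq_zero_of_bounded hp hι (h b) hab h2] with t ht
  exact sub_eq_zero.1 ht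

omit [CompleteSpace X] [CompleteSpace D] in
lemma HalfLineMR.exists_sol_bounded (h : HalfLineMR p ι A K a) (b : ℝ) {F : ℝ → X}
    (hF : MemLpOn p (Ioo a b) F) (hab : a < b) : ∃ u : ℝ → D, ZeroSol p (Ioo a b) a ι A F u := by
  obtain ⟨w, hw⟩ := h.exists_sol _ (hF.indicator measurableSet_Ioo)
  exact ⟨w, (hw.mono Ioo_subset_Ioi_self).congr_ae (isLeftInterval_Ioo hab) (by
    filter_upwards [ae_restrict_mem measurableSet_Ioo] with t ht
    rw [indicator_of_mem ht]) (ae_of_all _ fun _ => rfl)⟩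

/-- Extending the data by zero does not change their norm, so the half-line constant serves all
bounded intervals, independently of their length. -/
lemma HalfLineMR.bound_bounded (hp : 1 ≤ p) (hι : Function.Injective ι)
    (h : ∀ a, HalfLineMR p ι A K a) (hab : a < b) {F : ℝ → X} {u : ℝ → D}
    (hu : ZeroSol p (Ioo a b) a ι A F u) :
    lpNormOn p (Ioo a b) u ≤ K * lpNormOn p (Ioo a b) F ∧
    lpNormOn p (Ioo a b) (fun t => F t - A (u t)) ≤ K * lpNormOn p (Ioo a b) F := by
  obtain ⟨w, hw, hwu⟩ := HalfLineMR.exists_extension hp hι h hab hu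
  have h1 := (h a).bound_sol _ _ hw
  have h2 := (h a).bound_deriv _ _ hw
  rw [lpNormOn_indicator measurableSet_Ioo Ioo_subset_Ioi_self] at h1 h2
  constructor
  · rw [← lpNormOn_congr_ae hwu]
    exact (lpNormOn_mono_set hw.sol Ioo_subset_Ioi_self).trans h1
  · refine le_trans (le_of_eq_of_le ?_
      (lpNormOn_mono_set (J := Ioo a b) hw.deriv_mem Ioo_subset_Ioi_self)) h2
    refine lpNormOn_congr_ae ?_
    filter_upwards [hwu, ae_restrict_mem measurableSet_Ioo] with t h3 h4
    rw [h3, indicator_of_mem h4]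

end

/-! ### Orbits of the homogeneous equation -/

section

variable {X D : Type*} [NormedAddCommGroup X] [NormedSpace ℝ X]
  [NormedAddCommGroup D] [NormedSpace ℝ D]
variable {p a b K : ℝ} {I J : Set ℝ} {ι A : D →L[ℝ] X}

lemma MemLpOn.intervalIntegrable_Ioo {Y : Type*} [NormedAddCommGroup Y] (hp : 1 ≤ p) (hab : a ≤ b)
    {u : ℝ → Y} (h : MemLpOn p (Ioo a b) u) : IntervalIntegrable u volume a b := by
  rw [intervalIntegrable_iff_integrableOn_Ioo_of_le hab]
  exact h.integrableOn hp Subset.rfl (by simp)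

lemma norm_integral_le_lpNormOn (hp : 1 ≤ p) (hab : a < b) {u : ℝ → X}
    (hu : MemLpOn p (Ioo a b) u) :
    ‖∫ r in a..b, u r‖ ≤ lpNormOn p (Ioo a b) u * (b - a) ^ (1 - 1 / p) := by
  have h1 := eLpNorm_le_eLpNorm_mul_rpow_measure_univ (μ := volume.restrict (Ioo a b))
    (p := 1) (q := ENNReal.ofReal p) (by simpa using hp) hu.1
  rw [ENNReal.toReal_one, div_one, ENNReal.toReal_ofReal (by linarith),
    Measure.restrict_apply_univ, Real.volume_Ioo,
    ENNReal.ofReal_rpow_of_pos (by linarith)] at h1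
  have h2 := ENNReal.toReal_mono (ENNReal.mul_ne_top hu.2.ne ENNReal.ofReal_ne_top) h1
  rw [ENNReal.toReal_mul, ENNReal.toReal_ofReal (Real.rpow_nonneg (by linarith) _)] at h2
  refine le_trans ?_ h2
  rw [intervalIntegral.integral_of_le hab.le, integral_Ioc_eq_integral_Ioo]
  refine (norm_integral_le_integral_norm _).trans (le_of_eq ?_)
  rw [eLpNorm_one_eq_lintegral_enorm, integral_norm_eq_lintegral_enorm hu.1]

omit [NormedSpace ℝ X] in
lemma lpNormOn_const (hp : 1 ≤ p) (hab : a ≤ b) (x : X) :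
    lpNormOn p (Ioo a b) (fun _ => x) = ‖x‖ * (b - a) ^ (1 / p) := by
  rw [lpNormOn, eLpNorm_const' x (by simpa using (by linarith : 0 < p)) (by simp),
    ENNReal.toReal_mul, Measure.restrict_apply_univ, Real.volume_Ioo,
    ENNReal.toReal_ofReal (by linarith), ← ENNReal.toReal_rpow,
    ENNReal.toReal_ofReal (by linarith), toReal_enorm]

/-- The integrated form of `u' + A u = 0`, `u(0) = x`. -/
structure IsOrbit (p : ℝ) (I : Set ℝ) (ι A : D →L[ℝ] X) (x : D) (u : ℝ → D) : Prop where
  sol : MemLpOn p I u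
  eq : ∀ᵐ t ∂(volume.restrict I), ι (u t) = ι x - ∫ r in (0 : ℝ)..t, A (u r)

namespace IsOrbit
variable {x y : D} {u v : ℝ → D}

lemma mono (h : IsOrbit p I ι A x u) (hJ : J ⊆ I) : IsOrbit p J ι A x u :=
  ⟨h.sol.mono hJ, ae_mono (Measure.restrict_mono hJ le_rfl) h.eq⟩

lemma add (hp : 1 ≤ p) (hI : IsLeftInterval 0 I) (hu : IsOrbit p I ι A x u)
    (hv : IsOrbit p I ι A y v) : IsOrbit p I ι A (x + y) (fun t => u t + v t) := by
  refine ⟨MemLp.add hu.sol hv.sol, ?_⟩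
  filter_upwards [hu.eq, hv.eq, ae_restrict_mem hI.measurableSet] with t h1 h2 ht
  simp only [map_add]
  rw [h1, h2, intervalIntegral.integral_add
    ((hu.sol.clm_comp A).intervalIntegrable hp hI ht)
    ((hv.sol.clm_comp A).intervalIntegrable hp hI ht)]
  abel

lemma smul (c : ℝ) (hu : IsOrbit p I ι A x u) : IsOrbit p I ι A (c • x) (fun t => c • u t) := by
  refine ⟨MemLp.const_smul hu.sol c, ?_⟩
  filter_upwards [hu.eq] with t h1
  simp only [map_smul]
  rw [h1, intervalIntegral.integral_smul, smul_sub]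

lemma zeroSol_sub (hp : 1 ≤ p) (hI : IsLeftInterval 0 I) (hu : IsOrbit p I ι A x u)
    (hv : IsOrbit p I ι A x v) : ZeroSol p I 0 ι A (fun _ => 0) (fun t => u t - v t) := by
  have h := hu.add hp hI (hv.smul (-1))
  simp only [neg_smul, one_smul, add_neg_cancel, ← sub_eq_add_neg] at h
  refine ⟨h.sol, MemLp.zero', ?_⟩
  filter_upwards [h.eq] with t ht
  rw [ht, map_zero]
  simp only [zero_sub, intervalIntegral.integral_neg]

lemma unique (hp : 1 ≤ p) (h : HalfLineMR p ι A K 0) (hu : IsOrbit p (Ioi 0) ι A x u)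
    (hv : IsOrbit p (Ioi 0) ι A x v) : ∀ᵐ t ∂(volume.restrict (Ioi 0)), u t = v t := by
  have h1 := hu.zeroSol_sub hp (isLeftInterval_Ioi 0) hv
  have h2 := h.bound_sol _ _ h1
  have h3 : lpNormOn p (Ioi 0) (fun _ : ℝ => (0 : X)) = 0 := by simp [lpNormOn]
  rw [h3, mul_zero] at h2
  filter_upwards [ae_eq_zero_of_lpNormOn_eq_zero (by linarith) h1.sol
    (le_antisymm h2 (lpNormOn_nonneg _))] with t ht
  exact sub_eq_zero.1 ht

variable [CompleteSpace X] [CompleteSpace D]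

lemma unique_bounded (hp : 1 ≤ p) (hι : Function.Injective ι)
    (h : ∀ a, HalfLineMR p ι A K a) (hb : 0 < b) (hu : IsOrbit p (Ioo 0 b) ι A x u)
    (hv : IsOrbit p (Ioo 0 b) ι A x v) : ∀ᵐ t ∂(volume.restrict (Ioo 0 b)), u t = v t := by
  filter_upwards [(h 0).eq_zero_of_bounded hp hι (h b) hb
    (hu.zeroSol_sub hp (isLeftInterval_Ioo hb) hv)] with t ht
  exact sub_eq_zero.1 ht

omit [CompleteSpace D] in
-- Product rule for $r\,u(r)$: its derivative is $u+ru'=u-A(ru)$, and it vanishes at $0$.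
lemma integral_add_smul (hp : 1 ≤ p) (hu : MemLpOn p (Ioo 0 b) u) {t : ℝ} (ht : 0 < t)
    (htb : t ≤ b) (hx : ∀ᵐ t ∂(volume.restrict (Ioo 0 b)), ι (u t) = ι x - ∫ r in (0 : ℝ)..t, A (u r)) :
    ∫ r in (0 : ℝ)..t, (ι (u r) - A (r • u r)) = t • (ι x - ∫ r in (0 : ℝ)..t, A (u r)) := by
  have hi : IntervalIntegrable (fun r => -A (u r)) volume 0 t :=
    ((hu.clm_comp A).mono (Ioo_subset_Ioo_right htb)).intervalIntegrable_Ioo hp ht.le |>.neg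
  have h := smul_primitive_sub contDiff_id (ι x) hi
  simp only [id, zero_smul, sub_zero, intervalIntegral.integral_neg, ← sub_eq_add_neg] at h
  rw [← h]
  refine intervalIntegral.integral_congr_ae ?_
  have hne : ∀ᵐ r : ℝ, r ≠ b := by simp [ae_iff, measure_singleton]
  filter_upwards [(ae_restrict_iff' measurableSet_Ioo).1 hx, hne] with r hr hrb hrt
  rw [uIoc_of_le ht.le] at hrt
  rw [hr ⟨hrt.1, lt_of_le_of_ne (hrt.2.trans htb) hrb⟩]
  rw [show deriv id r = 1 from deriv_id r, one_smul, map_smul, smul_neg, sub_eq_add_neg]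

/-- The solution starting at `x` is bounded by the norm of `x` in `X`. -/
lemma norm_le (hp : 1 ≤ p) (hι : Function.Injective ι) (h : ∀ a, HalfLineMR p ι A K a)
    (hb : 0 < b) (hu : IsOrbit p (Ioo 0 b) ι A x u) :
    ‖ι x - ∫ r in (0 : ℝ)..b, A (u r)‖ ≤ K ^ 2 * ‖ι x‖ := by
  have hI := isLeftInterval_Ioo hb
  have hui := hu.sol.intervalIntegrable_indicator hp hI
  set U : ℝ → D := fun t => ∫ r in (0 : ℝ)..t, (Ioo 0 b).indicator u r with hU
  have hUc : Continuous U := intervalIntegral.continuous_primitive hui 0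
  have hUL : ∀ L : D →L[ℝ] X, ∀ t ∈ Ioo 0 b, L (U t) = ∫ r in (0 : ℝ)..t, L (u r) := by
    intro L t ht
    rw [hU]
    simp only [hI.integral_indicator u ht]
    exact (L.intervalIntegral_comp_comm (hu.sol.intervalIntegrable hp hI ht)).symm
  have e1 : ∀ᵐ t, t ∈ Ioo 0 b → ι (u t) = ι x - A (U t) := by
    filter_upwards [(ae_restrict_iff' measurableSet_Ioo).1 hu.eq] with t ht htI
    rw [ht htI, hUL A t htI]
  -- `U` solves `U' + A U = ι x` with `U(0) = 0`, and `U' = ι u`. The bound for the derivative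
  -- therefore controls `u` in $L^p(0,b;X)$ by $K\|x\|b^{1/p}$.
  have hz1 : ZeroSol p (Ioo 0 b) 0 ι A (fun _ => ι x) U := by
    refine ⟨memLpOn_Ioo_of_continuous hUc 0 b, memLpOn_Ioo_of_continuous continuous_const 0 b, ?_⟩
    filter_upwards [ae_restrict_mem measurableSet_Ioo] with t ht
    rw [hUL ι t ht]
    refine intervalIntegral.integral_congr_ae ?_
    filter_upwards [e1] with r hr hrt
    rw [uIoc_of_le ht.1.le] at hrt
    exact hr (hI.Ioc_subset t ht hrt)
  have b1 := (HalfLineMR.bound_bounded hp hι h hb hz1).2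
  rw [← lpNormOn_congr_ae ((ae_restrict_iff' measurableSet_Ioo).2 e1),
    lpNormOn_const hp hb.le] at b1
  -- The function `t • u t` solves the equation with data `ι u` and zero initial value, so its
  -- derivative is bounded by $K\|u\|_{L^p}$.
  have hz2 : ZeroSol p (Ioo 0 b) 0 ι A (fun t => ι (u t)) (fun t => t • u t) := by
    refine ⟨?_, hu.sol.clm_comp ι, ?_⟩
    · refine MemLp.of_le_mul (c := b) hu.sol (aestronglyMeasurable_id.smul hu.sol.1) ?_
      filter_upwards [ae_restrict_mem measurableSet_Ioo] with t ht
      rw [norm_smul, Real.norm_of_nonneg ht.1.le]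
      exact mul_le_mul_of_nonneg_right ht.2.le (norm_nonneg _)
    · filter_upwards [ae_restrict_mem measurableSet_Ioo, hu.eq] with t ht h2
      rw [integral_add_smul hp hu.sol ht.1 ht.2.le hu.eq, map_smul, h2]
  have b2 := (HalfLineMR.bound_bounded hp hι h hb hz2).2
  -- Hölder's inequality applied to $b\,u(b)=\int_0^b(tu)'$; the powers of `b` cancel, which makes
  -- the bound uniform in time.
  have b3 := norm_integral_le_lpNormOn hp hb hz2.deriv_mem
  rw [integral_add_smul hp hu.sol hb le_rfl hu.eq, norm_smul, Real.norm_of_nonneg hb.le,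
    sub_zero] at b3
  rw [sub_zero] at b1
  have hK := (h 0).nonneg
  have b4 : lpNormOn p (Ioo 0 b) (fun t => ι (u t) - A (t • u t))
      ≤ K * (K * (‖ι x‖ * b ^ (1 / p))) := b2.trans (mul_le_mul_of_nonneg_left b1 hK)
  have hbp : (0 : ℝ) < b ^ (1 - 1 / p) := by positivity
  have hbb : b ^ (1 / p) * b ^ (1 - 1 / p) = b := by
    rw [← Real.rpow_add hb]; simp
  refine le_of_mul_le_mul_left (b3.trans ((mul_le_mul_of_nonneg_right b4 hbp.le).trans
    (le_of_eq ?_))) hb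
  calc K * (K * (‖ι x‖ * b ^ (1 / p))) * b ^ (1 - 1 / p)
      = K * K * ‖ι x‖ * (b ^ (1 / p) * b ^ (1 - 1 / p)) := by ring
    _ = b * (K ^ 2 * ‖ι x‖) := by rw [hbb]; ring

end IsOrbit

/-- The function $e^{-t}x$ carries the initial value and belongs to $L^p(0,\infty;D)$. The remainder
starts at zero and solves the equation with data $e^{-t}(x-Ax)$. -/
lemma HalfLineMR.exists_orbit (hp : 1 ≤ p) [CompleteSpace X] (h : HalfLineMR p ι A K 0) (x : D) :
    ∃ u, IsOrbit p (Ioi 0) ι A x u := by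
  have hI := isLeftInterval_Ioi 0
  have hp0 : 0 < p := by linarith
  have hexp : MemLpOn p (Ioi 0) (fun t => Real.exp (-t) • (ι x - A x)) := by
    simpa only [sub_zero] using memLpOn_exp_smul hp0 0 (ι x - A x)
  have hexp' : MemLpOn p (Ioi 0) (fun t => Real.exp (-t) • x) := by
    simpa only [sub_zero] using memLpOn_exp_smul hp0 0 x
  obtain ⟨v, hv⟩ := h.exists_sol (fun t => Real.exp (-t) • (ι x - A x)) hexp
  refine ⟨fun t => v t + Real.exp (-t) • x, MemLp.add hv.sol hexp', ?_⟩
  filter_upwards [hv.eq, ae_restrict_mem measurableSet_Ioi] with t ht ht0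
  have hder : ∀ r ∈ uIcc 0 t, HasDerivAt (fun r => -(Real.exp (-r) • ι x))
      (Real.exp (-r) • ι x) r := by
    intro r _
    have h1 : HasDerivAt (fun r => Real.exp (-r)) (Real.exp (-r) * (-1)) r :=
      ((hasDerivAt_id r).neg).exp
    simpa using (h1.smul_const (ι x)).fun_neg
  have hi : IntervalIntegrable (fun r => Real.exp (-r) • ι x) volume 0 t :=
    Continuous.intervalIntegrable (by fun_prop) _ _
  have hi2 : IntervalIntegrable (fun r => Real.exp (-r) • A x) volume 0 t :=
    Continuous.intervalIntegrable (by fun_prop) _ _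
  have hvi := (hv.sol.clm_comp A).intervalIntegrable hp hI ht0
  have e := intervalIntegral.integral_eq_sub_of_hasDerivAt hder hi
  simp only [map_add, map_smul, smul_sub] at ht ⊢
  rw [ht, intervalIntegral.integral_sub (hi.sub hi2) hvi, intervalIntegral.integral_sub hi hi2,
    intervalIntegral.integral_add hvi hi2, e]
  simp
  abel

end

/-! ### The solution operators on `X` -/

section

variable {X D : Type*} [NormedAddCommGroup X] [NormedSpace ℝ X] [CompleteSpace X]
  [NormedAddCommGroup D] [NormedSpace ℝ D] [CompleteSpace D]
variable {p a b K M : ℝ} {I J : Set ℝ} {ι A : D →L[ℝ] X} {T : ℝ≥0 → X →L[ℝ] X}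

omit [CompleteSpace X] in
-- Closedness of `A` as an operator in `X`: its graph is the range of `ι.prod A`, a map bounded
-- below on a complete space. The factor `2` compares the sum with the maximum norm of the product.
lemma GraphNormEquiv.isClosed_range (h : GraphNormEquiv ι A) : IsClosed (range (ι.prod A)) := by
  obtain ⟨c, C, hc, -, h⟩ := h
  have : AntilipschitzWith (2 / c).toNNReal (ι.prod A) := by
    refine (ι.prod A).antilipschitz_of_bound fun x => ?_
    rw [Real.coe_toNNReal _ (by positivity)]
    have h1 := (h x).1
    have h2 := norm_fst_le (ι.prod A x)
    have h3 := norm_snd_le (ι.prod A x)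
    simp only [ContinuousLinearMap.prod_apply] at h2 h3 ⊢
    rw [div_mul_eq_mul_div, le_div_iff₀ hc]
    linarith
  exact this.isClosed_range (ι.prod A).uniformContinuous

omit [CompleteSpace X] [CompleteSpace D] in
lemma GraphNormEquiv.continuous_of_comp {S : Type*} [TopologicalSpace S] (h : GraphNormEquiv ι A)
    {z : S → D} (h1 : Continuous fun s => ι (z s)) (h2 : Continuous fun s => A (z s)) :
    Continuous z := by
  obtain ⟨c, C, hc, -, h⟩ := h
  rw [continuous_iff_continuousAt]
  intro s
  rw [ContinuousAt, tendsto_iff_norm_sub_tendsto_zero]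
  have h3 := ((tendsto_iff_norm_sub_tendsto_zero.1 (h1.tendsto s)).add
    (tendsto_iff_norm_sub_tendsto_zero.1 (h2.tendsto s))).const_mul c⁻¹
  rw [add_zero, mul_zero] at h3
  refine squeeze_zero (fun _ => norm_nonneg _) (fun r => ?_) h3
  have := (h (z r - z s)).1
  rw [map_sub, map_sub] at this
  rw [inv_mul_eq_div, le_div_iff₀ hc]
  linarith

omit [CompleteSpace X] [CompleteSpace D] in
lemma IsOrbit.continuous_value (hp : 1 ≤ p) {x : D} {u : ℝ → D} (hu : IsOrbit p (Ioi 0) ι A x u) :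
    Continuous fun t : ℝ≥0 => ι x - ∫ r in (0 : ℝ)..t, A (u r) := by
  have hI := isLeftInterval_Ioi 0
  have h1 : Continuous fun t : ℝ => ι x - ∫ r in (0 : ℝ)..t, (Ioi 0).indicator (fun r => A (u r)) r :=
    continuous_const.sub (intervalIntegral.continuous_primitive
      ((hu.sol.clm_comp A).intervalIntegrable_indicator hp hI) 0)
  refine (h1.comp NNReal.continuous_coe).congr fun t => ?_
  rcases eq_or_lt_of_le t.coe_nonneg with ht | ht
  · simp [← ht]
  · simp only [Function.comp]
    rw [hI.integral_indicator _ ht]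

/-- The solution operators of the homogeneous problem. -/
lemma HalfLineMR.exists_family (hp : 1 ≤ p) (hι : Function.Injective ι) (hd : DenseRange ι)
    (h : ∀ a, HalfLineMR p ι A K a) : ∃ T : ℝ≥0 → X →L[ℝ] X,
      (∀ t x, ‖T t x‖ ≤ K ^ 2 * ‖x‖) ∧
      ∀ x u, IsOrbit p (Ioi 0) ι A x u → ∀ t : ℝ≥0, T t (ι x) = ι x - ∫ r in (0 : ℝ)..t, A (u r) := by
  have hI := isLeftInterval_Ioi 0
  choose u hu using (h 0).exists_orbit hp
  have huniq : ∀ x v, IsOrbit p (Ioi 0) ι A x v → ∀ t : ℝ≥0,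
      ∫ r in (0 : ℝ)..t, A (u x r) = ∫ r in (0 : ℝ)..t, A (v r) := by
    intro x v hv t
    refine intervalIntegral.integral_congr_ae ?_
    rw [uIoc_of_le t.coe_nonneg]
    filter_upwards [(ae_restrict_iff' measurableSet_Ioi).1 ((hu x).unique hp (h 0) hv)] with r hr hrt
    rw [hr hrt.1]
  have hint : ∀ x, ∀ t : ℝ≥0, IntervalIntegrable (fun r => A (u x r)) volume 0 t := by
    intro x t
    exact ((hu x).sol.clm_comp A).mono (Ioo_subset_Ioi_self) |>.intervalIntegrable_Ioo hp t.2
  let L : ℝ≥0 → D →ₗ[ℝ] X := fun t =>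
    { toFun := fun x => ι x - ∫ r in (0 : ℝ)..t, A (u x r)
      map_add' := fun x y => by
        rw [huniq _ _ ((hu x).add hp hI (hu y)) t]
        simp only [map_add]
        rw [intervalIntegral.integral_add (hint x t) (hint y t)]
        abel
      map_smul' := fun c x => by
        rw [huniq _ _ ((hu x).smul c) t]
        simp only [map_smul, intervalIntegral.integral_smul, smul_sub, RingHom.id_apply] }
  -- The uniform bound in the norm of `X` lets each `L t` extend from the dense image of `D`. The
  -- value at `t = 0` is reached as a limit, since the orbit estimate needs an interval of positive
  -- length.
  have hL : ∀ t x, ‖L t x‖ ≤ K ^ 2 * ‖(ι : D →ₗ[ℝ] X) x‖ := by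
    intro t x
    have hpos : ∀ t : ℝ≥0, 0 < t → ‖L t x‖ ≤ K ^ 2 * ‖ι x‖ := fun t ht =>
      ((hu x).mono Ioo_subset_Ioi_self).norm_le hp hι h (by exact_mod_cast ht)
    rcases eq_or_lt_of_le (zero_le : 0 ≤ t) with rfl | ht
    · have hc : Tendsto (fun t => ‖L t x‖) (𝓝[>] 0) (𝓝 ‖L 0 x‖) :=
        ((hu x).continuous_value hp).norm.continuousWithinAt
      refine le_of_tendsto hc ?_
      filter_upwards [self_mem_nhdsWithin] with t ht using hpos t ht
    · exact hpos t ht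
  refine ⟨fun t => (L t).extendOfNorm (ι : D →ₗ[ℝ] X), fun t x =>
    LinearMap.norm_extendOfNorm_apply_le hd (K ^ 2) (hL t) x, fun x v hv t => ?_⟩
  rw [← huniq x v hv t]
  exact LinearMap.extendOfNorm_eq hd ⟨K ^ 2, hL t⟩ x

section Family
variable (hp : 1 ≤ p) (hι : Function.Injective ι) (hd : DenseRange ι) (hA : GraphNormEquiv ι A)
  (h : ∀ a, HalfLineMR p ι A K a) (hT : ∀ t x, ‖T t x‖ ≤ M * ‖x‖)
  (hTu : ∀ x u, IsOrbit p (Ioi 0) ι A x u → ∀ t : ℝ≥0,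
    T t (ι x) = ι x - ∫ r in (0 : ℝ)..t, A (u r))

include hp hd h hTu

omit [CompleteSpace D] in
lemma family_zero : T 0 = ContinuousLinearMap.id ℝ X := by
  refine ContinuousLinearMap.ext fun y => congrFun (hd.equalizer (T 0).continuous continuous_id
    (funext fun x => ?_)) y
  obtain ⟨u, hu⟩ := (h 0).exists_orbit hp x
  simp [hTu x u hu 0]

include hT

omit [CompleteSpace D] in
-- Orbits starting in `D` are continuous, and the bound on `T t` makes the approximation by them
-- uniform in time.
lemma family_continuous (x : X) : Continuous fun t => T t x := by
  refine continuous_of_uniform_approx_of_continuous fun s hs => ?_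
  obtain ⟨ε, hε, hεs⟩ := Metric.mem_uniformity_dist.1 hs
  have hM : 0 ≤ |M| := abs_nonneg M
  obtain ⟨y, hy⟩ := hd.exists_dist_lt x (show 0 < ε / (|M| + 1) by positivity)
  obtain ⟨u, hu⟩ := (h 0).exists_orbit hp y
  refine ⟨fun t => T t (ι y), (hu.continuous_value hp).congr fun t => (hTu y u hu t).symm,
    fun t => hεs ?_⟩
  rw [dist_eq_norm, ← map_sub]
  rw [dist_eq_norm] at hy
  calc ‖T t (x - ι y)‖ ≤ M * ‖x - ι y‖ := hT t _
    _ ≤ (|M| + 1) * ‖x - ι y‖ := by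
      gcongr; linarith [le_abs_self M]
    _ < ε := by
      rw [lt_div_iff₀ (by positivity)] at hy
      linarith

omit [CompleteSpace D] in
lemma family_add (s t : ℝ≥0) : T (s + t) = (T s).comp (T t) := by
  have hI := isLeftInterval_Ioi 0
  have hcont := family_continuous hp hd h hT hTu
  refine ContinuousLinearMap.ext fun y => congrFun (hd.equalizer (T (s + t)).continuous
    ((T s).comp (T t)).continuous (funext fun x => ?_)) y
  obtain ⟨u, hu⟩ := (h 0).exists_orbit hp x
  -- For almost every `r` the value of the orbit at time `r` is `ι (u r)` with `u r` in `D`, so the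
  -- translated function is an orbit starting at `u r`.
  have key : ∀ᵐ r : ℝ, 0 < r → T (s + r.toNNReal) (ι x) = T s (T r.toNNReal (ι x)) := by
    filter_upwards [(ae_restrict_iff' measurableSet_Ioi).1 hu.eq] with r hr hr0
    have hint : ∀ q : ℝ, 0 ≤ q → IntervalIntegrable (fun r => A (u r)) volume 0 q := fun q hq =>
      ((hu.sol.clm_comp A).mono Ioo_subset_Ioi_self).intervalIntegrable_Ioo hp hq
    have hsplit : ∀ q : ℝ, 0 ≤ q → ι x - ∫ r in (0 : ℝ)..(q + r), A (u r)
        = ι (u r) - ∫ v in (0 : ℝ)..q, A (u (v + r)) := by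
      intro q hq
      rw [intervalIntegral.integral_comp_add_right (fun v => A (u v)), zero_add, hr hr0,
        sub_sub, intervalIntegral.integral_add_adjacent_intervals (hint r hr0.le)
          ((hint r hr0.le).symm.trans (hint (q + r) (by positivity)))]
    have hor : IsOrbit p (Ioi 0) ι A (u r) (fun t => u (t + r)) := by
      have e2 : ((fun t : ℝ => t - (-r)) ⁻¹' Ioi r) = Ioi 0 := by simp
      have hsub : Ioi r ⊆ Ioi (0 : ℝ) := Ioi_subset_Ioi hr0.le
      refine ⟨?_, ?_⟩
      · have := (hu.sol.mono hsub).comp_sub measurableSet_Ioi (-r)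
        rw [e2] at this
        simpa only [sub_neg_eq_add] using this
      · have := ((measurePreserving_sub_right volume (-r)).restrict_preimage
          (measurableSet_Ioi (a := r))).quasiMeasurePreserving.ae
          (ae_mono (Measure.restrict_mono hsub le_rfl) hu.eq)
        rw [e2] at this
        filter_upwards [this, ae_restrict_mem measurableSet_Ioi] with q hq hq0
        rw [sub_neg_eq_add] at hq
        rw [hq, hsplit q (le_of_lt hq0)]
    rw [hTu x u hu r.toNNReal, Real.coe_toNNReal r hr0.le, ← hr hr0, hTu _ _ hor, hTu x u hu,
      NNReal.coe_add, Real.coe_toNNReal r hr0.le, hsplit s s.coe_nonneg]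
  -- Continuity removes the exceptional null set of times and includes `r = 0`.
  have hcl : ∀ r : ℝ, 0 ≤ r → T (s + r.toNNReal) (ι x) = T s (T r.toNNReal (ι x)) := by
    have c1 : Continuous fun r : ℝ => T (s + r.toNNReal) (ι x) :=
      (hcont (ι x)).comp (continuous_const.add continuous_real_toNNReal)
    have c2 : Continuous fun r : ℝ => T s (T r.toNNReal (ι x)) :=
      (T s).continuous.comp ((hcont (ι x)).comp continuous_real_toNNReal)
    have h1 : EqOn (fun r : ℝ => T (s + r.toNNReal) (ι x)) (fun r : ℝ => T s (T r.toNNReal (ι x)))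
        (Ioi 0) :=
      Measure.eqOn_open_of_ae_eq (μ := volume) ((ae_restrict_iff' measurableSet_Ioi).2 key)
        isOpen_Ioi c1.continuousOn c2.continuousOn
    have h2 := h1.closure c1 c2
    rw [closure_Ioi] at h2
    exact fun r hr => h2 hr
  simpa using hcl t t.coe_nonneg

end Family

end

/-! ### Identification of the generator -/

section

variable {X D : Type*} [NormedAddCommGroup X] [NormedSpace ℝ X] [CompleteSpace X]
  [NormedAddCommGroup D] [NormedSpace ℝ D] [CompleteSpace D]
variable {p a b K M : ℝ} {I J : Set ℝ} {ι A : D →L[ℝ] X} {T : ℝ≥0 → X →L[ℝ] X}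

section Family
variable (hp : 1 ≤ p) (hι : Function.Injective ι) (hd : DenseRange ι) (hA : GraphNormEquiv ι A)
  (h : ∀ a, HalfLineMR p ι A K a) (hT : ∀ t x, ‖T t x‖ ≤ M * ‖x‖)
  (hTu : ∀ x u, IsOrbit p (Ioi 0) ι A x u → ∀ t : ℝ≥0,
    T t (ι x) = ι x - ∫ r in (0 : ℝ)..t, A (u r))

include hp hd h hTu hT hA

/-- This is $\int_0^tT(r)x\,dr\in D$ with $A\int_0^tT(r)x\,dr=x-T(t)x$. On `D` it is the integrated
equation; it extends to `X` because the graph of `A` is closed and the pair depends continuously on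
`x`. -/
lemma family_integral_mem_range (x : X) (t : ℝ≥0) :
    ((∫ r in (0 : ℝ)..t, T r.toNNReal x, x - T t x) : X × X) ∈ range (ι.prod A) := by
  have hcont := family_continuous hp hd h hT hTu
  have hcr : ∀ x, Continuous fun r : ℝ => T r.toNNReal x := fun x =>
    (hcont x).comp continuous_real_toNNReal
  refine hd.induction_on (p := fun x => ((∫ r in (0 : ℝ)..t, T r.toNNReal x, x - T t x) : X × X) ∈
    range (ι.prod A)) x (hA.isClosed_range.preimage ?_) fun y => ?_
  · refine Continuous.prodMk ?_ (continuous_id.sub (T t).continuous)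
    refine LipschitzWith.continuous (K := (M * t).toNNReal) (LipschitzWith.of_dist_le_mul
      fun x y => ?_)
    rw [dist_eq_norm, dist_eq_norm, ← intervalIntegral.integral_sub
      ((hcr x).intervalIntegrable _ _) ((hcr y).intervalIntegrable _ _)]
    have := intervalIntegral.norm_integral_le_of_norm_le_const (a := 0) (b := (t : ℝ))
      (f := fun r => T r.toNNReal x - T r.toNNReal y) (C := M * ‖x - y‖) fun r _ => by
        rw [← map_sub]; exact hT _ _
    rw [sub_zero, abs_of_nonneg t.coe_nonneg] at this
    refine this.trans ?_
    calc M * ‖x - y‖ * t = M * t * ‖x - y‖ := by ring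
      _ ≤ _ := mul_le_mul_of_nonneg_right (Real.le_coe_toNNReal _) (norm_nonneg _)
  · obtain ⟨u, hu⟩ := (h 0).exists_orbit hp y
    have hi : IntervalIntegrable u volume 0 t :=
      (hu.sol.mono Ioo_subset_Ioi_self).intervalIntegrable_Ioo hp t.coe_nonneg
    refine ⟨∫ r in (0 : ℝ)..t, u r, Prod.ext ?_ ?_⟩
    · simp only [ContinuousLinearMap.prod_apply]
      rw [← ι.intervalIntegral_comp_comm hi]
      refine intervalIntegral.integral_congr_ae ?_
      filter_upwards [(ae_restrict_iff' measurableSet_Ioi).1 hu.eq] with r hr hrt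
      rw [uIoc_of_le t.coe_nonneg] at hrt
      rw [hr hrt.1, hTu y u hu, Real.coe_toNNReal r hrt.1.le]
    · simp only [ContinuousLinearMap.prod_apply]
      rw [← A.intervalIntegral_comp_comm hi, hTu y u hu, sub_sub_cancel]

include hι

/-- Gives `A` applied before the semigroup instead of after it. With `d s` in `D` representing
$\int_0^sT(r)Ax\,dr$, one has $A(x-d(s))=T(s)Ax$, so $x-d$ is itself an orbit from `x`; uniqueness
on bounded intervals identifies it with the given one. -/
lemma family_apply (x : D) (t : ℝ≥0) :
    T t (ι x) = ι x - ∫ r in (0 : ℝ)..t, T r.toNNReal (A x) := by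
  have hcont := family_continuous hp hd h hT hTu
  have hcr : ∀ x, Continuous fun r : ℝ => T r.toNNReal x := fun x =>
    (hcont x).comp continuous_real_toNNReal
  rcases eq_or_lt_of_le (zero_le : 0 ≤ t) with rfl | ht
  · simp [family_zero hp hd h hTu]
  choose d hdd using family_integral_mem_range hp hd hA h hT hTu (A x)
  have hιd : ∀ s, ι (d s) = ∫ r in (0 : ℝ)..s, T r.toNNReal (A x) := fun s =>
    congrArg Prod.fst (hdd s)
  have hAd : ∀ s, A (d s) = A x - T s (A x) := fun s => congrArg Prod.snd (hdd s)
  have hdc : Continuous d := by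
    refine hA.continuous_of_comp ?_ ?_
    · simp only [hιd]
      exact (intervalIntegral.continuous_primitive
        (fun _ _ => (hcr (A x)).intervalIntegrable _ _) 0).comp NNReal.continuous_coe
    · simp only [hAd]
      exact continuous_const.sub (hcont (A x))
  have hAz : ∀ r : ℝ, A (x - d r.toNNReal) = T r.toNNReal (A x) := fun r => by
    rw [map_sub, hAd, sub_sub_cancel]
  have hor : IsOrbit p (Ioo 0 t) ι A x (fun r => x - d r.toNNReal) := by
    refine ⟨memLpOn_Ioo_of_continuous
      (continuous_const.sub (hdc.comp continuous_real_toNNReal)) _ _, ?_⟩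
    filter_upwards [ae_restrict_mem measurableSet_Ioo] with r hr
    simp only [hAz]
    rw [map_sub, hιd, Real.coe_toNNReal r hr.1.le]
  obtain ⟨u, hu⟩ := (h 0).exists_orbit hp x
  have ht' : (0 : ℝ) < t := ht
  have heq := IsOrbit.unique_bounded hp hι h ht' (hu.mono Ioo_subset_Ioi_self) hor
  rw [hTu x u hu]
  congr 1
  rw [intervalIntegral.integral_of_le ht'.le, intervalIntegral.integral_of_le ht'.le,
    integral_Ioc_eq_integral_Ioo, integral_Ioc_eq_integral_Ioo]
  refine integral_congr_ae ?_
  filter_upwards [heq] with r hr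
  rw [hr, hAz]

lemma family_isSemigroupOf : IsSemigroupOf ι A T where
  zero := family_zero hp hd h hTu
  add := family_add hp hd h hT hTu
  continuous := family_continuous hp hd h hT hTu
  generator x y := by
    have hcont := family_continuous hp hd h hT hTu
    have hcr : ∀ x, Continuous fun r : ℝ => T r.toNNReal x := fun x =>
      (hcont x).comp continuous_real_toNNReal
    have h0 := family_zero hp hd h hTu
    have hcoe : Tendsto (fun s : ℝ≥0 => (s : ℝ)) (𝓝[>] 0) (𝓝[≠] 0) := by
      refine tendsto_nhdsWithin_iff.2 ⟨(NNReal.continuous_coe.tendsto 0).mono_left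
        nhdsWithin_le_nhds, ?_⟩
      filter_upwards [self_mem_nhdsWithin] with s hs
      have : (0 : ℝ≥0) < s := hs
      simpa using this.ne'
    have hder : ∀ x, Tendsto (fun s : ℝ≥0 => (s : ℝ)⁻¹ • ∫ r in (0 : ℝ)..s, T r.toNNReal x)
        (𝓝[>] 0) (𝓝 x) := by
      intro x
      have h1 : HasDerivAt (fun s : ℝ => ∫ r in (0 : ℝ)..s, T r.toNNReal x)
          (T (0 : ℝ).toNNReal x) 0 := ((hcr x).integral_hasStrictDerivAt 0 0).hasDerivAt
      have h2 := (hasDerivAt_iff_tendsto_slope_zero.1 h1).comp hcoe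
      simpa [h0, Function.comp_def] using h2
    constructor
    · intro hlim
      -- The averages $s^{-1}\int_0^sT(r)x\,dr$ tend to `x`, and their images under `A` are
      -- $s^{-1}(x-T(s)x)$, tending to `-y`; the closed graph contains the limit.
      have hmem : ((x, -y) : X × X) ∈ range (ι.prod A) := by
        refine hA.isClosed_range.mem_of_tendsto ((hder x).prodMk_nhds hlim.neg)
          (Eventually.of_forall fun s => ?_)
        obtain ⟨d, hd'⟩ := family_integral_mem_range hp hd hA h hT hTu x s
        refine ⟨(s : ℝ)⁻¹ • d, ?_⟩
        rw [map_smul, hd', Prod.smul_mk, ← smul_neg, neg_sub]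
      obtain ⟨d, hd'⟩ := hmem
      have h1 : ι d = x := congrArg Prod.fst hd'
      have h2 : A d = -y := congrArg Prod.snd hd'
      exact ⟨d, h1, by rw [h2, neg_neg]⟩
    · rintro ⟨d, rfl, rfl⟩
      refine (hder (A d)).neg.congr fun s => ?_
      rw [family_apply hp hι hd hA h hT hTu d s, sub_sub_cancel_left, smul_neg]

end Family

/-! ### Arbitrary semigroups generated by `-A` -/

namespace IsSemigroupOf
variable (hS : IsSemigroupOf ι A T)
include hS

omit [CompleteSpace X] [CompleteSpace D] in
lemma continuous_real (x : X) : Continuous fun r : ℝ => T r.toNNReal x :=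
  (hS.continuous x).comp continuous_real_toNNReal

omit [CompleteSpace X] [CompleteSpace D] in
lemma tendsto_slope (x : D) (t : ℝ≥0) :
    Tendsto (fun h : ℝ≥0 => (h : ℝ)⁻¹ • (T (t + h) (ι x) - T t (ι x))) (𝓝[>] 0)
      (𝓝 (-(T t (A x)))) := by
  have h1 := (hS.generator (ι x) (-(A x))).2 ⟨x, rfl, rfl⟩
  have h2 := ((T t).continuous.tendsto _).comp h1
  rw [map_neg] at h2
  refine h2.congr fun s => ?_
  simp [hS.add]

omit [CompleteSpace X] [CompleteSpace D] in
-- The semigroup preserves the domain and commutes with `A` there, because the difference quotient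
-- at $T(t)x$ is $T(t)$ applied to the one at $x$.
lemma exists_domain (x : D) (t : ℝ≥0) :
    ∃ d : D, ι d = T t (ι x) ∧ A d = T t (A x) := by
  obtain ⟨d, h1, h2⟩ := (hS.generator (T t (ι x)) (-(T t (A x)))).1 (by
    refine (hS.tendsto_slope x t).congr fun s => ?_
    rw [add_comm, hS.add]; rfl)
  exact ⟨d, h1, (neg_injective h2).symm⟩

omit [CompleteSpace D] in
-- The generator supplies right derivatives only; for a continuous function with integrable right
-- derivative this is enough to integrate.
lemma apply_eq (x : D) (t : ℝ≥0) :
    T t (ι x) = ι x - ∫ r in (0 : ℝ)..t, T r.toNNReal (A x) := by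
  have h1 := intervalIntegral.integral_eq_sub_of_hasDeriv_right (a := 0) (b := (t : ℝ))
    (f := fun r => T r.toNNReal (ι x)) (f' := fun r => -(T r.toNNReal (A x)))
    (hS.continuous_real _).continuousOn (fun r hr => ?_)
    ((hS.continuous_real _).neg.intervalIntegrable _ _)
  · rw [intervalIntegral.integral_neg] at h1
    simp only [Real.toNNReal_coe, Real.toNNReal_zero, hS.zero,
      ContinuousLinearMap.id_apply] at h1
    rw [sub_eq_add_neg, h1]; abel
  · rw [min_eq_left t.coe_nonneg] at hr
    rw [hasDerivWithinAt_iff_tendsto_slope' (by simp)]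
    have h2 := hS.tendsto_slope x r.toNNReal
    have h3 : Tendsto (fun q : ℝ => (q - r).toNNReal) (𝓝[>] r) (𝓝[>] 0) := by
      refine tendsto_nhdsWithin_iff.2 ⟨?_, ?_⟩
      · have : Continuous fun q : ℝ => (q - r).toNNReal :=
          continuous_real_toNNReal.comp (continuous_id.sub continuous_const)
        simpa using (this.tendsto r).mono_left nhdsWithin_le_nhds
      · filter_upwards [self_mem_nhdsWithin] with q hq
        simpa using hq
    refine (h2.comp h3).congr' ?_
    filter_upwards [self_mem_nhdsWithin] with q hq
    have hq' : r < q := hq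
    simp only [Function.comp]
    rw [Real.coe_toNNReal _ (by linarith), ← Real.toNNReal_add hr.1.le (by linarith),
      add_sub_cancel, slope_def_module]

/-- The semigroup orbit of an element of `D` is continuous into `D` by the graph norm and solves the
integrated homogeneous equation, so the orbit estimate applies; density extends it to `X`. -/
lemma norm_le (hp : 1 ≤ p) (hι : Function.Injective ι) (hd : DenseRange ι)
    (hA : GraphNormEquiv ι A) (h : ∀ a, HalfLineMR p ι A K a) (t : ℝ≥0) (x : X) :
    ‖T t x‖ ≤ K ^ 2 * ‖x‖ := by
  have hpos : ∀ t : ℝ≥0, 0 < t → ∀ x : D, ‖T t (ι x)‖ ≤ K ^ 2 * ‖ι x‖ := by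
    intro t ht x
    choose d hιd hAd using hS.exists_domain x
    have hdc : Continuous d := hA.continuous_of_comp (by simpa only [hιd] using hS.continuous _)
      (by simpa only [hAd] using hS.continuous _)
    have hor : IsOrbit p (Ioo 0 t) ι A x (fun r => d r.toNNReal) := by
      refine ⟨memLpOn_Ioo_of_continuous (hdc.comp continuous_real_toNNReal) _ _, ?_⟩
      filter_upwards [ae_restrict_mem measurableSet_Ioo] with r hr
      simp only [hAd]
      rw [hιd, hS.apply_eq, Real.coe_toNNReal r hr.1.le]
    have := hor.norm_le hp hι h (by exact_mod_cast ht)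
    simp only [hAd] at this
    rwa [hS.apply_eq]
  refine hd.induction_on (p := fun x => ‖T t x‖ ≤ K ^ 2 * ‖x‖) x
    (isClosed_le (T t).continuous.norm (continuous_const.mul continuous_norm)) fun x => ?_
  rcases eq_or_lt_of_le (zero_le : 0 ≤ t) with rfl | ht
  · refine le_of_tendsto (((hS.continuous (ι x)).norm.continuousWithinAt (s := Ioi 0) (x := 0))) ?_
    filter_upwards [self_mem_nhdsWithin] with t ht using hpos t ht x
  · exact hpos t ht x

end IsSemigroupOf
end

/-! ### The variation of constants estimate -/

section

variable {X D : Type*} [NormedAddCommGroup X] [NormedSpace ℝ X] [CompleteSpace X]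
  [NormedAddCommGroup D] [NormedSpace ℝ D] [CompleteSpace D]
variable {p a b K M : ℝ} {I J : Set ℝ} {ι A : D →L[ℝ] X} {T : ℝ≥0 → X →L[ℝ] X}

omit [CompleteSpace X] in
/-- Product rule for a strongly differentiable bounded family of operators. -/
lemma hasDerivAt_family_apply {S : ℝ → X →L[ℝ] X} (hS : ∀ q x, ‖S q x‖ ≤ M * ‖x‖) {f : ℝ → X}
    {f' g' : X} {r : ℝ} (hf : HasDerivAt f f' r) (hSc : ContinuousAt (fun q => S q f') r)
    (hSd : HasDerivAt (fun q => S q (f r)) g' r) :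
    HasDerivAt (fun q => S q (f q)) (g' + S r f') r := by
  rw [hasDerivAt_iff_tendsto_slope] at hf hSd ⊢
  have h1 : Tendsto (fun q => S q (slope f r q - f')) (𝓝[≠] r) (𝓝 0) := by
    have h2 : Tendsto (fun q => M * ‖slope f r q - f'‖) (𝓝[≠] r) (𝓝 (M * 0)) :=
      (tendsto_iff_norm_sub_tendsto_zero.1 hf).const_mul M
    rw [mul_zero] at h2
    exact squeeze_zero_norm (fun q => hS q _) h2
  have h3 := (hSd.add (h1.add (hSc.tendsto.mono_left nhdsWithin_le_nhds)))
  rw [zero_add] at h3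
  refine h3.congr fun q => ?_
  simp only [slope_def_module, map_sub, map_smul, smul_sub]
  abel

omit [CompleteSpace D] in
lemma IsSemigroupOf.hasDerivAt (hS : IsSemigroupOf ι A T) (x : D) {s : ℝ} (hs : 0 < s) :
    HasDerivAt (fun q : ℝ => T q.toNNReal (ι x)) (-(T s.toNNReal (A x))) s := by
  have h1 : HasDerivAt (fun q : ℝ => ι x - ∫ r in (0 : ℝ)..q, T r.toNNReal (A x))
      (-(T s.toNNReal (A x))) s :=
    ((hS.continuous_real (A x)).integral_hasStrictDerivAt 0 s).hasDerivAt.const_sub (ι x)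
  refine h1.congr_of_eventuallyEq ?_
  filter_upwards [lt_mem_nhds hs] with q hq
  rw [hS.apply_eq, Real.coe_toNNReal q hq.le]

/-- The estimate given by the variation of constants formula. -/
lemma ZeroSol.norm_integral_le (hp : 1 ≤ p) (hS : IsSemigroupOf ι A T)
    (hM : ∀ t x, ‖T t x‖ ≤ M * ‖x‖) (hM0 : 0 ≤ M) {h : ℝ → X} {w : ℝ → D}
    (hw : ZeroSol p (Ioi a) a ι A h w) {t : ℝ} (ht : a < t) :
    ‖∫ r in a..t, (h r - A (w r))‖ ≤ M * ∫ r in a..t, ‖h r‖ := by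
  have hI := isLeftInterval_Ioi a
  set w' := (Ioi a).indicator w with hw'
  set h' := (Ioi a).indicator h with hh'
  have hwi : ∀ s t, IntervalIntegrable w' volume s t := hw.sol.intervalIntegrable_indicator hp hI
  have hhi : ∀ s t, IntervalIntegrable h' volume s t := hw.data.intervalIntegrable_indicator hp hI
  have hLi : ∀ (L : D →L[ℝ] X) s t, IntervalIntegrable (fun r => L (w' r)) volume s t :=
    fun L s t => ⟨L.integrable_comp (hwi s t).1, L.integrable_comp (hwi s t).2⟩
  set g := fun r => h' r - A (w' r) with hg
  have hgi : ∀ s t, IntervalIntegrable g volume s t := fun s t => (hhi s t).sub (hLi A s t)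
  have hgeq : ∀ s, a < s → ∫ r in a..s, g r = ∫ r in a..s, (h r - A (w r)) := by
    intro s hs
    refine intervalIntegral_congr_uIoc fun r hr => ?_
    rw [uIoc_of_le hs.le] at hr
    simp [hg, hw', hh', indicator_of_mem (show r ∈ Ioi a from hr.1)]
  -- `c` is the continuous representative of `ι w`, while `w` is only $L^p$ in `D`. The product rule
  -- for $T(t-q)w(q)$ is therefore applied to increments of the primitive `W`, which lie in `D` at
  -- every time.
  set c : ℝ → X := fun s => ∫ r in a..s, g r with hc
  have hcc : Continuous c := intervalIntegral.continuous_primitive hgi a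
  set W : ℝ → D := fun s => ∫ r in a..s, w' r with hW
  set C : ℝ → X := fun s => ∫ r in a..s, c r with hC
  set H : ℝ → ℝ := fun s => ∫ r in a..s, ‖h' r‖ with hH
  have hHc : Continuous H := intervalIntegral.continuous_primitive (fun s t => (hhi s t).norm) a
  have hHm : Monotone H := fun s q hsq => by
    have := intervalIntegral.integral_interval_sub_left (hhi a q).norm (hhi a s).norm
    have h2 := intervalIntegral.integral_nonneg (μ := volume) hsq
      (f := fun r => ‖h' r‖) fun _ _ => norm_nonneg _
    show (∫ r in a..s, ‖h' r‖) ≤ ∫ r in a..q, ‖h' r‖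
    linarith
  have hCd : ∀ s, HasDerivAt C (c s) s := fun s => (hcc.integral_hasStrictDerivAt a s).hasDerivAt
  have hιW : ∀ s, a ≤ s → ι (W s) = C s := by
    intro s hs
    rw [hW, hC]
    simp only
    rw [← ι.intervalIntegral_comp_comm (hwi a s)]
    refine intervalIntegral.integral_congr_ae ?_
    filter_upwards [(ae_restrict_iff' measurableSet_Ioi).1 hw.eq] with r hr hrs
    rw [uIoc_of_le hs] at hrs
    rw [hw', indicator_of_mem (show r ∈ Ioi a from hrs.1), hr hrs.1, ← hgeq r hrs.1]
  -- Since $y'+Az=\int_s^{s+\delta}h$ and $y=\iota z$, the derivative of $T(t-q)y(q)$ is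
  -- $T(t-q)\int_q^{q+\delta}h$. Integrating its norm bounds the increment of `C`; dividing by `δ`
  -- and letting $\delta\to0$ gives the estimate for `c`.
  have key : ∀ δ > 0, ‖δ⁻¹ • (C (t + δ) - C t)‖ ≤
      M * (‖δ⁻¹ • (C (a + δ) - C a)‖ + H (t + δ)) := by
    intro δ hδ
    set z : ℝ → D := fun s => W (s + δ) - W s with hz
    set y : ℝ → X := fun s => C (s + δ) - C s with hy
    have hyz : ∀ s, a ≤ s → ι (z s) = y s := fun s hs => by
      rw [hz, map_sub, hιW s hs, hιW (s + δ) (by linarith)]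
    have hyd : ∀ s, HasDerivAt y (c (s + δ) - c s) s := fun s =>
      ((hCd (s + δ)).comp_add_const s δ).sub (hCd s)
    have hyd2 : ∀ s, c (s + δ) - c s = (∫ r in s..(s + δ), h' r) - A (z s) := by
      intro s
      simp only [hc, hz, hW]
      rw [intervalIntegral.integral_interval_sub_left (hgi _ _) (hgi _ _),
        intervalIntegral.integral_interval_sub_left (hwi _ _) (hwi _ _),
        ← A.intervalIntegral_comp_comm (hwi _ _), ← intervalIntegral.integral_sub (hhi _ _)
        (hLi A _ _)]
    have hk : ∀ s, ‖∫ r in s..(s + δ), h' r‖ ≤ H (s + δ) - H s := by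
      intro s
      simp only [hH]
      rw [intervalIntegral.integral_interval_sub_left (hhi _ _).norm (hhi _ _).norm]
      exact intervalIntegral.norm_integral_le_integral_norm (by linarith)
    have hHδ : Continuous fun s => H (s + δ) - H s :=
      (hHc.comp (continuous_id.add continuous_const)).sub hHc
    have hB : ∀ s, HasDerivAt (fun s => M * (‖y a‖ + ∫ r in a..s, (H (r + δ) - H r)))
        (M * (H (s + δ) - H s)) s := fun s =>
      (((hHδ.integral_hasStrictDerivAt a s).hasDerivAt).const_add _).const_mul M
    have hF : ∀ r ∈ Ico a t, HasDerivAt (fun q => T (t - q).toNNReal (y q))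
        (T (t - r).toNNReal (∫ v in r..(r + δ), h' v)) r := by
      intro r hr
      have h1 : HasDerivAt (fun q => T (t - q).toNNReal (y r))
          (T (t - r).toNNReal (A (z r))) r := by
        rw [← hyz r hr.1]
        have h2 := (hS.hasDerivAt (z r) (s := t - r) (by linarith [hr.2])).scomp r
          ((hasDerivAt_id r).const_sub t)
        simpa [Function.comp_def] using h2
      have h3 : ContinuousAt (fun q => T (t - q).toNNReal (c (r + δ) - c r)) r :=
        ((hS.continuous_real _).comp (continuous_const.sub continuous_id)).continuousAt
      have h4 := hasDerivAt_family_apply (S := fun q => T (t - q).toNNReal)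
        (fun q x => hM _ x) (hyd r) h3 h1
      rwa [hyd2, ← map_add, add_sub_cancel] at h4
    have hyc : Continuous y := continuous_iff_continuousAt.2 fun s => (hyd s).continuousAt
    -- At `q = t` the semigroup is evaluated at time zero, where no two-sided derivative is
    -- available; continuity there follows from the uniform bound and strong continuity.
    have hFc : ContinuousOn (fun q => T (t - q).toNNReal (y q)) (Icc a t) := by
      intro r hr
      rcases lt_or_eq_of_le hr.2 with h | h
      · exact (hF r ⟨hr.1, h⟩).continuousAt.continuousWithinAt
      · refine ContinuousAt.continuousWithinAt ?_
        rw [ContinuousAt, tendsto_iff_norm_sub_tendsto_zero]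
        have l1 : Tendsto (fun q => M * ‖y q - y r‖) (𝓝 r) (𝓝 (M * 0)) :=
          (tendsto_iff_norm_sub_tendsto_zero.1 (hyc.tendsto r)).const_mul M
        have l2 : Tendsto (fun q => ‖T (t - q).toNNReal (y r) - T (t - r).toNNReal (y r)‖)
            (𝓝 r) (𝓝 0) := tendsto_iff_norm_sub_tendsto_zero.1
          (((hS.continuous_real (y r)).comp (continuous_const.sub continuous_id)).tendsto r)
        have l3 := l1.add l2
        rw [mul_zero, add_zero] at l3
        refine squeeze_zero (fun _ => norm_nonneg _) (fun q => ?_) l3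
        calc ‖T (t - q).toNNReal (y q) - T (t - r).toNNReal (y r)‖
            = ‖T (t - q).toNNReal (y q - y r)
                + (T (t - q).toNNReal (y r) - T (t - r).toNNReal (y r))‖ := by
              rw [(T (t - q).toNNReal).map_sub (y q) (y r), sub_add_sub_cancel]
          _ ≤ _ := (norm_add_le _ _).trans (by gcongr; exact hM _ _)
    have hfin := image_norm_le_of_norm_deriv_right_le_deriv_boundary' hFc
      (fun r hr => (hF r hr).hasDerivWithinAt)
      (B := fun s => M * (‖y a‖ + ∫ r in a..s, (H (r + δ) - H r)))
      (by simpa using hM _ (y a))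
      (fun s _ => (hB s).continuousAt.continuousWithinAt) (fun s _ => (hB s).hasDerivWithinAt)
      (fun s _ => (hM _ _).trans (mul_le_mul_of_nonneg_left (hk s) hM0))
      (right_mem_Icc.2 ht.le)
    simp only [sub_self, Real.toNNReal_zero, hS.zero, ContinuousLinearMap.id_apply] at hfin
    have hHi : ∀ s q, IntervalIntegrable H volume s q := fun s q => hHc.intervalIntegrable _ _
    -- The integral telescopes to $\int_t^{t+\delta}H-\int_a^{a+\delta}H$, with `H` nonnegative on
    -- $[a,a+\delta]$ and increasing.
    have hint : ∫ r in a..t, (H (r + δ) - H r) ≤ δ * H (t + δ) := by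
      have hHs : Continuous fun r => H (r + δ) := hHc.comp (continuous_id.add continuous_const)
      rw [intervalIntegral.integral_sub (hHs.intervalIntegrable _ _) (hHi _ _),
        intervalIntegral.integral_comp_add_right H]
      have e1 := intervalIntegral.integral_add_adjacent_intervals (hHi a (a + δ))
        (hHi (a + δ) (t + δ))
      have e2 := intervalIntegral.integral_add_adjacent_intervals (hHi a t) (hHi t (t + δ))
      have e3 : 0 ≤ ∫ r in a..(a + δ), H r :=
        intervalIntegral.integral_nonneg (by linarith) fun r hr => by
          have := hHm hr.1
          simpa [hH] using this
      have e4 : ∫ r in t..(t + δ), H r ≤ δ * H (t + δ) := by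
        have := intervalIntegral.integral_mono_on (by linarith : t ≤ t + δ) (hHi t (t + δ))
          (intervalIntegrable_const (c := H (t + δ))) fun r hr => hHm hr.2
        simpa using this
      linarith
    rw [norm_smul, norm_smul, Real.norm_of_nonneg (inv_nonneg.2 hδ.le)]
    have : ‖y t‖ ≤ M * (‖y a‖ + δ * H (t + δ)) :=
      hfin.trans (mul_le_mul_of_nonneg_left (by linarith) hM0)
    calc δ⁻¹ * ‖y t‖ ≤ δ⁻¹ * (M * (‖y a‖ + δ * H (t + δ))) :=
          mul_le_mul_of_nonneg_left this (inv_nonneg.2 hδ.le)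
      _ = M * (δ⁻¹ * ‖y a‖ + H (t + δ)) := by field_simp
  -- Since `C' = c`, the difference quotients at `t` and at `a` recover $c(t)$ and $c(a)=0$.
  have hlim : ∀ s, Tendsto (fun δ : ℝ => δ⁻¹ • (C (s + δ) - C s)) (𝓝[>] 0) (𝓝 (c s)) := fun s =>
    (hasDerivAt_iff_tendsto_slope_zero.1 (hCd s)).mono_left
      (nhdsWithin_mono _ fun x hx => ne_of_gt hx)
  have hH1 : Tendsto (fun δ : ℝ => H (t + δ)) (𝓝[>] 0) (𝓝 (H t)) := by
    have : Continuous fun δ : ℝ => H (t + δ) := hHc.comp (continuous_const.add continuous_id)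
    simpa using (this.tendsto 0).mono_left nhdsWithin_le_nhds
  have h5 := le_of_tendsto_of_tendsto (hlim t).norm
    (((hlim a).norm.add hH1).const_mul M) (by
      filter_upwards [self_mem_nhdsWithin] with δ hδ using key δ hδ)
  have hca : c a = 0 := intervalIntegral.integral_same
  rw [hca, norm_zero, zero_add] at h5
  rw [← hgeq t ht]
  refine h5.trans (le_of_eq ?_)
  congr 1
  refine intervalIntegral_congr_uIoc fun r hr => ?_
  rw [uIoc_of_le ht.le] at hr
  simp [hh', indicator_of_mem (show r ∈ Ioi a from hr.1)]

lemma ZeroSol.norm_le_bounded (hp : 1 ≤ p) (hι : Function.Injective ι)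
    (hH : ∀ a, HalfLineMR p ι A K a) (hS : IsSemigroupOf ι A T)
    (hM : ∀ t x, ‖T t x‖ ≤ M * ‖x‖) (hM0 : 0 ≤ M) (hab : a < b) {h : ℝ → X} {w : ℝ → D}
    (hw : ZeroSol p (Ioo a b) a ι A h w) :
    ∀ᵐ t ∂(volume.restrict (Ioo a b)), ‖ι (w t)‖ ≤ M * ∫ r in a..t, ‖h r‖ := by
  obtain ⟨v, hv, hvw⟩ := HalfLineMR.exists_extension hp hι hH hab hw
  filter_upwards [hvw, (hv.mono (J := Ioo a b) Ioo_subset_Ioi_self).eq,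
    ae_restrict_mem measurableSet_Ioo] with t h1 h2 ht
  rw [← h1, h2]
  refine (hv.norm_integral_le hp hS hM hM0 ht.1).trans (le_of_eq ?_)
  congr 1
  refine intervalIntegral_congr_uIoc fun r hr => ?_
  rw [uIoc_of_le ht.1.le] at hr
  rw [indicator_of_mem (show r ∈ Ioo a b from ⟨hr.1, hr.2.trans_lt ht.2⟩)]

end

/-! ### Young's inequality and exponential kernels -/

section

open ENNReal in
/-- Young's convolution inequality for a kernel of mass at most one. -/
lemma lintegral_convolution_rpow_le {p : ℝ} (hp : 1 < p) {k G : ℝ → ℝ≥0∞} (hk : Measurable k)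
    (hk1 : ∫⁻ s, k s ≤ 1) (hG : Measurable G) :
    ∫⁻ t, (∫⁻ r, k (t - r) * G r) ^ p ≤ ∫⁻ r, G r ^ p := by
  have hp0 : 0 < p := by linarith
  have hpq := Real.HolderConjugate.conjExponent hp
  set q := p.conjExponent
  have hq0 : 0 < q := hpq.symm.pos
  have hkt : ∀ t : ℝ, Measurable fun r => k (t - r) := fun t => hk.comp (measurable_const.sub
    measurable_id)
  have h1 : ∀ t, (∫⁻ r, k (t - r) * G r) ^ p ≤ ∫⁻ r, k (t - r) * G r ^ p := by
    intro t
    -- Splitting `k = k^{1/q} k^{1/p}` in Hölder's inequality uses the mass of `k` only in the first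
    -- factor; Tonelli's theorem then integrates the second one over `t`.
    have e : ∀ r, k (t - r) * G r = (k (t - r) ^ (1 / q)) * (k (t - r) ^ (1 / p) * G r) := by
      intro r
      rw [← mul_assoc, ← ENNReal.rpow_add_of_nonneg _ _ (by positivity) (by positivity)]
      have : 1 / q + 1 / p = 1 := by
        have := hpq.symm.inv_add_inv_eq_one
        rwa [one_div, one_div]
      rw [this, ENNReal.rpow_one]
    have h2 := ENNReal.lintegral_mul_le_Lp_mul_Lq volume hpq.symm
      (f := fun r => k (t - r) ^ (1 / q)) (g := fun r => k (t - r) ^ (1 / p) * G r)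
      ((hkt t).pow_const _).aemeasurable (((hkt t).pow_const _).mul hG).aemeasurable
    simp only [Pi.mul_apply, ← e] at h2
    have h3 : ∫⁻ r, (k (t - r) ^ (1 / q)) ^ q ≤ 1 := by
      simp only [← ENNReal.rpow_mul, one_div_mul_cancel hq0.ne', ENNReal.rpow_one]
      rwa [lintegral_sub_left_eq_self k t]
    have h4 : (∫⁻ r, (k (t - r) ^ (1 / q)) ^ q) ^ (1 / q) ≤ 1 :=
      ENNReal.rpow_le_one h3 (by positivity)
    have h5 : ∀ r, (k (t - r) ^ (1 / p) * G r) ^ p = k (t - r) * G r ^ p := by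
      intro r
      rw [ENNReal.mul_rpow_of_nonneg _ _ hp0.le, ← ENNReal.rpow_mul,
        one_div_mul_cancel hp0.ne', ENNReal.rpow_one]
    simp only [h5] at h2
    calc (∫⁻ r, k (t - r) * G r) ^ p
        ≤ (1 * (∫⁻ r, k (t - r) * G r ^ p) ^ (1 / p)) ^ p := by
          gcongr
          exact h2.trans (by gcongr)
      _ = _ := by
          rw [one_mul, ← ENNReal.rpow_mul, one_div_mul_cancel hp0.ne', ENNReal.rpow_one]
  calc ∫⁻ t, (∫⁻ r, k (t - r) * G r) ^ p ≤ ∫⁻ t, ∫⁻ r, k (t - r) * G r ^ p := lintegral_mono h1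
    _ = ∫⁻ r, ∫⁻ t, k (t - r) * G r ^ p := by
        refine lintegral_lintegral_swap (Measurable.aemeasurable ?_)
        exact (hk.comp (measurable_fst.sub measurable_snd)).mul
          ((hG.comp measurable_snd).pow_const p)
    _ = ∫⁻ r, (∫⁻ s, k s) * G r ^ p := by
        refine lintegral_congr fun r => ?_
        rw [lintegral_mul_const (f := fun t => k (t - r)) _
          (hk.comp (measurable_id.sub measurable_const)),
          lintegral_sub_right_eq_self k r]
    _ ≤ ∫⁻ r, G r ^ p := lintegral_mono fun r => by
        calc _ ≤ 1 * G r ^ p := by gcongr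
          _ = _ := one_mul _

lemma lintegral_exp_kernel {l : ℝ} (hl : 0 < l) :
    ∫⁻ s, (Ioi (0 : ℝ)).indicator (fun s => ENNReal.ofReal (l * Real.exp (-(l * s)))) s = 1 := by
  rw [lintegral_indicator measurableSet_Ioi, ← ofReal_integral_eq_lintegral_ofReal]
  · rw [integral_const_mul]
    have := integral_exp_mul_Ioi (a := -l) (by linarith) 0
    simp only [neg_mul, mul_zero, Real.exp_zero] at this
    rw [this, neg_div_neg_eq, mul_one_div_cancel hl.ne', ENNReal.ofReal_one]
  · have := (integrableOn_exp_mul_Ioi (a := -l) (by linarith) 0).const_mul l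
    simpa only [neg_mul] using this
  · exact ae_of_all _ fun s => by positivity

variable {p a b M : ℝ}

/-- The kernel $l e^{-ls}$ on $s>0$ has mass one, so multiplication by `l` turns the pointwise bound
into a convolution covered by Young's inequality. -/
lemma mul_lpNormOn_le_of_exp_convolution {Y Z : Type*} [NormedAddCommGroup Y] [NormedAddCommGroup Z]
    (hp : 1 < p) {l : ℝ} (hl : 0 < l) (hM : 0 ≤ M) {v : ℝ → Y} {g : ℝ → Z}
    (hg : MemLpOn p (Ioo a b) g)
    (h : ∀ᵐ t ∂(volume.restrict (Ioo a b)),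
      ‖v t‖ ≤ M * ∫ r in a..t, Real.exp (-(l * (t - r))) * ‖g r‖) :
    l * lpNormOn p (Ioo a b) v ≤ M * lpNormOn p (Ioo a b) g := by
  have hp0 : 0 < p := by linarith
  have hpe : (ENNReal.ofReal p).toReal = p := ENNReal.toReal_ofReal hp0.le
  set k := (Ioi (0 : ℝ)).indicator (fun s => ENNReal.ofReal (l * Real.exp (-(l * s)))) with hk
  have hkm : Measurable k := by
    refine Measurable.indicator ?_ measurableSet_Ioi
    fun_prop
  have hGm : AEMeasurable (fun r => ‖(Ioo a b).indicator g r‖ₑ) :=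
    ((aestronglyMeasurable_indicator_iff measurableSet_Ioo).2 hg.1).enorm
  set G := hGm.mk with hG
  have hGG : ∀ᵐ r, ‖(Ioo a b).indicator g r‖ₑ = G r := hGm.ae_eq_mk
  have hY := lintegral_convolution_rpow_le hp hkm (lintegral_exp_kernel hl).le hGm.measurable_mk
  have hGp : ∫⁻ r, G r ^ p = ∫⁻ r in Ioo a b, ‖g r‖ₑ ^ p := by
    rw [← lintegral_indicator measurableSet_Ioo]
    refine lintegral_congr_ae ?_
    filter_upwards [hGG] with r hr
    rw [← hr]
    by_cases hrI : r ∈ Ioo a b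
    · simp [hrI]
    · simp [hrI, hp0]
  have hv : ∀ᵐ t ∂(volume.restrict (Ioo a b)),
      ENNReal.ofReal l * ‖v t‖ₑ ≤ ENNReal.ofReal M * ∫⁻ r, k (t - r) * G r := by
    filter_upwards [h, ae_restrict_mem measurableSet_Ioo] with t ht htI
    have h1 : ‖∫ r in a..t, Real.exp (-(l * (t - r))) * ‖g r‖‖ₑ
        ≤ ∫⁻ r in Ioo a t, ‖Real.exp (-(l * (t - r))) * ‖g r‖‖ₑ := by
      rw [intervalIntegral.integral_of_le htI.1.le, integral_Ioc_eq_integral_Ioo]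
      exact enorm_integral_le_lintegral_enorm _
    have h2 : ENNReal.ofReal l * ∫⁻ r in Ioo a t, ‖Real.exp (-(l * (t - r))) * ‖g r‖‖ₑ
        ≤ ∫⁻ r, k (t - r) * G r := by
      rw [← lintegral_const_mul' _ _ ENNReal.ofReal_ne_top, ← lintegral_indicator measurableSet_Ioo]
      refine lintegral_mono_ae ?_
      filter_upwards [hGG] with r hr
      by_cases hrI : r ∈ Ioo a t
      · have h3 : r ∈ Ioo a b := ⟨hrI.1, hrI.2.trans htI.2⟩
        rw [indicator_of_mem hrI, ← hr, indicator_of_mem h3, hk,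
          indicator_of_mem (show t - r ∈ Ioi 0 from sub_pos.2 hrI.2), enorm_mul, enorm_norm,
          ENNReal.ofReal_mul hl.le, mul_assoc, Real.enorm_of_nonneg (Real.exp_pos _).le]
      · rw [indicator_of_notMem hrI]; exact zero_le
    have h4 : ‖v t‖ₑ ≤ ENNReal.ofReal M * ‖∫ r in a..t, Real.exp (-(l * (t - r))) * ‖g r‖‖ₑ := by
      rw [← ofReal_norm (v t)]
      refine (ENNReal.ofReal_le_ofReal ht).trans ?_
      rw [ENNReal.ofReal_mul hM]
      gcongr
      exact Real.ofReal_le_enorm _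
    calc ENNReal.ofReal l * ‖v t‖ₑ
        ≤ ENNReal.ofReal l * (ENNReal.ofReal M *
            ∫⁻ r in Ioo a t, ‖Real.exp (-(l * (t - r))) * ‖g r‖‖ₑ) := by
          gcongr; exact h4.trans (by gcongr)
      _ = ENNReal.ofReal M * (ENNReal.ofReal l *
            ∫⁻ r in Ioo a t, ‖Real.exp (-(l * (t - r))) * ‖g r‖‖ₑ) := by ring
      _ ≤ _ := by gcongr
  have hmain : ENNReal.ofReal l ^ p * ∫⁻ t in Ioo a b, ‖v t‖ₑ ^ p
      ≤ ENNReal.ofReal M ^ p * ∫⁻ r in Ioo a b, ‖g r‖ₑ ^ p := by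
    rw [← lintegral_const_mul' _ _ (ENNReal.rpow_ne_top_of_nonneg hp0.le ENNReal.ofReal_ne_top)]
    calc ∫⁻ t in Ioo a b, ENNReal.ofReal l ^ p * ‖v t‖ₑ ^ p
        ≤ ∫⁻ t in Ioo a b, ENNReal.ofReal M ^ p * (∫⁻ r, k (t - r) * G r) ^ p := by
          refine lintegral_mono_ae (hv.mono fun t ht => ?_)
          rw [← ENNReal.mul_rpow_of_nonneg _ _ hp0.le, ← ENNReal.mul_rpow_of_nonneg _ _ hp0.le]
          gcongr
      _ = ENNReal.ofReal M ^ p * ∫⁻ t in Ioo a b, (∫⁻ r, k (t - r) * G r) ^ p :=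
          lintegral_const_mul' _ _ (ENNReal.rpow_ne_top_of_nonneg hp0.le ENNReal.ofReal_ne_top)
      _ ≤ ENNReal.ofReal M ^ p * ∫⁻ t, (∫⁻ r, k (t - r) * G r) ^ p := by
          gcongr; exact Measure.restrict_le_self
      _ ≤ _ := by rw [← hGp]; gcongr
  have hfin : ENNReal.ofReal l * eLpNorm v (ENNReal.ofReal p) (volume.restrict (Ioo a b))
      ≤ ENNReal.ofReal M * eLpNorm g (ENNReal.ofReal p) (volume.restrict (Ioo a b)) := by
    rw [eLpNorm_eq_lintegral_rpow_enorm_toReal (by simpa using hp0) (by simp),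
      eLpNorm_eq_lintegral_rpow_enorm_toReal (by simpa using hp0) (by simp), hpe]
    have h6 := ENNReal.rpow_le_rpow hmain (show 0 ≤ 1 / p by positivity)
    rwa [ENNReal.mul_rpow_of_nonneg _ _ (by positivity), ENNReal.mul_rpow_of_nonneg _ _
      (by positivity), one_div, ENNReal.rpow_rpow_inv hp0.ne', ENNReal.rpow_rpow_inv hp0.ne',
      ← one_div] at h6
  have h7 := ENNReal.toReal_mono (ENNReal.mul_ne_top ENNReal.ofReal_ne_top hg.2.ne) hfin
  rwa [ENNReal.toReal_mul, ENNReal.toReal_mul, ENNReal.toReal_ofReal hl.le,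
    ENNReal.toReal_ofReal hM] at h7
end

/-! ### Tools for the perturbation: measurability, fixed points, damping -/

section

variable {X D : Type*} [NormedAddCommGroup X] [NormedSpace ℝ X]
  [NormedAddCommGroup D] [NormedSpace ℝ D]
variable {p a b K M l : ℝ} {I J : Set ℝ} {ι A : D →L[ℝ] X} {T : ℝ≥0 → X →L[ℝ] X}

lemma MemLpOn.continuous_smul {Y : Type*} [NormedAddCommGroup Y] [NormedSpace ℝ Y] {u : ℝ → Y}
    (hu : MemLpOn p (Ioo a b) u) {φ : ℝ → ℝ} (hφ : Continuous φ) :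
    MemLpOn p (Ioo a b) (fun t => φ t • u t) := by
  obtain ⟨C, hC⟩ := isCompact_Icc.exists_bound_of_continuousOn (hφ.continuousOn (s := Icc a b))
  refine MemLp.of_le_mul (c := C) hu (hφ.aestronglyMeasurable.smul hu.1) ?_
  filter_upwards [ae_restrict_mem measurableSet_Ioo] with t ht
  rw [norm_smul]
  exact mul_le_mul_of_nonneg_right (hC t (Ioo_subset_Icc_self ht)) (norm_nonneg _)

/-- Measurability of `B(·)x` for fixed `x` passes to simple functions by finite sums, and to limits
because each `B t` is continuous. -/
lemma StronglyMeasurableOp.aestronglyMeasurable_apply {B : ℝ → D →L[ℝ] X}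
    (hB : StronglyMeasurableOp I B) {u : ℝ → D} (hu : AEStronglyMeasurable u (volume.restrict I)) :
    AEStronglyMeasurable (fun t => B t (u t)) (volume.restrict I) := by
  obtain ⟨w, hw, huw⟩ := hu
  refine AEStronglyMeasurable.congr (f := fun t => B t (w t)) ?_
    (huw.mono fun t ht => by simp only [ht])
  refine aestronglyMeasurable_of_tendsto_ae atTop (f := fun n t => B t (hw.approx n t))
    (fun n => ?_) (ae_of_all _ fun t => ((B t).continuous.tendsto _).comp (hw.tendsto_approx t))
  have e : (fun t => B t (hw.approx n t)) = fun t => ∑ y ∈ (hw.approx n).range,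
      ((hw.approx n) ⁻¹' {y}).indicator (fun t => B t y) t := by
    ext t
    rw [Finset.sum_eq_single (hw.approx n t)]
    · simp
    · intro y _ hy
      exact indicator_of_notMem (fun h => hy h.symm) _
    · intro h
      exact absurd (SimpleFunc.mem_range_self _ t) h
  rw [e]
  exact Finset.aestronglyMeasurable_fun_sum _ fun y _ =>
    (hB y).indicator ((hw.approx n).measurableSet_preimage {y})

lemma memLpOn_op_apply {B : ℝ → D →L[ℝ] X} {ε η : ℝ} (hη : 0 ≤ η)
    (hI : MeasurableSet I) (hB : StronglyMeasurableOp I B)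
    (hBb : ∀ t ∈ I, ∀ x, ‖B t x‖ ≤ ε * ‖x‖ + η * ‖ι x‖) {u : ℝ → D} (hu : MemLpOn p I u) :
    MemLpOn p I (fun t => B t (u t)) := by
  refine MemLp.of_le_mul (c := ε + η * ‖ι‖) hu (hB.aestronglyMeasurable_apply hu.1) ?_
  filter_upwards [ae_restrict_mem hI] with t ht
  have := ι.le_opNorm (u t)
  calc ‖B t (u t)‖ ≤ ε * ‖u t‖ + η * ‖ι (u t)‖ := hBb t ht _
    _ ≤ ε * ‖u t‖ + η * (‖ι‖ * ‖u t‖) := by gcongr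
    _ = _ := by ring

lemma lpNormOn_op_apply_le (hp : 1 ≤ p) {B : ℝ → D →L[ℝ] X} {ε η : ℝ} (hε : 0 ≤ ε) (hη : 0 ≤ η)
    (hI : MeasurableSet I) (hBb : ∀ t ∈ I, ∀ x, ‖B t x‖ ≤ ε * ‖x‖ + η * ‖ι x‖) {u : ℝ → D}
    (hu : MemLpOn p I u) : lpNormOn p I (fun t => B t (u t)) ≤
      ε * lpNormOn p I u + η * lpNormOn p I (fun t => ι (u t)) := by
  have h1 : MemLpOn p I (fun t => ε * ‖u t‖) := (MemLp.norm hu).const_mul ε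
  have h2 : MemLpOn p I (fun t => η * ‖ι (u t)‖) := (MemLp.norm (hu.clm_comp ι)).const_mul η
  calc lpNormOn p I (fun t => B t (u t))
      ≤ 1 * lpNormOn p I (fun t => ε * ‖u t‖ + η * ‖ι (u t)‖) := by
        refine lpNormOn_le_mul zero_le_one (MemLp.add h1 h2) ?_
        filter_upwards [ae_restrict_mem hI] with t ht
        rw [one_mul, Real.norm_of_nonneg (by positivity)]
        exact hBb t ht _
    _ ≤ lpNormOn p I (fun t => ε * ‖u t‖) + lpNormOn p I (fun t => η * ‖ι (u t)‖) := by
        rw [one_mul]; exact lpNormOn_add_le hp h1 h2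
    _ ≤ _ := by
        refine add_le_add (lpNormOn_le_mul hε hu (ae_of_all _ fun t => ?_))
          (lpNormOn_le_mul hη (hu.clm_comp ι) (ae_of_all _ fun t => ?_))
        · rw [Real.norm_of_nonneg (by positivity)]
        · rw [Real.norm_of_nonneg (by positivity)]

omit [NormedSpace ℝ X] in
-- Banach's theorem in $L^p$, phrased for functions. The contraction estimate is required for all
-- representatives, so it also makes the values of `S` independent of the representative up to null
-- sets.
lemma exists_fixed_of_contraction [CompleteSpace X] (hp : 1 ≤ p) (S : (ℝ → X) → ℝ → X)
    {c : ℝ≥0} (hc : c < 1) (hS : ∀ g, MemLpOn p I g → MemLpOn p I (S g))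
    (hSc : ∀ g g', MemLpOn p I g → MemLpOn p I g' →
      lpNormOn p I (fun t => S g t - S g' t) ≤ c * lpNormOn p I (fun t => g t - g' t)) :
    ∃ g, MemLpOn p I g ∧ ∀ᵐ t ∂(volume.restrict I), S g t = g t := by
  have : Fact (1 ≤ ENNReal.ofReal p) := ⟨by simpa using hp⟩
  let Φ : Lp X (ENNReal.ofReal p) (volume.restrict I) → Lp X (ENNReal.ofReal p) (volume.restrict I) :=
    fun G => MemLp.toLp (S G) (hS G (Lp.memLp G))
  have hdist : ∀ (g g' : ℝ → X) (hg : MemLp g (ENNReal.ofReal p) (volume.restrict I))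
      (hg' : MemLp g' (ENNReal.ofReal p) (volume.restrict I)),
      dist (hg.toLp g) (hg'.toLp g') = lpNormOn p I (fun t => g t - g' t) := by
    intro g g' hg hg'
    rw [dist_eq_norm, ← MemLp.toLp_sub, Lp.norm_toLp]
    rfl
  have hΦ : ContractingWith c Φ := by
    refine ⟨hc, LipschitzWith.of_dist_le_mul fun G G' => ?_⟩
    have h1 := hSc G G' (Lp.memLp G) (Lp.memLp G')
    rw [← hdist _ _ (hS G (Lp.memLp G)) (hS G' (Lp.memLp G')), ← hdist _ _ (Lp.memLp G) (Lp.memLp G'),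
      Lp.toLp_coeFn, Lp.toLp_coeFn] at h1
    exact h1
  have h1 : Φ hΦ.fixedPoint = hΦ.fixedPoint := hΦ.fixedPoint_isFixedPt
  refine ⟨hΦ.fixedPoint, Lp.memLp _, ?_⟩
  have h2 := MemLp.coeFn_toLp (hS hΦ.fixedPoint (Lp.memLp _))
  change (Φ hΦ.fixedPoint : ℝ → X) =ᵐ[_] _ at h2
  rw [h1] at h2
  exact h2.symm

/-- The interpolation inequality defining `α_p`. -/
lemma rpow_sum_le_alphaP (hp : 1 < p) {x y z ν : ℝ} (hx : 0 ≤ x) (hy : 0 ≤ y) (hz : 0 ≤ z)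
    (hν : 0 ≤ ν) : (x ^ p + y ^ p + (z + ν * x) ^ p) ^ (1 / p) ≤
      alphaP p ν * (x ^ p + y ^ p + z ^ p) ^ (1 / p) := by
  have hxp := Real.rpow_nonneg hx p
  have hyp := Real.rpow_nonneg hy p
  have hzp := Real.rpow_nonneg hz p
  rw [alphaP, Real.iInf_mul_of_nonneg (by positivity)]
  refine le_ciInf fun μ => ?_
  obtain ⟨μ, h0, h1⟩ := μ
  simp only
  have h1' : 0 < 1 - μ := by linarith
  rw [abs_of_nonneg hν]
  set m := max (1 + μ ^ (1 - p) * ν ^ p) ((1 - μ) ^ (1 - p))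
  have hm1 : 1 + μ ^ (1 - p) * ν ^ p ≤ m := le_max_left _ _
  have hm2 : (1 - μ) ^ (1 - p) ≤ m := le_max_right _ _
  have hm0 : 1 ≤ m := le_trans (by have : 0 ≤ μ ^ (1 - p) * ν ^ p := by positivity
                                   linarith) hm1
  -- Convexity of the `p`-th power at $z+\nu x=(1-\mu)\frac{z}{1-\mu}+\mu\frac{\nu x}{\mu}$.
  have hconv : (z + ν * x) ^ p ≤ (1 - μ) ^ (1 - p) * z ^ p + μ ^ (1 - p) * (ν ^ p * x ^ p) := by
    have hc := (convexOn_rpow hp.le).2 (mem_Ici.2 (show 0 ≤ z / (1 - μ) by positivity))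
      (mem_Ici.2 (show 0 ≤ ν * x / μ by positivity)) h1'.le h0.le (by ring)
    simp only [smul_eq_mul] at hc
    rw [mul_div_cancel₀ _ h1'.ne', mul_div_cancel₀ _ h0.ne', Real.div_rpow hz h1'.le,
      Real.div_rpow (by positivity) h0.le, Real.mul_rpow hν hx] at hc
    refine hc.trans (le_of_eq ?_)
    rw [Real.rpow_sub h1', Real.rpow_sub h0, Real.rpow_one, Real.rpow_one]
    ring
  rw [← Real.mul_rpow (by positivity) (by linarith)]
  refine Real.rpow_le_rpow (by positivity) ?_ (by positivity)
  nlinarith [mul_le_mul_of_nonneg_right hm1 hxp, mul_le_mul_of_nonneg_right hm2 hzp,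
    mul_le_mul_of_nonneg_right hm0 hyp]

/-- For a nonpositive argument the positive part vanishes and the second factor collapses to
$(e^{p\nu})^{1/p}$. -/
lemma cP_neg {p ν : ℝ} (hp : 1 < p) (hν : 0 ≤ ν) : cP p (-ν) = alphaP p ν * Real.exp ν := by
  have e : alphaP p (-ν) = alphaP p ν := by simp [alphaP]
  rw [cP, kappaP, e, add_sub_cancel, neg_neg, max_eq_left hν, max_eq_right (by linarith), mul_zero,
    neg_zero, Real.exp_zero, add_sub_cancel_left, mul_comm p, Real.exp_mul, one_div,
    Real.rpow_rpow_inv (Real.exp_pos _).le (by linarith)]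

lemma alphaP_nonneg (p ν : ℝ) : 0 ≤ alphaP p ν :=
  Real.iInf_nonneg fun μ => alphaP_term_nonneg p ν μ

variable [CompleteSpace X]

/-- Multiplying a solution by an exponential. -/
lemma ZeroSol.exp_smul (hp : 1 ≤ p) (hab : a < b) {F : ℝ → X} {u : ℝ → D} (l : ℝ)
    (hu : ZeroSol p (Ioo a b) a ι A F u) : ZeroSol p (Ioo a b) a ι A
      (fun t => Real.exp (-(l * (t - a))) • F t - l • ι (Real.exp (-(l * (t - a))) • u t))
      (fun t => Real.exp (-(l * (t - a))) • u t) := by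
  have hI := isLeftInterval_Ioo hab
  have hφ : ContDiff ℝ 1 (fun t => Real.exp (-(l * (t - a)))) := by fun_prop
  have hd : ∀ t, deriv (fun t => Real.exp (-(l * (t - a)))) t
      = -(l * Real.exp (-(l * (t - a)))) := by
    intro t
    have h1 : HasDerivAt (fun t => Real.exp (-(l * (t - a))))
        (Real.exp (-(l * (t - a))) * (-(l * 1))) t :=
      ((((hasDerivAt_id t).sub_const a).const_mul l).neg).exp
    rw [h1.deriv]; ring
  have hv : MemLpOn p (Ioo a b) (fun t => Real.exp (-(l * (t - a))) • u t) :=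
    hu.sol.continuous_smul hφ.continuous
  refine ⟨hv, MemLp.sub (hu.data.continuous_smul hφ.continuous)
    (MemLp.const_smul (hv.clm_comp ι) l), ?_⟩
  filter_upwards [hu.eq, ae_restrict_mem measurableSet_Ioo] with t ht htI
  have h1 := smul_primitive_sub hφ (0 : X) (hu.deriv_mem.intervalIntegrable hp hI htI)
  rw [smul_zero, sub_zero, zero_add] at h1
  rw [map_smul, ht, ← h1]
  refine intervalIntegral.integral_congr_ae ?_
  filter_upwards [(ae_restrict_iff' measurableSet_Ioo).1 hu.eq] with r hr hrt
  rw [uIoc_of_le htI.1.le] at hrt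
  rw [zero_add, ← hr (hI.Ioc_subset t htI hrt), hd, map_smul, map_smul, smul_sub, neg_smul,
    mul_smul]
  abel

end

/-! ### The perturbation argument on a bounded interval -/

section

variable {X D : Type*} [NormedAddCommGroup X] [NormedSpace ℝ X] [CompleteSpace X]
  [NormedAddCommGroup D] [NormedSpace ℝ D] [CompleteSpace D]
variable {p a b K M l : ℝ} {I J : Set ℝ} {ι A : D →L[ℝ] X} {T : ℝ≥0 → X →L[ℝ] X}

lemma derivWeight_Ioo (hab : a < b) : derivWeight (Ioo a b) = b - a := by
  rw [derivWeight, if_pos bddAbove_Ioo, measureReal_def, Real.volume_Ioo,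
    ENNReal.toReal_ofReal (by linarith)]

/-- The constant adds the bounds of the three terms of the norm, using that an $\ell^p$ sum is at
most the $\ell^1$ sum. -/
lemma HalfLineMR.autMaxReg_Ioo (hp : 1 ≤ p) (hι : Function.Injective ι) (hA : GraphNormEquiv ι A)
    (h : ∀ a, HalfLineMR p ι A K a) (hab : a < b) : AutMaxReg p (Ioo a b) ι A := by
  have hI := isLeftInterval_Ioo hab
  have hK := (h a).nonneg
  refine ⟨hA, fun f hf => ?_, (‖ι‖ * K) + K + (b - a) * K, ?_, fun f u hf hu => ?_⟩
  · obtain ⟨u, hu⟩ := (h a).exists_sol_bounded b hf hab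
    refine ⟨u, (isSolution_const_iff hp hI hf).2 hu, fun v hv => ?_⟩
    exact HalfLineMR.unique_bounded hp hι h hab ((isSolution_const_iff hp hI hf).1 hv) hu
  · have : 0 ≤ b - a := by linarith
    positivity
  · have hu' := (isSolution_const_iff hp hI hf).1 hu
    obtain ⟨b1, b2⟩ := HalfLineMR.bound_bounded hp hι h hab hu'
    have hba : 0 ≤ b - a := by linarith
    have b3 : lpNormOn p (Ioo a b) (fun t => ι (u t)) ≤ ‖ι‖ * lpNormOn p (Ioo a b) u :=
      lpNormOn_le_mul (norm_nonneg _) hu'.sol (ae_of_all _ fun t => ι.le_opNorm _)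
    have n0 := lpNormOn_nonneg (p := p) (I := Ioo a b) f
    have n1 := lpNormOn_nonneg (p := p) (I := Ioo a b) u
    have n2 := lpNormOn_nonneg (p := p) (I := Ioo a b) (fun t => ι (u t))
    have n3 := lpNormOn_nonneg (p := p) (I := Ioo a b) (fun t => f t - A (u t))
    rw [hu'.mrNorm_eq hp hI, derivWeight_Ioo hab, ← Real.mul_rpow hba n3]
    have hsum : ∀ x y z : ℝ, 0 ≤ x → 0 ≤ y → 0 ≤ z →
        (x ^ p + y ^ p + z ^ p) ^ (1 / p) ≤ x + y + z := by
      intro x y z hx hy hz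
      have h1 : x ^ p + y ^ p + z ^ p ≤ (x + y + z) ^ p :=
        (add_le_add_left (Real.add_rpow_le_rpow_add hx hy hp) _).trans
          (Real.add_rpow_le_rpow_add (by positivity) hz hp)
      calc _ ≤ ((x + y + z) ^ p) ^ (1 / p) :=
            Real.rpow_le_rpow (by positivity) h1 (by positivity)
        _ = _ := by rw [one_div, Real.rpow_rpow_inv (by positivity) (by linarith)]
    refine (hsum _ _ _ n2 n1 (by positivity)).trans ?_
    calc _ ≤ ‖ι‖ * (K * lpNormOn p (Ioo a b) f) + K * lpNormOn p (Ioo a b) f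
          + (b - a) * (K * lpNormOn p (Ioo a b) f) := by
          gcongr
          exact b3.trans (by gcongr)
      _ = _ := by ring

omit [CompleteSpace X] [CompleteSpace D] in
-- The infimum is attained: for data of positive norm divide by it, while for data of zero norm
-- every admissible constant gives the same bound.
lemma isMRBound_mrConst {B : ℝ → D →L[ℝ] X} (h : ∃ K, IsMRBound p I ι B K) :
    IsMRBound p I ι B (mrConst p I ι B) := by
  obtain ⟨K, hK⟩ := h
  refine ⟨le_csInf ⟨K, hK⟩ fun K hK => hK.1, fun f u hf hu => ?_⟩
  rcases eq_or_lt_of_le (lpNormOn_nonneg (p := p) (I := I) f) with h0 | h0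
  · have := hK.2 f u hf hu
    rwa [← h0, mul_zero] at this ⊢
  · rw [← div_le_iff₀ h0]
    refine le_csInf ⟨K, hK⟩ fun K' hK' => ?_
    rw [div_le_iff₀ h0]
    exact hK'.2 f u hf hu

/-- The data of the perturbation theorem on a bounded interval. -/
structure PerturbSetting (p a b K K₀ M : ℝ) (ι A : D →L[ℝ] X) (T : ℝ≥0 → X →L[ℝ] X) : Prop where
  hp : 1 < p
  hab : a < b
  inj : Function.Injective ι
  halfLine : ∀ a, HalfLineMR p ι A K a
  semigroup : IsSemigroupOf ι A T
  bound : ∀ t x, ‖T t x‖ ≤ M * ‖x‖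
  nonneg : 0 ≤ M
  mrBound : IsMRBound p (Ioo a b) ι (fun _ => A) K₀

namespace PerturbSetting
variable {K₀ : ℝ} (S : PerturbSetting p a b K K₀ M ι A T)
include S

/-- Damped solutions are small in `L^p(I; X)`. -/
lemma mul_lpNormOn_le (hl : 0 ≤ l) {F : ℝ → X} {u : ℝ → D}
    (hu : ZeroSol p (Ioo a b) a ι A F u) :
    l * lpNormOn p (Ioo a b) (fun t => ι (Real.exp (-(l * (t - a))) • u t))
      ≤ M * lpNormOn p (Ioo a b) (fun t => Real.exp (-(l * (t - a))) • F t) := by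
  rcases eq_or_lt_of_le hl with rfl | hl
  · rw [zero_mul]; exact mul_nonneg S.nonneg (lpNormOn_nonneg _)
  refine mul_lpNormOn_le_of_exp_convolution S.hp hl S.nonneg
    (hu.data.continuous_smul (by fun_prop)) ?_
  filter_upwards [hu.norm_le_bounded S.hp.le S.inj S.halfLine S.semigroup S.bound S.nonneg S.hab]
    with t ht
  rw [map_smul, norm_smul, Real.norm_of_nonneg (Real.exp_pos _).le]
  have e : ∫ r in a..t, Real.exp (-(l * (t - r))) * ‖Real.exp (-(l * (r - a))) • F r‖
      = Real.exp (-(l * (t - a))) * ∫ r in a..t, ‖F r‖ := by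
    rw [← intervalIntegral.integral_const_mul]
    congr 1 with r
    rw [norm_smul, Real.norm_of_nonneg (Real.exp_pos _).le, ← mul_assoc, ← Real.exp_add]
    ring_nf
  rw [e]
  calc _ ≤ Real.exp (-(l * (t - a))) * (M * ∫ r in a..t, ‖F r‖) := by gcongr
    _ = _ := by ring

/-- The damped function solves the equation with data $\varphi F-lv$. Its norm is at most
$(1+M)\|\varphi F\|$ whatever `l`, because $l\|v\|_{L^p(X)}\le M\|\varphi F\|$. -/
lemma mrNorm_le (hl : 0 ≤ l) {F : ℝ → X} {u : ℝ → D}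
    (hu : ZeroSol p (Ioo a b) a ι A F u) :
    mrNorm p (Ioo a b) ι (fun t => Real.exp (-(l * (t - a))) • u t)
      ≤ K₀ * ((1 + M) * lpNormOn p (Ioo a b) (fun t => Real.exp (-(l * (t - a))) • F t)) := by
  have hI := isLeftInterval_Ioo S.hab
  have hv := hu.exp_smul S.hp.le S.hab l
  have h1 := S.mrBound.2 _ _ hv.data ((isSolution_const_iff S.hp.le hI hv.data).2 hv)
  have hg : MemLpOn p (Ioo a b) (fun t => Real.exp (-(l * (t - a))) • F t) :=
    hu.data.continuous_smul (by fun_prop)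
  have hιv : MemLpOn p (Ioo a b) (fun t => ι (Real.exp (-(l * (t - a))) • u t)) :=
    hv.sol.clm_comp ι
  have h2 : lpNormOn p (Ioo a b) (fun t => l • ι (Real.exp (-(l * (t - a))) • u t))
      ≤ l * lpNormOn p (Ioo a b) (fun t => ι (Real.exp (-(l * (t - a))) • u t)) :=
    lpNormOn_le_mul hl hιv (ae_of_all _ fun t => by
      rw [norm_smul, Real.norm_of_nonneg hl])
  have hlιv : MemLpOn p (Ioo a b) (fun t => l • ι (Real.exp (-(l * (t - a))) • u t)) :=
    MemLp.const_smul hιv l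
  have h3 := lpNormOn_sub_le S.hp.le hg hlιv
  have h4 := S.mul_lpNormOn_le hl hu
  refine h1.trans (mul_le_mul_of_nonneg_left ?_ S.mrBound.1)
  linarith

omit [CompleteSpace D] in
lemma lpNormOn_le_mrNorm {F : ℝ → X} {u : ℝ → D} (hu : ZeroSol p (Ioo a b) a ι A F u) :
    lpNormOn p (Ioo a b) u ≤ mrNorm p (Ioo a b) ι u := by
  have hI := isLeftInterval_Ioo S.hab
  have hba : 0 ≤ b - a := by linarith [S.hab]
  rw [hu.mrNorm_eq S.hp.le hI, derivWeight_Ioo S.hab, ← Real.mul_rpow hba (lpNormOn_nonneg _)]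
  exact (le_rpow_sum S.hp.le (lpNormOn_nonneg _) (lpNormOn_nonneg _)
    (mul_nonneg hba (lpNormOn_nonneg _))).2.1

omit [CompleteSpace D] in
/-- Removing the exponential damping. -/
lemma mrNorm_le_undamped (hl : 0 ≤ l) {F : ℝ → X} {u : ℝ → D}
    (hu : ZeroSol p (Ioo a b) a ι A F u) : mrNorm p (Ioo a b) ι u ≤
      cP p (-(l * (b - a))) * mrNorm p (Ioo a b) ι (fun t => Real.exp (-(l * (t - a))) • u t) := by
  have hI := isLeftInterval_Ioo S.hab
  have hp := S.hp
  have hba : 0 ≤ b - a := by linarith [S.hab]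
  have hv := hu.exp_smul S.hp.le S.hab l
  rw [hu.mrNorm_eq S.hp.le hI, hv.mrNorm_eq S.hp.le hI, cP_neg hp (by positivity),
    derivWeight_Ioo S.hab, ← Real.mul_rpow hba (lpNormOn_nonneg _),
    ← Real.mul_rpow hba (lpNormOn_nonneg _)]
  set v := fun t => Real.exp (-(l * (t - a))) • u t with hvdef
  set E := Real.exp (l * (b - a)) with hE
  set x := lpNormOn p (Ioo a b) (fun t => ι (v t)) with hx
  set y := lpNormOn p (Ioo a b) v with hy
  set z := lpNormOn p (Ioo a b)
    (fun t => Real.exp (-(l * (t - a))) • F t - l • ι (v t) - A (v t)) with hz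
  have hE0 : 0 ≤ E := (Real.exp_pos _).le
  have hx0 : 0 ≤ x := lpNormOn_nonneg _
  have hy0 : 0 ≤ y := lpNormOn_nonneg _
  have hz0 : 0 ≤ z := lpNormOn_nonneg _
  have hdampX : ∀ (w : X), ∀ t ∈ Ioo a b, ‖w‖ ≤ E * ‖Real.exp (-(l * (t - a))) • w‖ := by
    intro w t ht
    rw [norm_smul, Real.norm_of_nonneg (Real.exp_pos _).le, ← mul_assoc, hE, ← Real.exp_add]
    refine le_mul_of_one_le_left (norm_nonneg _) (Real.one_le_exp ?_)
    nlinarith [ht.2]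
  have hdampD : ∀ (w : D), ∀ t ∈ Ioo a b, ‖w‖ ≤ E * ‖Real.exp (-(l * (t - a))) • w‖ := by
    intro w t ht
    rw [norm_smul, Real.norm_of_nonneg (Real.exp_pos _).le, ← mul_assoc, hE, ← Real.exp_add]
    refine le_mul_of_one_le_left (norm_nonneg _) (Real.one_le_exp ?_)
    nlinarith [ht.2]
  have b1 : lpNormOn p (Ioo a b) (fun t => ι (u t)) ≤ E * x := by
    refine lpNormOn_le_mul hE0 (hv.sol.clm_comp ι) ?_
    filter_upwards [ae_restrict_mem measurableSet_Ioo] with t ht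
    rw [hvdef, map_smul]
    exact hdampX _ t ht
  have b2 : lpNormOn p (Ioo a b) u ≤ E * y := by
    refine lpNormOn_le_mul hE0 hv.sol ?_
    filter_upwards [ae_restrict_mem measurableSet_Ioo] with t ht
    exact hdampD _ t ht
  have hιv : MemLpOn p (Ioo a b) (fun t => ι (v t)) := hv.sol.clm_comp ι
  -- Undamping the derivative: $e^{-l(t-a)}u'=v'+lv$.
  have b3 : lpNormOn p (Ioo a b) (fun t => F t - A (u t)) ≤ E * (z + l * x) := by
    have hm : MemLpOn p (Ioo a b) (fun t => l • ι (v t)) := MemLp.const_smul hιv l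
    have h1 := lpNormOn_add_le hp.le hv.deriv_mem hm
    have h2 : lpNormOn p (Ioo a b) (fun t => l • ι (v t)) ≤ l * x :=
      lpNormOn_le_mul hl hιv (ae_of_all _ fun t => by
        rw [norm_smul, Real.norm_of_nonneg hl])
    have hsum : MemLpOn p (Ioo a b) (fun t =>
        Real.exp (-(l * (t - a))) • F t - l • ι (v t) - A (v t) + l • ι (v t)) :=
      MemLp.add hv.deriv_mem hm
    refine le_trans (lpNormOn_le_mul hE0 hsum ?_)
      (mul_le_mul_of_nonneg_left (h1.trans (by linarith)) hE0)
    filter_upwards [ae_restrict_mem measurableSet_Ioo] with t ht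
    have e : Real.exp (-(l * (t - a))) • F t - l • ι (v t) - A (v t) + l • ι (v t)
        = Real.exp (-(l * (t - a))) • (F t - A (u t)) := by
      have hAv : A (v t) = Real.exp (-(l * (t - a))) • A (u t) := map_smul A _ _
      rw [hAv, smul_sub]
      abel
    rw [e]
    exact hdampX _ t ht
  calc (lpNormOn p (Ioo a b) (fun t => ι (u t)) ^ p + lpNormOn p (Ioo a b) u ^ p
        + ((b - a) * lpNormOn p (Ioo a b) (fun t => F t - A (u t))) ^ p) ^ (1 / p)
      ≤ ((E * x) ^ p + (E * y) ^ p + (E * ((b - a) * z + l * (b - a) * x)) ^ p) ^ (1 / p) := by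
        have n1 := lpNormOn_nonneg (p := p) (I := Ioo a b) u
        have n2 := lpNormOn_nonneg (p := p) (I := Ioo a b) (fun t => ι (u t))
        have n3 := lpNormOn_nonneg (p := p) (I := Ioo a b) (fun t => F t - A (u t))
        have hp0 : 0 ≤ p := by linarith
        have b4 : (b - a) * lpNormOn p (Ioo a b) (fun t => F t - A (u t))
            ≤ E * ((b - a) * z + l * (b - a) * x) :=
          (mul_le_mul_of_nonneg_left b3 hba).trans (le_of_eq (by ring))
        exact Real.rpow_le_rpow (by positivity) (add_le_add (add_le_add
          (Real.rpow_le_rpow n2 b1 hp0) (Real.rpow_le_rpow n1 b2 hp0))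
          (Real.rpow_le_rpow (mul_nonneg hba n3) b4 hp0)) (by positivity)
    _ = E * (x ^ p + y ^ p + ((b - a) * z + l * (b - a) * x) ^ p) ^ (1 / p) := by
        rw [Real.mul_rpow hE0 hx0, Real.mul_rpow hE0 hy0, Real.mul_rpow hE0 (by positivity),
          ← mul_add, ← mul_add, Real.mul_rpow (by positivity) (by positivity), one_div,
          Real.rpow_rpow_inv hE0 (by linarith)]
    _ ≤ E * (alphaP p (l * (b - a)) * (x ^ p + y ^ p + ((b - a) * z) ^ p) ^ (1 / p)) := by
        gcongr
        exact rpow_sum_le_alphaP hp hx0 hy0 (by positivity) (by positivity)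
    _ = _ := by ring

variable {B : ℝ → D →L[ℝ] X} {η : ℝ}

/-- The perturbation is a contraction with respect to the damped norm. -/
lemma lpNormOn_perturbation_le (hM1 : Nontrivial X → 0 < M) (hη : 0 ≤ η)
    (hBb : ∀ t ∈ Ioo a b, ∀ x : D,
      ‖B t x‖ ≤ 1 / (2 * (K₀ + 1) * (M + 1)) * ‖x‖ + η * ‖ι x‖)
    {F : ℝ → X} {u : ℝ → D} (hu : ZeroSol p (Ioo a b) a ι A F u) :
    lpNormOn p (Ioo a b) (fun t => Real.exp (-(4 * M * η * (t - a))) • B t (u t)) ≤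
      3 / 4 * lpNormOn p (Ioo a b) (fun t => Real.exp (-(4 * M * η * (t - a))) • F t) := by
  have hM := S.nonneg
  have hK := S.mrBound.1
  have hl : 0 ≤ 4 * M * η := by positivity
  have hv := hu.exp_smul S.hp.le S.hab (4 * M * η)
  have h1 := lpNormOn_op_apply_le S.hp.le (by positivity) hη measurableSet_Ioo hBb hv.sol
  have h2 := (S.lpNormOn_le_mrNorm hv).trans (S.mrNorm_le hl hu)
  have h3 := S.mul_lpNormOn_le hl hu
  simp only [map_smul] at h1 h3
  set g := lpNormOn p (Ioo a b) (fun t => Real.exp (-(4 * M * η * (t - a))) • F t)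
  have hg : 0 ≤ g := lpNormOn_nonneg _
  -- With $l=4M\eta$ the smallness estimate reads $4M\eta\|v\|\le M\|\varphi F\|$, and `M` cancels.
  -- When `X` is trivial `M` may be zero, but then the left side vanishes.
  have h4 : η * lpNormOn p (Ioo a b) (fun t => Real.exp (-(4 * M * η * (t - a))) • ι (u t))
      ≤ 1 / 4 * g := by
    rcases subsingleton_or_nontrivial X with hX | hX
    · have : lpNormOn p (Ioo a b) (fun t => Real.exp (-(4 * M * η * (t - a))) • ι (u t)) = 0 := by
        have e : (fun t => Real.exp (-(4 * M * η * (t - a))) • ι (u t)) = fun _ => 0 := by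
          ext t; exact Subsingleton.elim _ _
        rw [e]; simp [lpNormOn]
      rw [this, mul_zero]; positivity
    · refine le_of_mul_le_mul_left ?_ (hM1 hX)
      linarith
  -- Maximal regularity bounds the norm in `D` by $K_0(1+M)\|\varphi F\|$, half the reciprocal of
  -- $\varepsilon_0$ at most.
  have h5 : 1 / (2 * (K₀ + 1) * (M + 1)) *
      lpNormOn p (Ioo a b) (fun t => Real.exp (-(4 * M * η * (t - a))) • u t) ≤ 1 / 2 * g := by
    calc _ ≤ 1 / (2 * (K₀ + 1) * (M + 1)) * ((K₀ + 1) * ((1 + M) * g)) := by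
          gcongr
          refine h2.trans ?_
          gcongr
          linarith
      _ = 1 / 2 * g := by field_simp; ring
  linarith

/-- With $F=f-Bu$, the contraction estimate gives $\|\varphi F\|\le\|\varphi f\|+\tfrac34\|\varphi
F\|$, hence $\|\varphi F\|\le4\|f\|$; this is the factor `4` of the theorem. -/
lemma mrNorm_le_of_perturbed (hM1 : Nontrivial X → 0 < M) (hη : 0 ≤ η)
    (hB : StronglyMeasurableOp (Ioo a b) B)
    (hBb : ∀ t ∈ Ioo a b, ∀ x : D,
      ‖B t x‖ ≤ 1 / (2 * (K₀ + 1) * (M + 1)) * ‖x‖ + η * ‖ι x‖)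
    {f : ℝ → X} {u : ℝ → D} (hf : MemLpOn p (Ioo a b) f)
    (hu : ZeroSol p (Ioo a b) a ι A (fun t => f t - B t (u t)) u) :
    mrNorm p (Ioo a b) ι u ≤
      4 * (1 + M) * cP p (-(4 * M * η * (b - a))) * K₀ * lpNormOn p (Ioo a b) f := by
  have hM := S.nonneg
  have hK := S.mrBound.1
  have hl : 0 ≤ 4 * M * η := by positivity
  have hba : 0 ≤ b - a := by linarith [S.hab]
  have h1 := S.lpNormOn_perturbation_le hM1 hη hBb hu
  have hBu := memLpOn_op_apply hη measurableSet_Ioo hB hBb hu.sol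
  have hexp : Continuous fun t => Real.exp (-(4 * M * η * (t - a))) := by fun_prop
  have h2 := lpNormOn_sub_le S.hp.le (hf.continuous_smul hexp) (hBu.continuous_smul hexp)
  simp only [← smul_sub] at h2
  have h3 : lpNormOn p (Ioo a b) (fun t => Real.exp (-(4 * M * η * (t - a))) • f t)
      ≤ 1 * lpNormOn p (Ioo a b) f := by
    refine lpNormOn_le_mul zero_le_one hf ?_
    filter_upwards [ae_restrict_mem measurableSet_Ioo] with t ht
    rw [norm_smul, Real.norm_of_nonneg (Real.exp_pos _).le]
    gcongr
    rw [Real.exp_le_one_iff, neg_nonpos]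
    exact mul_nonneg hl (by linarith [ht.1])
  have h4 := S.mrNorm_le hl hu
  have h5 := S.mrNorm_le_undamped hl hu
  have hc : 0 ≤ cP p (-(4 * M * η * (b - a))) := by
    rw [cP_neg S.hp (by positivity)]
    exact mul_nonneg (alphaP_nonneg _ _) (Real.exp_pos _).le
  calc mrNorm p (Ioo a b) ι u ≤ _ := h5
    _ ≤ cP p (-(4 * M * η * (b - a))) * (K₀ * ((1 + M) * (4 * lpNormOn p (Ioo a b) f))) := by
        gcongr
        refine h4.trans ?_
        gcongr
        linarith
    _ = _ := by ring

lemma exists_perturbed (hM1 : Nontrivial X → 0 < M) (hη : 0 ≤ η)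
    (hB : StronglyMeasurableOp (Ioo a b) B)
    (hBb : ∀ t ∈ Ioo a b, ∀ x : D,
      ‖B t x‖ ≤ 1 / (2 * (K₀ + 1) * (M + 1)) * ‖x‖ + η * ‖ι x‖)
    {f : ℝ → X} (hf : MemLpOn p (Ioo a b) f) :
    ∃ u : ℝ → D, ZeroSol p (Ioo a b) a ι A (fun t => f t - B t (u t)) u := by
  classical
  have hI := isLeftInterval_Ioo S.hab
  set φ : ℝ → ℝ := fun t => Real.exp (-(4 * M * η * (t - a))) with hφ
  set ψ : ℝ → ℝ := fun t => Real.exp (4 * M * η * (t - a)) with hψ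
  have hφc : Continuous φ := by fun_prop
  have hψc : Continuous ψ := by fun_prop
  have hφψ : ∀ t, φ t * ψ t = 1 := fun t => by
    simp only [hφ, hψ]; rw [← Real.exp_add]; simp
  -- The unknown is the damped right-hand side $g=\varphi F$, so that the contraction takes place in
  -- the ordinary $L^p$ norm; `ψ` restores $F=\psi g$. Functions outside $L^p$ get the default value
  -- `0`.
  have hsol : ∀ g : ℝ → X, ∃ u : ℝ → D, MemLpOn p (Ioo a b) g →
      ZeroSol p (Ioo a b) a ι A (fun t => ψ t • g t) u := by
    intro g
    by_cases hg : MemLpOn p (Ioo a b) g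
    · obtain ⟨u, hu⟩ := (S.halfLine a).exists_sol_bounded b (hg.continuous_smul hψc) S.hab
      exact ⟨u, fun _ => hu⟩
    · exact ⟨0, fun h => absurd h hg⟩
  choose u hu using hsol
  have hBu : ∀ g, MemLpOn p (Ioo a b) g → MemLpOn p (Ioo a b) (fun t => B t (u g t)) :=
    fun g hg => memLpOn_op_apply hη measurableSet_Ioo hB hBb (hu g hg).sol
  obtain ⟨g, hg, hfix⟩ := exists_fixed_of_contraction S.hp.le (I := Ioo a b)
    (fun g t => φ t • (f t - B t (u g t))) (c := 3 / 4) (by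
      rw [← NNReal.coe_lt_coe]; norm_num)
    (fun g hg => MemLpOn.continuous_smul (MemLp.sub hf (hBu g hg)) hφc) (fun g g' hg hg' => by
      have h1 := S.lpNormOn_perturbation_le hM1 hη hBb ((hu g hg).sub S.hp.le hI (hu g' hg'))
      have e1 : lpNormOn p (Ioo a b) (fun t => φ t • (f t - B t (u g t))
          - φ t • (f t - B t (u g' t)))
          = lpNormOn p (Ioo a b) (fun t => φ t • B t (u g t - u g' t)) := by
        refine lpNormOn_congr_norm_ae (ae_of_all _ fun t => ?_)
        rw [← smul_sub, sub_sub_sub_cancel_left, map_sub, norm_smul, norm_smul, norm_sub_rev]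
      have e2 : (fun t => φ t • (ψ t • g t - ψ t • g' t)) = fun t => g t - g' t := by
        ext t
        rw [← smul_sub, smul_smul, hφψ, one_smul]
      rw [e1]
      refine h1.trans (le_of_eq ?_)
      rw [e2]
      norm_num)
  refine ⟨u g, (hu g hg).congr_ae hI ?_ (ae_of_all _ fun _ => rfl)⟩
  filter_upwards [hfix] with t ht
  rw [← ht, smul_smul, mul_comm, hφψ, one_smul]

omit [CompleteSpace D] in
/-- The norm of `D` is controlled by the graph norm of `A` with the constant `K₀`. -/
lemma exists_norm_le : ∃ C : ℝ, ∀ x : D, ‖x‖ ≤ K₀ * ‖A x‖ + C * ‖ι x‖ := by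
  have hI := isLeftInterval_Ioo S.hab
  have hp := S.hp
  set n := lpNormOn p (Ioo a b) (fun t : ℝ => t - a) with hn
  have hφ : MemLpOn p (Ioo a b) (fun t : ℝ => t - a) := memLpOn_Ioo_of_continuous (by fun_prop) a b
  have hone : MemLpOn p (Ioo a b) (fun _ : ℝ => (1 : ℝ)) :=
    memLpOn_Ioo_of_continuous (by fun_prop) a b
  have hn0 : 0 < n := by
    refine lt_of_le_of_ne (lpNormOn_nonneg _) fun h => ?_
    have h1 := ae_eq_zero_of_lpNormOn_eq_zero (by linarith) hφ h.symm
    have h2 : ∀ᵐ t ∂(volume.restrict (Ioo a b)), False := by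
      filter_upwards [h1, ae_restrict_mem measurableSet_Ioo] with t h3 h4
      linarith [h4.1]
    have h3 : volume.restrict (Ioo a b) = 0 := by
      rwa [eventually_false_iff_eq_bot, ae_eq_bot] at h2
    rw [Measure.restrict_eq_zero, Real.volume_Ioo, ENNReal.ofReal_eq_zero] at h3
    linarith [S.hab]
  refine ⟨K₀ * lpNormOn p (Ioo a b) (fun _ : ℝ => (1 : ℝ)) / n, fun x => ?_⟩
  -- The test solution $(t-a)x$ has data $x+(t-a)Ax$. Dividing its maximal regularity estimate by
  -- $\|t-a\|_{L^p}$ leaves exactly `K₀` in front of `‖A x‖`, which is what $\varepsilon_0$ can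
  -- absorb.
  have hu : ZeroSol p (Ioo a b) a ι A (fun t => ι x + (t - a) • A x) (fun t => (t - a) • x) := by
    refine ⟨memLpOn_Ioo_of_continuous (by fun_prop) a b,
      memLpOn_Ioo_of_continuous (by fun_prop) a b, ae_of_all _ fun t => ?_⟩
    simp
  have h1 := S.mrBound.2 _ _ hu.data ((isSolution_const_iff hp.le hI hu.data).2 hu)
  have h2 := (S.lpNormOn_le_mrNorm hu).trans h1
  have h3 : lpNormOn p (Ioo a b) (fun t => ι x + (t - a) • A x)
      ≤ ‖ι x‖ * lpNormOn p (Ioo a b) (fun _ : ℝ => (1 : ℝ)) + ‖A x‖ * n := by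
    refine (lpNormOn_add_le hp.le (memLpOn_Ioo_of_continuous (by fun_prop) a b)
      (memLpOn_Ioo_of_continuous (by fun_prop) a b)).trans (add_le_add ?_ ?_)
    · exact lpNormOn_le_mul (norm_nonneg _) hone (ae_of_all _ fun t => by simp)
    · exact lpNormOn_le_mul (norm_nonneg _) hφ (ae_of_all _ fun t => by
        rw [norm_smul, mul_comm])
  have h4 : n * ‖x‖ ≤ lpNormOn p (Ioo a b) (fun t => (t - a) • x) := by
    rcases eq_or_ne x 0 with rfl | hx
    · rw [norm_zero, mul_zero]; exact lpNormOn_nonneg _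
    · have hx0 : 0 < ‖x‖ := norm_pos_iff.2 hx
      have h5 := lpNormOn_le_mul (u := fun t => t - a) (inv_nonneg.2 hx0.le) hu.sol
        (ae_of_all _ fun t => by rw [norm_smul]; field_simp; rfl)
      rwa [inv_mul_eq_div, le_div_iff₀ hx0] at h5
  have h6 : ‖x‖ * n ≤ (K₀ * ‖A x‖
      + K₀ * lpNormOn p (Ioo a b) (fun _ : ℝ => (1 : ℝ)) / n * ‖ι x‖) * n := by
    have h7 := h4.trans (h2.trans (mul_le_mul_of_nonneg_left h3 S.mrBound.1))
    calc ‖x‖ * n = n * ‖x‖ := mul_comm _ _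
      _ ≤ _ := h7
      _ = _ := by field_simp; ring
  exact le_of_mul_le_mul_right h6 hn0

omit [CompleteSpace D] in
/-- The graph norms of the perturbed operators. -/
lemma graphNormEquiv_perturbed (hη : 0 ≤ η)
    (hBb : ∀ t ∈ Ioo a b, ∀ x : D,
      ‖B t x‖ ≤ 1 / (2 * (K₀ + 1) * (M + 1)) * ‖x‖ + η * ‖ι x‖) {t : ℝ} (ht : t ∈ Ioo a b) :
    GraphNormEquiv ι (A + B t) := by
  obtain ⟨C, hC⟩ := S.exists_norm_le
  have hM := S.nonneg
  have hK := S.mrBound.1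
  set R := K₀ + K₀ * η + |C| + 1 with hR
  have hR0 : 0 < R := by positivity
  refine ⟨1 / (2 * R), ‖ι‖ + ‖A + B t‖ + 1, by positivity, by positivity, fun x => ⟨?_, ?_⟩⟩
  · have h1 : ‖A x‖ ≤ ‖(A + B t) x‖ + ‖B t x‖ := by
      have : A x = (A + B t) x - B t x := by simp
      rw [this]; exact norm_sub_le _ _
    -- Since $K_0\varepsilon_0\le\tfrac12$, the contribution of `B t` to the norm of `D` is
    -- absorbed, leaving $\tfrac12\|x\|$ on the left.
    have h2 : K₀ * (1 / (2 * (K₀ + 1) * (M + 1))) ≤ 1 / 2 := by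
      rw [mul_one_div, div_le_div_iff₀ (by positivity) (by positivity)]
      nlinarith [mul_nonneg hK hM]
    have h3 := hBb t ht x
    have h4 : ‖x‖ ≤ K₀ * (‖(A + B t) x‖ + (1 / (2 * (K₀ + 1) * (M + 1)) * ‖x‖ + η * ‖ι x‖))
        + |C| * ‖ι x‖ := by
      refine (hC x).trans (add_le_add (mul_le_mul_of_nonneg_left (by linarith) hK) ?_)
      exact mul_le_mul_of_nonneg_right (le_abs_self C) (norm_nonneg _)
    have h5 := mul_le_mul_of_nonneg_right h2 (norm_nonneg x)
    have h6 : 1 / 2 * ‖x‖ ≤ R * (‖ι x‖ + ‖(A + B t) x‖) := by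
      have e1 : 0 ≤ (K₀ + 1) * ‖ι x‖ := by positivity
      have e2 : 0 ≤ (K₀ * η + |C| + 1) * ‖(A + B t) x‖ := by positivity
      rw [hR]
      nlinarith
    calc 1 / (2 * R) * ‖x‖ = (1 / 2 * ‖x‖) / R := by field_simp
      _ ≤ _ := by rw [div_le_iff₀ hR0]; linarith
  · have h1 := ι.le_opNorm x
    have h2 := (A + B t).le_opNorm x
    nlinarith [norm_nonneg x]

lemma nonautMaxReg_perturbed (hM1 : Nontrivial X → 0 < M) (hη : 0 ≤ η)
    (hB : StronglyMeasurableOp (Ioo a b) B)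
    (hBb : ∀ t ∈ Ioo a b, ∀ x : D,
      ‖B t x‖ ≤ 1 / (2 * (K₀ + 1) * (M + 1)) * ‖x‖ + η * ‖ι x‖) :
    NonautMaxReg p (Ioo a b) ι (fun t => A + B t) ∧
      IsMRBound p (Ioo a b) ι (fun t => A + B t)
        (4 * (1 + M) * cP p (-(4 * M * η * (b - a))) * K₀) := by
  have hI := isLeftInterval_Ioo S.hab
  have hM := S.nonneg
  have hK := S.mrBound.1
  have hba : 0 ≤ b - a := by linarith [S.hab]
  have hiff : ∀ (f : ℝ → X) (u : ℝ → D), MemLpOn p (Ioo a b) f → MemLpOn p (Ioo a b) u →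
      (IsSolution p (Ioo a b) ι (fun t => A + B t) f u ↔
        ZeroSol p (Ioo a b) a ι A (fun t => f t - B t (u t)) u) := by
    intro f u hf hu
    refine isSolution_iff S.hp.le hI (MemLp.sub hf (memLpOn_op_apply hη measurableSet_Ioo hB hBb hu))
      (ae_of_all _ fun t => ?_)
    simp only [add_apply]
    abel
  have hbound : IsMRBound p (Ioo a b) ι (fun t => A + B t)
      (4 * (1 + M) * cP p (-(4 * M * η * (b - a))) * K₀) := by
    refine ⟨?_, fun f u hf hu => ?_⟩
    · rw [cP_neg S.hp (by positivity)]
      have := alphaP_nonneg p (4 * M * η * (b - a))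
      positivity
    · exact S.mrNorm_le_of_perturbed hM1 hη hB hBb hf ((hiff f u hf hu.1.1).1 hu)
  refine ⟨⟨⟨fun x => aestronglyMeasurable_const.add (hB x), fun x => ?_⟩,
    fun t ht => S.graphNormEquiv_perturbed hη hBb ht, fun f hf => ?_, _, hbound⟩, hbound⟩
  · refine ⟨‖A x‖ + (1 / (2 * (K₀ + 1) * (M + 1)) * ‖x‖ + η * ‖ι x‖), ?_⟩
    filter_upwards [ae_restrict_mem measurableSet_Ioo] with t ht
    exact (norm_add_le _ _).trans (add_le_add le_rfl (hBb t ht x))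
  · obtain ⟨u, hu⟩ := S.exists_perturbed hM1 hη hB hBb hf
    refine ⟨u, (hiff f u hf hu.sol).2 hu, fun v hv => ?_⟩
    have hv' := (hiff f v hf hv.1.1).1 hv
    -- The difference of two solutions solves the perturbed problem with zero data, so the a priori
    -- estimate gives uniqueness.
    have hd : ZeroSol p (Ioo a b) a ι A (fun t => 0 - B t (v t - u t)) (fun t => v t - u t) := by
      refine (hv'.sub S.hp.le hI hu).congr_ae hI (ae_of_all _ fun t => ?_) (ae_of_all _ fun _ => rfl)
      rw [map_sub]; abel
    have h0 : MemLpOn p (Ioo a b) (fun _ : ℝ => (0 : X)) := MemLp.zero'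
    have h1 := S.mrNorm_le_of_perturbed hM1 hη hB hBb h0 hd
    have h2 : lpNormOn p (Ioo a b) (fun _ : ℝ => (0 : X)) = 0 := by simp [lpNormOn]
    rw [h2, mul_zero] at h1
    filter_upwards [ae_eq_zero_of_lpNormOn_eq_zero (by linarith [S.hp]) hd.sol
      (le_antisymm ((S.lpNormOn_le_mrNorm hd).trans h1) (lpNormOn_nonneg _))] with t ht
    exact sub_eq_zero.1 ht

end PerturbSetting

end

end MaxReg

end

theorem mainTheorem6 (p : ℝ) (hp : 1 < p) :
    -- the correction in the definition of the constant `c_p`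
    (MaxReg.kappaP p 0 = 1 ∧
      Tendsto (fun ν : ℝ => MaxReg.kappaP p ν / |ν|) atTop (𝓝 0) ∧
      Tendsto (fun ν : ℝ => MaxReg.kappaP p ν / |ν|) atBot (𝓝 0)) ∧
    ∀ {X D : Type*} [NormedAddCommGroup X] [NormedSpace ℝ X] [CompleteSpace X]
      [NormedAddCommGroup D] [NormedSpace ℝ D] [CompleteSpace D]
      (ι : D →L[ℝ] X), Function.Injective ι → DenseRange ι → IsCompactOperator ι →
      ∀ A₀ : D →L[ℝ] X, MaxReg.AutMaxReg p (Ioi 0) ι A₀ →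
        -- `M₀` and the constant of `A₀` on a bounded interval are meaningful
        (∃ T : ℝ≥0 → X →L[ℝ] X, MaxReg.IsSemigroupOf ι A₀ T) ∧
        ∀ T : ℝ≥0 → X →L[ℝ] X, MaxReg.IsSemigroupOf ι A₀ T →
          BddAbove (range fun τ : ℝ≥0 => ‖T τ‖) ∧
          ∀ a b : ℝ, a < b →
            MaxReg.AutMaxReg p (Ioo a b) ι A₀ ∧
            ∀ (B : ℝ → D →L[ℝ] X) (η : ℝ), 0 ≤ η →
              MaxReg.StronglyMeasurableOp (Ioo a b) B →
              (∀ t ∈ Ioo a b, ∀ x : D,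
                ‖B t x‖ ≤
                  1 / (2 * (MaxReg.autConst p (Ioo a b) ι A₀ + 1) *
                    (MaxReg.semigroupSup T + 1)) * ‖x‖ + η * ‖ι x‖) →
              MaxReg.NonautMaxReg p (Ioo a b) ι (fun t => A₀ + B t) ∧
              MaxReg.mrConst p (Ioo a b) ι (fun t => A₀ + B t) ≤
                4 * (1 + MaxReg.semigroupSup T) *
                  MaxReg.cP p (-4 * MaxReg.semigroupSup T * η * (b - a)) *
                  MaxReg.autConst p (Ioo a b) ι A₀ := by
  refine ⟨⟨MaxReg.kappaP_zero hp, MaxReg.tendsto_kappaP_div hp tendsto_abs_atTop_atTop,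
    MaxReg.tendsto_kappaP_div hp tendsto_abs_atBot_atTop⟩, ?_⟩
  intro X D _ _ _ _ _ _ ι hι hd _ A₀ hA₀
  obtain ⟨K, hK⟩ := MaxReg.halfLineMR_zero hp.le hA₀
  have hH : ∀ a, MaxReg.HalfLineMR p ι A₀ K a := hK.shift
  refine ⟨?_, fun T hT => ?_⟩
  · obtain ⟨T, hT, hTu⟩ := MaxReg.HalfLineMR.exists_family hp.le hι hd hH
    exact ⟨T, MaxReg.family_isSemigroupOf hp.le hι hd hA₀.1 hH hT hTu⟩
  have hbdd : BddAbove (range fun τ : ℝ≥0 => ‖T τ‖) := by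
    refine ⟨K ^ 2, ?_⟩
    rintro _ ⟨τ, rfl⟩
    exact (T τ).opNorm_le_bound (sq_nonneg K) fun x => hT.norm_le hp.le hι hd hA₀.1 hH τ x
  refine ⟨hbdd, fun a b hab => ?_⟩
  have haut := MaxReg.HalfLineMR.autMaxReg_Ioo hp.le hι hA₀.1 hH hab
  have hle : ∀ τ, ‖T τ‖ ≤ MaxReg.semigroupSup T := fun τ => le_ciSup hbdd τ
  refine ⟨haut, fun B η hη hB hBb => ?_⟩
  have S : MaxReg.PerturbSetting p a b K (MaxReg.autConst p (Ioo a b) ι A₀)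
      (MaxReg.semigroupSup T) ι A₀ T :=
    { hp := hp
      hab := hab
      inj := hι
      halfLine := hH
      semigroup := hT
      bound := fun τ x => (T τ).le_of_opNorm_le (hle τ) x
      nonneg := (norm_nonneg _).trans (hle 0)
      mrBound := MaxReg.isMRBound_mrConst haut.2.2 }
  -- For nontrivial `X` the identity has norm one, so $M_0\ge\|T(0)\|=1$.
  have hM1 : Nontrivial X → 0 < MaxReg.semigroupSup T := fun _ => by
    have := hle 0
    rw [hT.zero, ContinuousLinearMap.norm_id] at this
    linarith
  obtain ⟨h1, h2⟩ := S.nonautMaxReg_perturbed hM1 hη hB hBb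
  refine ⟨h1, ?_⟩
  have e : -4 * MaxReg.semigroupSup T * η * (b - a)
      = -(4 * MaxReg.semigroupSup T * η * (b - a)) := by ring
  rw [e]
  exact csInf_le ⟨0, fun K hK => hK.1⟩ h2
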